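/- Let $M$ be a smooth (Hausdorff, second countable) manifold of dimension $2n$, let $Z\subset M$ be a closed embedded hypersurface with trivial normal bundle, i.e. $Z$ is the zero set of a smooth function $t$ defined on an open neighbourhood of $Z$ with $dt\neq 0$ at every point of $Z$, and let $\omega$ be a $b$-symplectic form on $(M,Z)$: a closed nondegenerate 2-form on the $b$-tangent bundle ${}^bTM$, the vector bundle whose sections are the smooth vector fields on $M$ that are tangent to $Z$ ($b$-vector fields). A $b$-function is a function $f$, defined and smooth on $M\setminus Z$, which near each point of $Z$ has the form $c\log|t|+g$ with $c\in\mathbb R$, $g$ smooth and $t$ a local defining function of $Z$; its differential is a $b$-form, and its $b$-Hamiltonian vector field $X_f$ is the $b$-vector field with $\iota_{X_f}\omega=-df$. Let $F=(f_1,\dots,f_n)$ be a $b$-integrable system on $(M,\omega)$: the $f_i$ are $b$-functions with $\omega(X_{f_i},X_{f_j})=0$ for all $i,j$, such that $df_1\wedge\dots\wedge df_n$ is nonzero, as a section of $\Lambda^n({}^bT^*M)$, on a dense subset of $M$ and on a dense subset of $Z$. A point is regular if $X_{f_1},\dots,X_{f_n}$ are linearly independent there as ordinary tangent vectors. On the set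 of regular points the distribution spanned by $X_{f_1},\dots,X_{f_n}$ defines a foliation $\varepsilon$; let $\varepsilon_p$ be its leaf (the maximal connected integral manifold) through the regular point $p$. Let $m\in Z$ be a regular point such that $\varepsilon_m$ is compact. Then there exist an open neighbourhood $U$ of $\varepsilon_m$ consisting of regular points and a diffeomorphism $\phi:U\to\mathbb T^n\times B^n$, where $\mathbb T^n=(S^1)^n$ and $B^n$ is the open unit ball of $\mathbb R^n$, which takes the foliation $\varepsilon$ to the trivial foliation $\{\mathbb T^n\times\{b\}\}_{b\in B^n}$: for every $p\in U$ with $\phi(p)=(\theta,b)$ the leaf $\varepsilon_p$ is contained in $U$ and equals $\phi^{-1}(\mathbb T^n\times\{b\})$. -/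

import Mathlib

open scoped Manifold ContDiff Topology

noncomputable section

namespace BSymplectic

section Hypersurfaces

variable (d : ℕ) {M : Type*} [TopologicalSpace M] [ChartedSpace (EuclideanSpace ℝ (Fin d)) M]

/-- `t` is a defining function of `Z` on the open set `U`: it is smooth on `U`, its zero set in `U`
is `Z ∩ U`, and its differential does not vanish at the points of `Z ∩ U`. -/
structure IsDefiningFunction (Z U : Set M) (t : M → ℝ) : Prop where
  isOpen : IsOpen U
  smooth : ContMDiffOn (𝓡 d) 𝓘(ℝ, ℝ) ∞ t U
  mem_iff : ∀ p ∈ U, p ∈ Z ↔ t p = 0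
  mfderiv_ne_zero : ∀ p ∈ U, p ∈ Z → mfderiv (𝓡 d) 𝓘(ℝ, ℝ) t p ≠ 0

/-- `(M, Z)` is a b-manifold: `Z` is a closed embedded hypersurface of `M`. -/
structure IsHypersurface (Z : Set M) : Prop where
  isClosed : IsClosed Z
  exists_defining : ∀ p ∈ Z, ∃ (U : Set M) (t : M → ℝ), p ∈ U ∧ IsDefiningFunction d Z U t

/-- The hypersurface `Z` is cut out by one defining function on a whole neighbourhood of `Z`. -/
def HasTrivialNormalBundle (Z : Set M) : Prop :=
  ∃ (V : Set M) (t : M → ℝ), Z ⊆ V ∧ IsDefiningFunction d Z V t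

/-- A b-function on `(M, Z)`: smooth away from `Z`, and near each point of `Z` of the form
`c log |t| + g` with `c` a real constant, `t` a local defining function and `g` smooth.
A b-function lives on `M ∖ Z`; the values of `f` on `Z` play no role. -/
def IsBFunction (Z : Set M) (f : M → ℝ) : Prop :=
  ContMDiffOn (𝓡 d) 𝓘(ℝ, ℝ) ∞ f Zᶜ ∧
    ∀ p ∈ Z, ∃ (U : Set M) (t g : M → ℝ) (c : ℝ), p ∈ U ∧ IsDefiningFunction d Z U t ∧
      ContMDiffOn (𝓡 d) 𝓘(ℝ, ℝ) ∞ g U ∧ ∀ q ∈ U, q ∉ Z → f q = c * Real.log |t q| + g q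

end Hypersurfaces

section VectorFields

variable (d : ℕ) (M : Type*) [TopologicalSpace M] [ChartedSpace (EuclideanSpace ℝ (Fin d)) M]

/-- The ring `C^∞(M)` of smooth real functions. -/
abbrev SmoothFunctions : Type _ := C^∞⟮𝓡 d, M; 𝓘(ℝ, ℝ), ℝ⟯

variable [IsManifold (𝓡 d) ∞ M]

/-- Smooth vector fields on `M`. -/
abbrev VectorFields : Type _ :=
  Cₛ^∞⟮𝓡 d; EuclideanSpace ℝ (Fin d), (TangentSpace (𝓡 d) : M → Type)⟯

instance : SMul (SmoothFunctions d M) (VectorFields d M) where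
  smul g X := ⟨fun p => g p • X p, ContMDiff.smul_section g.contMDiff X.contMDiff⟩

variable {d M}

theorem smul_vectorField_apply (g : SmoothFunctions d M) (X : VectorFields d M) (p : M) :
    (g • X) p = g p • X p := rfl

/-- The pointwise `C^∞(M)`-module structure on vector fields. -/
instance : Module (SmoothFunctions d M) (VectorFields d M) where
  one_smul X := by ext1 p; exact one_smul ℝ (X p)
  mul_smul g h X := by ext1 p; exact mul_smul (g p) (h p) (X p)
  smul_zero g := by ext1 p; exact smul_zero (g p)
  smul_add g X Y := by ext1 p; exact smul_add (g p) (X p) (Y p)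
  add_smul g h X := by ext1 p; exact add_smul (g p) (h p) (X p)
  zero_smul X := by ext1 p; exact zero_smul ℝ (X p)

/-- The derivative `X_p f` of a real function along a tangent vector. -/
def dirDeriv (f : M → ℝ) (p : M) (v : TangentSpace (𝓡 d) p) : ℝ :=
  mfderiv (𝓡 d) 𝓘(ℝ, ℝ) f p v

variable (d) in
/-- The `C^∞(M)`-module of b-vector fields of `(M, Z)`: the smooth vector fields on `M` that are
tangent to `Z`. It is the module of smooth sections of the b-tangent bundle. -/
def BVectorFields (Z : Set M) : Submodule (SmoothFunctions d M) (VectorFields d M) where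
  carrier := {X | ∀ (U : Set M) (t : M → ℝ), IsDefiningFunction d Z U t →
    ∀ p ∈ U, p ∈ Z → dirDeriv t p (X p) = 0}
  add_mem' {X Y} hX hY U t ht p hp hpZ :=
    (map_add (mfderiv (𝓡 d) 𝓘(ℝ, ℝ) t p) (X p) (Y p)).trans
      ((congrArg₂ (fun a b : ℝ => a + b) (hX U t ht p hp hpZ) (hY U t ht p hp hpZ)).trans
        (add_zero 0))
  zero_mem' _ t _ p _ _ := map_zero (mfderiv (𝓡 d) 𝓘(ℝ, ℝ) t p)
  smul_mem' g X hX U t ht p hp hpZ :=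
    (map_smul (mfderiv (𝓡 d) 𝓘(ℝ, ℝ) t p) (g p) (X p)).trans
      ((congrArg (fun a : ℝ => g p * a) (hX U t ht p hp hpZ)).trans (mul_zero (g p)))

end VectorFields

section Bracket

open VectorField Filter

theorem fderiv_lieBracket_eq_zero {E : Type*} [NormedAddCommGroup E] [NormedSpace ℝ E]
    [CompleteSpace E] {τ : E → ℝ} {V W : E → E} {x : E}
    (hτ : ContDiffAt ℝ 2 τ x) (hV : ContDiffAt ℝ 1 V x) (hW : ContDiffAt ℝ 1 W x)
    (h0 : τ x = 0) (hd : fderiv ℝ τ x ≠ 0)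
    (hVt : ∀ᶠ y in 𝓝 x, τ y = 0 → fderiv ℝ τ y (V y) = 0)
    (hWt : ∀ᶠ y in 𝓝 x, τ y = 0 → fderiv ℝ τ y (W y) = 0) :
    fderiv ℝ τ x (lieBracket ℝ V W x) = 0 := by
  have hdτ : ContDiffAt ℝ 1 (fderiv ℝ τ) x := hτ.fderiv_right (by norm_num)
  have key : ∀ A B : E → E, ContDiffAt ℝ 1 B x →
      (∀ᶠ y in 𝓝 x, τ y = 0 → fderiv ℝ τ y (A y) = 0) →
      (∀ᶠ y in 𝓝 x, τ y = 0 → fderiv ℝ τ y (B y) = 0) →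
      fderiv ℝ τ x (fderiv ℝ B x (A x)) + fderiv ℝ (fderiv ℝ τ) x (A x) (B x) = 0 := by
    intro A B hB hA' hB'
    have hg : ContDiffAt ℝ 1 (fun y => fderiv ℝ τ y (B y)) x := hdτ.clm_apply hB
    have hext : IsLocalExtrOn (fun y => fderiv ℝ τ y (B y)) {y | τ y = τ x} x := by
      left
      have h1 := hB'.self_of_nhds h0
      have : ∀ᶠ y in 𝓝[{y | τ y = τ x}] x, fderiv ℝ τ x (B x) ≤ fderiv ℝ τ y (B y) := by
        filter_upwards [nhdsWithin_le_nhds hB', self_mem_nhdsWithin] with y hy hy'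
        rw [h1, hy (by rw [← h0]; exact hy')]
      exact this
    obtain ⟨a, b, hab, h⟩ := hext.exists_multipliers_of_hasStrictFDerivAt_1d
      (hτ.hasStrictFDerivAt (by norm_num)) (hg.hasStrictFDerivAt (by norm_num))
    have hb : b ≠ 0 := by
      rintro rfl
      apply hd
      have ha : a ≠ 0 := by rintro rfl; exact hab rfl
      simpa [ha] using h
    have h2 := congrArg (fun L : StrongDual ℝ E => L (A x)) h
    simp only [add_apply, smul_apply, zero_apply, hA'.self_of_nhds h0, smul_eq_mul] at h2
    rw [fderiv_clm_apply (hdτ.differentiableAt (by norm_num)) (hB.differentiableAt (by norm_num))]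
      at h2
    simpa [hb] using h2
  have h1 := key V W hW hVt hWt
  have h2 := key W V hV hWt hVt
  have hs : IsSymmSndFDerivAt ℝ τ x := hτ.isSymmSndFDerivAt (by simp)
  rw [lieBracket, map_sub]
  have := hs (V x) (W x)
  linarith

theorem mfderiv_mlieBracket_eq_zero {d : ℕ} {M : Type*} [TopologicalSpace M]
    [ChartedSpace (EuclideanSpace ℝ (Fin d)) M] [IsManifold (𝓡 d) ∞ M] {t : M → ℝ} {X Y : (p : M) → TangentSpace (𝓡 d) p} {p : M}
    (ht : ContMDiffAt (𝓡 d) 𝓘(ℝ, ℝ) ∞ t p)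
    (hX : ContMDiffAt (𝓡 d) (𝓡 d).tangent ∞ (fun q => (⟨q, X q⟩ : TangentBundle (𝓡 d) M)) p)
    (hY : ContMDiffAt (𝓡 d) (𝓡 d).tangent ∞ (fun q => (⟨q, Y q⟩ : TangentBundle (𝓡 d) M)) p)
    (h0 : t p = 0) (hd : mfderiv (𝓡 d) 𝓘(ℝ, ℝ) t p ≠ 0)
    (hXt : ∀ᶠ q in 𝓝 p, t q = 0 → mfderiv (𝓡 d) 𝓘(ℝ, ℝ) t q (X q) = 0)
    (hYt : ∀ᶠ q in 𝓝 p, t q = 0 → mfderiv (𝓡 d) 𝓘(ℝ, ℝ) t q (Y q) = 0) :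
    mfderiv (𝓡 d) 𝓘(ℝ, ℝ) t p (mlieBracket (𝓡 d) X Y p) = 0 := by
  let E := EuclideanSpace ℝ (Fin d)
  let φ := extChartAt (𝓡 d) p
  let x : E := φ p
  let τ : E → ℝ := t ∘ φ.symm
  let V : E → E := mpullbackWithin 𝓘(ℝ, E) (𝓡 d) φ.symm X (Set.range (𝓡 d))
  let W : E → E := mpullbackWithin 𝓘(ℝ, E) (𝓡 d) φ.symm Y (Set.range (𝓡 d))
  have hr : Set.range (𝓡 d) = Set.univ := (𝓡 d).range_eq_univ
  have hxp : φ.symm x = p := extChartAt_to_inv p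
  have hid : (mfderiv (𝓡 d) 𝓘(ℝ, E) φ p) = ContinuousLinearMap.id ℝ E :=
    mfderiv_extChartAt_self
  have hbr : mlieBracket (𝓡 d) X Y p = (lieBracket ℝ V W x : E) := by
    rw [← mlieBracketWithin_univ, mlieBracketWithin_apply]
    simp only [hr, Set.preimage_univ, Set.inter_univ]
    have := congrArg (fun L : E →L[ℝ] E => L.inverse (lieBracket ℝ V W x)) hid
    simp only [ContinuousLinearMap.inverse_id, ContinuousLinearMap.id_apply] at this
    refine Eq.trans ?_ this
    rw [← lieBracketWithin_univ]
    simp only [V, W, hr]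
    rfl
  have htgt : ∀ᶠ y in 𝓝 x, y ∈ φ.target := extChartAt_target_mem_nhds p
  have hcont : Tendsto φ.symm (𝓝 x) (𝓝 p) := by
    have := continuousAt_extChartAt_symm (I := 𝓡 d) p
    rw [ContinuousAt, extChartAt_to_inv] at this
    exact this
  have htn : ∀ᶠ q in 𝓝 p, MDifferentiableAt (𝓡 d) 𝓘(ℝ, ℝ) t q := by
    have h1 : ContMDiffAt (𝓡 d) 𝓘(ℝ, ℝ) 1 t p := ht.of_le (by simp)
    filter_upwards [(contMDiffAt_iff_contMDiffAt_nhds (by simp)).1 h1] with q hq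
      using hq.mdifferentiableAt (by simp)
  have hchain : ∀ᶠ y in 𝓝 x, ∀ v : E, fderiv ℝ τ y
      ((mfderivWithin 𝓘(ℝ, E) (𝓡 d) φ.symm (Set.range (𝓡 d)) y).inverse v) =
        mfderiv (𝓡 d) 𝓘(ℝ, ℝ) t (φ.symm y) v := by
    filter_upwards [htgt, hcont.eventually htn] with y hy hty v
    have hinv := isInvertible_mfderivWithin_extChartAt_symm (I := 𝓡 d) hy
    have hs : MDifferentiableAt 𝓘(ℝ, E) (𝓡 d) φ.symm y := by
      have := mdifferentiableWithinAt_extChartAt_symm (I := 𝓡 d) hy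
      rwa [hr, mdifferentiableWithinAt_univ] at this
    have hc : mfderiv 𝓘(ℝ, E) 𝓘(ℝ, ℝ) τ y = _ := mfderiv_comp y hty hs
    rw [mfderiv_eq_fderiv] at hc
    have hw : mfderivWithin 𝓘(ℝ, E) (𝓡 d) φ.symm (Set.range (𝓡 d)) y
        = mfderiv 𝓘(ℝ, E) (𝓡 d) φ.symm y := by rw [hr, mfderivWithin_univ]
    have h1 := congrArg (fun L : E →L[ℝ] ℝ =>
      L ((mfderivWithin 𝓘(ℝ, E) (𝓡 d) φ.symm (Set.range (𝓡 d)) y).inverse v)) hc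
    refine h1.trans ?_
    rw [← hw]
    exact congrArg (mfderiv (𝓡 d) 𝓘(ℝ, ℝ) t (φ.symm y)) (hinv.self_apply_inverse v)
  have hpt : ∀ (A : (p : M) → TangentSpace (𝓡 d) p),
      (∀ᶠ q in 𝓝 p, t q = 0 → mfderiv (𝓡 d) 𝓘(ℝ, ℝ) t q (A q) = 0) →
      ∀ᶠ y in 𝓝 x, τ y = 0 → fderiv ℝ τ y
        (mpullbackWithin 𝓘(ℝ, E) (𝓡 d) φ.symm A (Set.range (𝓡 d)) y) = 0 := by
    intro A hA
    filter_upwards [hchain, hcont.eventually hA] with y hy hAy h0y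
    rw [mpullbackWithin_apply]
    exact (hy _).trans (hAy h0y)
  have hsm : ∀ (A : (p : M) → TangentSpace (𝓡 d) p),
      ContMDiffAt (𝓡 d) (𝓡 d).tangent ∞ (fun q => (⟨q, A q⟩ : TangentBundle (𝓡 d) M)) p →
      ContDiffAt ℝ 1 (mpullbackWithin 𝓘(ℝ, E) (𝓡 d) φ.symm A (Set.range (𝓡 d)) : E → E) x := by
    intro A hA
    have h := contMDiffWithinAt_mpullbackWithin_extChartAt_symm (n := ∞) (m := 1) (s := Set.univ)
      (V := A) (x := p) (hA.of_le (by simp)).contMDiffWithinAt uniqueMDiffOn_univ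
      (Set.mem_univ _) (by norm_cast)
    rw [Set.preimage_univ, Set.inter_univ] at h
    have h2 := contMDiffWithinAt_vectorSpace_iff_contDiffWithinAt.1 h
    exact h2.contDiffAt (extChartAt_target_mem_nhds p)
  have hτ : ContDiffAt ℝ 2 τ x := by
    have h := (contMDiffAt_iff.1 (ht.of_le (m := 2) (by norm_cast))).2
    rw [hr, contDiffWithinAt_univ] at h
    exact h
  have hv : ∀ v : E, mfderiv (𝓡 d) 𝓘(ℝ, ℝ) t p v = fderiv ℝ τ x v := by
    intro v
    have h := htn.self_of_nhds.mfderiv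
    rw [hr, fderivWithin_univ] at h
    exact congrArg (fun L : E →L[ℝ] ℝ => L v) h
  rw [hbr]
  refine (hv _).trans ?_
  refine fderiv_lieBracket_eq_zero hτ (hsm X hX) (hsm Y hY) ?_ ?_ (hpt X hXt) (hpt Y hYt)
  · simp only [τ, Function.comp, hxp, h0]
  · intro h
    apply hd
    ext v
    refine (hv v).trans ?_
    rw [h]
    rfl

variable {d : ℕ} {M : Type*} [TopologicalSpace M] [ChartedSpace (EuclideanSpace ℝ (Fin d)) M]
  [IsManifold (𝓡 d) ∞ M]

theorem contMDiff_mlieBracket (X Y : VectorFields d M) :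
    ContMDiff (𝓡 d) (𝓡 d).tangent ∞
      (fun p => (⟨p, mlieBracket (𝓡 d) X Y p⟩ : TangentBundle (𝓡 d) M)) := by
  have h2 : IsManifold (𝓡 d) (minSmoothness ℝ 2) M := by
    rw [minSmoothness_of_isRCLikeNormedField]
    exact IsManifold.of_le (n := ∞) (by norm_cast)
  have h3 : IsManifold (𝓡 d) (((⊤ : ℕ∞) : ℕ∞ω) + 1) M :=
    inferInstanceAs (IsManifold (𝓡 d) ∞ M)
  intro p
  exact ContMDiffAt.mlieBracket_vectorField (n := ⊤) (m := ⊤)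
    X.contMDiff.contMDiffAt Y.contMDiff.contMDiffAt (by simp)

/-- The Lie bracket of two b-vector fields, which is again a b-vector field. -/
def bracket {Z : Set M} (X Y : BVectorFields d Z) : BVectorFields d Z :=
  ⟨⟨mlieBracket (𝓡 d) X.1 Y.1, contMDiff_mlieBracket X.1 Y.1⟩,
    fun U t ht p hp hpZ => by
      have hU : U ∈ 𝓝 p := ht.isOpen.mem_nhds hp
      refine mfderiv_mlieBracket_eq_zero ((ht.smooth p hp).contMDiffAt hU)
        X.1.contMDiff.contMDiffAt Y.1.contMDiff.contMDiffAt ((ht.mem_iff p hp).1 hpZ)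
        (ht.mfderiv_ne_zero p hp hpZ) ?_ ?_
      · filter_upwards [hU] with q hq h0 using X.2 U t ht q hq ((ht.mem_iff q hq).2 h0)
      · filter_upwards [hU] with q hq h0 using Y.2 U t ht q hq ((ht.mem_iff q hq).2 h0)⟩

end Bracket

section Forms

variable {d : ℕ} {M : Type*} [TopologicalSpace M] [ChartedSpace (EuclideanSpace ℝ (Fin d)) M]
  [IsManifold (𝓡 d) ∞ M]

variable (d) in
/-- A b-form of degree one on `(M, Z)`, that is, a smooth section of the b-cotangent bundle, given
by its `C^∞(M)`-linear action on b-vector fields. -/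
abbrev BOneForm (Z : Set M) : Type _ := BVectorFields d Z →ₗ[SmoothFunctions d M]
  SmoothFunctions d M

variable (d) in
/-- A `C^∞(M)`-bilinear form on b-vector fields, that is, a smooth section of the second tensor
power of the b-cotangent bundle. -/
abbrev BBilinForm (Z : Set M) : Type _ := BVectorFields d Z →ₗ[SmoothFunctions d M]
  BVectorFields d Z →ₗ[SmoothFunctions d M] SmoothFunctions d M

variable (d) in
/-- The maximal ideal of the smooth functions that vanish at `p`. -/
def idealAt (p : M) : Ideal (SmoothFunctions d M) where
  carrier := {g | g p = 0}
  add_mem' hg hh := (congrArg₂ (fun a b : ℝ => a + b) hg hh).trans (add_zero 0)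
  zero_mem' := rfl
  smul_mem' g _ hh := (congrArg (fun a : ℝ => g p * a) hh).trans (mul_zero (g p))

variable (d) in
/-- The b-vector fields that vanish at `p` as sections of the b-tangent bundle. The fibre of the
b-tangent bundle at `p` is the quotient of `BVectorFields Z` by this submodule. For `p ∈ Z` this is
stronger than the vanishing at `p` of the underlying ordinary vector field. -/
def bVanishingAt (Z : Set M) (p : M) :
    Submodule (SmoothFunctions d M) (BVectorFields d Z) :=
  idealAt d p • ⊤

/-- Closedness of a b-form `Ω` of degree two: the Cartan formula for `dΩ` gives zero on every triple
of b-vector fields. -/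
def IsClosedForm {Z : Set M} (Ω : BBilinForm d Z) : Prop :=
  ∀ (X Y W : BVectorFields d Z) (p : M),
    dirDeriv (Ω Y W) p (X.1 p) - dirDeriv (Ω X W) p (Y.1 p) + dirDeriv (Ω X Y) p (W.1 p)
      - Ω (bracket X Y) W p + Ω (bracket X W) Y p - Ω (bracket Y W) X p = 0

/-- A b-symplectic form on `(M, Z)`: a closed alternating b-form of degree two which is
nondegenerate on every fibre of the b-tangent bundle. -/
structure IsBSymplectic {Z : Set M} (Ω : BBilinForm d Z) : Prop where
  alternating : ∀ X : BVectorFields d Z, Ω X X = 0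
  closed : IsClosedForm Ω
  nondegenerate : ∀ (p : M) (X : BVectorFields d Z),
    (∀ Y : BVectorFields d Z, Ω X Y p = 0) → X ∈ bVanishingAt d Z p

/-- `α` is the differential `df` of the b-function `f`, as a b-form: the smooth function `α Y` is
equal to `Y f` on the dense set `M ∖ Z`. -/
def IsBDifferential {Z : Set M} (f : M → ℝ) (α : BOneForm d Z) : Prop :=
  ∀ (Y : BVectorFields d Z) (p : M), p ∉ Z → α Y p = dirDeriv f p (Y.1 p)

/-- `X` is the b-Hamiltonian vector field of `f`: the contraction of `Ω` with `X` is `-df`. -/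
def IsBHamiltonian {Z : Set M} (Ω : BBilinForm d Z) (f : M → ℝ)
    (X : BVectorFields d Z) : Prop :=
  IsBDifferential f (-(Ω X))

/-- The b-forms `α 0, …, α (k - 1)` are linearly independent in the fibre of the b-cotangent bundle
at `p`; equivalently, their exterior product is nonzero at `p`. -/
def BIndependentAt {Z : Set M} {k : ℕ} (α : Fin k → BOneForm d Z) (p : M) : Prop :=
  LinearIndependent ℝ fun (i : Fin k) (Y : BVectorFields d Z) => α i Y p

end Forms

section Systems

variable {n : ℕ} {M : Type*} [TopologicalSpace M]
  [ChartedSpace (EuclideanSpace ℝ (Fin (2 * n))) M] [IsManifold (𝓡 (2 * n)) ∞ M]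

/-- A b-integrable system on the `2n`-dimensional b-manifold `(M, Z)` with b-symplectic form `Ω`:
`n` b-functions `f i`, with their b-Hamiltonian vector fields `X i` (which the `f i` determine),
that pairwise Poisson commute and whose differentials have a nonzero exterior product, as a section
of the exterior power of the b-cotangent bundle, on a dense subset of `M` and on a dense subset of
`Z`. -/
structure BIntegrableSystem {Z : Set M} (Ω : BBilinForm (2 * n) Z) where
  f : Fin n → M → ℝ
  X : Fin n → BVectorFields (2 * n) Z
  isBFunction : ∀ i, IsBFunction (2 * n) Z (f i)
  isBHamiltonian : ∀ i, IsBHamiltonian Ω (f i) (X i)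
  /-- The Poisson bracket of `f i` and `f j` is, up to sign, `Ω (X i) (X j)`. -/
  commute : ∀ i j, Ω (X i) (X j) = 0
  dense : Dense {p : M | BIndependentAt (fun i => -(Ω (X i))) p}
  dense_on : Z ⊆ closure {p : M | p ∈ Z ∧ BIndependentAt (fun i => -(Ω (X i))) p}

namespace BIntegrableSystem

variable {Z : Set M} {Ω : BBilinForm (2 * n) Z} (F : BIntegrableSystem Ω)

/-- A point is regular if the b-Hamiltonian vector fields of the integrals are linearly independent
there as ordinary tangent vectors. -/
def IsRegular (p : M) : Prop :=
  LinearIndependent ℝ fun i => (F.X i).1 p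

/-- The leaf through `p` of the foliation of the set of regular points that is tangent to the
distribution spanned by the vector fields `X i`: all points that can be joined to `p` by a smooth
curve of regular points which is tangent to the distribution. -/
def leaf (p : M) : Set M :=
  {q | ∃ γ : ℝ → M, ContMDiff 𝓘(ℝ, ℝ) (𝓡 (2 * n)) ∞ γ ∧ γ 0 = p ∧ γ 1 = q ∧
    ∀ s : ℝ, F.IsRegular (γ s) ∧ mfderiv 𝓘(ℝ, ℝ) (𝓡 (2 * n)) γ s (1 : ℝ) ∈
      Submodule.span ℝ (Set.range fun i => (F.X i).1 (γ s))}

end BIntegrableSystem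

end Systems

/-- The torus `𝕋ⁿ`, the `n`-fold power of the circle with its product manifold structure. -/
abbrev Torus (n : ℕ) : Type := Fin n → Circle

/-- The model with corners of `𝕋ⁿ`, the `n`-fold power of the model of the circle. -/
abbrev torusModel (n : ℕ) :=
  ModelWithCorners.pi (fun _ : Fin n => 𝓡 1)

/-- The open unit ball `Bⁿ` of `ℝⁿ`, an open submanifold. -/
def unitBall (n : ℕ) : TopologicalSpace.Opens (EuclideanSpace ℝ (Fin n)) :=
  ⟨Metric.ball 0 1, Metric.isOpen_ball⟩

end BSymplectic

end

open scoped Manifold ContDiff Topology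

/-! The proof follows the Liouville theorem on invariant tori; the work lies in making its local
steps valid across `Z`, where the integrals have logarithmic poles.

Near a regular point of `Z` write `f i = c i * log |t| + g i`. If every `c i` vanished, `dt` and the
`dg i` would be `n + 1` independent covectors killing `n` independent vectors in a space of
dimension `2n` (`exists_ne_zero`). So some `c k ≠ 0`, and `t * exp (g k / c k)` (off `Z`, up to
sign, `exp (f k / c k)`) together with `g i - c i / c k * g k` for `i ≠ k` (off `Z`, `f i - c i / c
k * f k`) are `n` smooth first integrals. They are independent by nondegeneracy of `Ω`
(`surjective_mfderiv_firstIntegrals`). The fields `X i` commute, by closedness of `Ω` off `Z` and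
density of the complement of `Z` (`mlieBracket_eq_zero`). Commuting fields with such integrals can
be straightened (`exists_isFlowBox`): the coframe dual to the `X i` is closed along the level sets,
and a primitive of it supplies the missing coordinates.

The integrals above depend on local choices. What the boxes share is `level`, the sign of `t`
together with the values of the `f i` off `Z`. It is constant on slices and, off `Z`, separates
them; here `t` is the defining function given by the trivial normal bundle. By density of the
complement of `Z`, returning to a box along the flow preserves the slice even over `Z`
(`IsLocalAction.snd_eq`), so the leaf has no holonomy.

The compact leaf lies in `Z`. Finitely many boxes cover it and give the joint flow for small times
on a neighbourhood, and halving the times extends it to all bounds on the times, on shrinking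
neighbourhoods (`exists_forall`). On the leaf this is a transitive action of `ℝⁿ` whose isotropy
group is a lattice (`exists_basis`). A period `b i` of the leaf is corrected to a smoothly varying
period `b i - a i β` of the nearby leaves (`exists_isPeriodMap`). Flowing from a transversal for
times in units of these periods gives angles and transverse parameters (`exists_isTube`), and hence
the diffeomorphism with torus times ball. -/

namespace BSymplectic

/-! ### Smooth dependence of integrals on parameters. -/

section ParametricIntegral

open Set MeasureTheory Metric

universe u

variable {Q G : Type u} [NormedAddCommGroup Q] [NormedSpace ℝ Q] [ProperSpace Q]
  [NormedAddCommGroup G] [NormedSpace ℝ G]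

theorem hasFDerivAt_integral_of_contDiff {F : ℝ × Q → G} (hF : ContDiff ℝ 1 F) (x₀ : Q) :
    HasFDerivAt (fun x => ∫ r in (0 : ℝ)..1, F (r, x))
      (∫ r in (0 : ℝ)..1, (fderiv ℝ F (r, x₀)).comp (ContinuousLinearMap.inr ℝ ℝ Q)) x₀ := by
  have hc : Continuous fun z : ℝ × Q =>
      (fderiv ℝ F z).comp (ContinuousLinearMap.inr ℝ ℝ Q) :=
    (hF.continuous_fderiv (by norm_num)).clm_comp continuous_const
  obtain ⟨C, hC⟩ := ((isCompact_Icc (a := (0 : ℝ)) (b := 1)).prod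
    (isCompact_closedBall x₀ 1)).exists_bound_of_continuousOn hc.continuousOn
  refine intervalIntegral.hasFDerivAt_integral_of_dominated_of_fderiv_le
    (F := fun x r => F (r, x))
    (F' := fun x r => (fderiv ℝ F (r, x)).comp (ContinuousLinearMap.inr ℝ ℝ Q))
    (s := closedBall x₀ 1) (bound := fun _ => C) (closedBall_mem_nhds _ one_pos) ?_ ?_ ?_ ?_ ?_ ?_
  · exact Filter.Eventually.of_forall fun x =>
      (hF.continuous.comp (by fun_prop : Continuous fun r : ℝ => (r, x))).aestronglyMeasurable
  · exact (hF.continuous.comp (by fun_prop : Continuous fun r : ℝ => (r, x₀))).intervalIntegrable _ _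
  · exact (hc.comp (by fun_prop : Continuous fun r : ℝ => (r, x₀))).aestronglyMeasurable
  · refine Filter.Eventually.of_forall fun r hr x hx => hC (r, x) ⟨?_, hx⟩
    rw [uIoc_of_le zero_le_one] at hr
    exact ⟨hr.1.le, hr.2⟩
  · exact intervalIntegrable_const
  · refine Filter.Eventually.of_forall fun r _ x _ => ?_
    exact ((hF.differentiable (by norm_num)) (r, x)).hasFDerivAt.comp x
      (hasFDerivAt_prodMk_right r x)

/-- Differentiation under the integral sign gives an integral of the same kind with values in `Q
→L[ℝ] G`. The induction on the order therefore runs over all targets `G`, which is why `Q` and `G`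
share a universe. -/
theorem contDiff_integral {F : ℝ × Q → G} (hF : ContDiff ℝ ∞ F) :
    ContDiff ℝ ∞ (fun x => ∫ r in (0 : ℝ)..1, F (r, x)) := by
  rw [contDiff_infty]
  intro k
  induction k generalizing G with
  | zero =>
    exact contDiff_zero.2 (intervalIntegral.continuous_parametric_intervalIntegral_of_continuous'
      (f := fun x r => F (r, x)) (hF.continuous.comp continuous_swap) 0 1)
  | succ k ih =>
    push_cast
    rw [contDiff_succ_iff_hasFDerivAt]
    refine ⟨_, ih (F := fun z => (fderiv ℝ F z).comp (ContinuousLinearMap.inr ℝ ℝ Q)) ?_,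
      hasFDerivAt_integral_of_contDiff (hF.of_le (by norm_cast))⟩
    exact (contDiff_infty_iff_fderiv.1 hF).2.clm_comp contDiff_const

end ParametricIntegral

/-! ### Extension of smooth germs. -/

section LocalExtension

variable {Q G : Type*} [NormedAddCommGroup Q] [NormedSpace ℝ Q] [FiniteDimensional ℝ Q]
  [NormedAddCommGroup G] [NormedSpace ℝ G]

/-- Multiplication by a bump function. Globally smooth representatives allow integration along
segments without any care about domains. -/
theorem exists_contDiff_eventuallyEq {f : Q → G} {x : Q}
    (hf : ∀ᶠ y in 𝓝 x, ContDiffAt ℝ ∞ f y) :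
    ∃ g : Q → G, ContDiff ℝ ∞ g ∧ g =ᶠ[𝓝 x] f := by
  obtain ⟨ρ, hρ, hsub⟩ := Metric.eventually_nhds_iff_ball.1 hf
  let χ : ContDiffBump x := ⟨ρ / 3, ρ / 2, by positivity, by linarith⟩
  refine ⟨fun y => χ y • f y, ?_, ?_⟩
  · rw [contDiff_iff_contDiffAt]
    intro y
    by_cases hy : y ∈ Metric.ball x ρ
    · exact χ.contDiff.contDiffAt.smul (hsub y hy)
    · have hy' : y ∉ tsupport χ := by
        rw [χ.tsupport_eq]
        intro h
        apply hy
        exact Metric.closedBall_subset_ball (show χ.rOut < ρ by simp only [χ]; linarith) h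
      refine (contDiffAt_const (c := (0 : G))).congr_of_eventuallyEq ?_
      filter_upwards [(isClosed_tsupport χ).isOpen_compl.mem_nhds hy'] with z hz
      rw [image_eq_zero_of_notMem_tsupport hz, zero_smul]
  · filter_upwards [χ.eventuallyEq_one] with y hy
    rw [hy]
    simp

end LocalExtension

/-! ### Division of a smooth function by a linear form. -/

section Hadamard

variable {Q : Type} [NormedAddCommGroup Q] [NormedSpace ℝ Q] [FiniteDimensional ℝ Q]

/-- Hadamard's division lemma for a hyperplane. -/
theorem exists_eq_mul_of_eq_zero {k : Q → ℝ} {l : Q →L[ℝ] ℝ} {x : Q}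
    (hk : ∀ᶠ y in 𝓝 x, ContDiffAt ℝ ∞ k y) (hx : l x = 0) (hl : l ≠ 0)
    (h0 : ∀ᶠ y in 𝓝 x, l y = 0 → k y = 0) :
    ∃ u : Q → ℝ, ContDiff ℝ ∞ u ∧ ∀ᶠ y in 𝓝 x, k y = l y * u y := by
  have : ProperSpace Q := FiniteDimensional.proper ℝ Q
  obtain ⟨w, hw⟩ : ∃ w, l w = 1 := by
    obtain ⟨v, hv⟩ : ∃ v, l v ≠ 0 := by
      by_contra! h
      exact hl (ContinuousLinearMap.ext h)
    exact ⟨(l v)⁻¹ • v, by simp [hv]⟩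
  obtain ⟨g, hg, hgk⟩ := exists_contDiff_eventuallyEq hk
  -- As `l w = 1`, the path `r ↦ y - ((1 - r) * l y) • w` joins the projection of `y` to the
  -- hyperplane `ker l` with `y` itself. Along it `g` has derivative `l y * F (r, y)`, so the
  -- integral of `F` over `r` is the quotient.
  let F : ℝ × Q → ℝ := fun z => fderiv ℝ g (z.2 - ((1 - z.1) * l z.2) • w) w
  have hF : ContDiff ℝ ∞ F := by
    have := (contDiff_infty_iff_fderiv.1 hg).2
    fun_prop
  refine ⟨fun y => ∫ r in (0 : ℝ)..1, F (r, y), contDiff_integral hF, ?_⟩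
  have hcont : Filter.Tendsto (fun y => y - l y • w) (𝓝 x) (𝓝 x) := by
    have : Continuous fun y => y - l y • w := by fun_prop
    simpa [hx] using this.tendsto x
  filter_upwards [hgk, hcont.eventually hgk, hcont.eventually h0] with y hy hy1 hy2
  have hderiv : ∀ r ∈ Set.uIcc (0 : ℝ) 1,
      HasDerivAt (fun r : ℝ => g (y - ((1 - r) * l y) • w))
        (fderiv ℝ g (y - ((1 - r) * l y) • w) (l y • w)) r := by
    intro r _
    have h1 : HasDerivAt (fun r : ℝ => y - ((1 - r) * l y) • w) (l y • w) r := by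
      have h2 : HasDerivAt (fun r : ℝ => (1 - r) * l y) (-1 * l y) r :=
        ((hasDerivAt_id r).const_sub 1).mul_const (l y)
      simpa using (h2.smul_const w).const_sub y
    exact ((hg.differentiable (by simp)) _).hasFDerivAt.comp_hasDerivAt r h1
  have hint := intervalIntegral.integral_eq_sub_of_hasDerivAt hderiv (by
    apply Continuous.intervalIntegrable
    have := (contDiff_infty_iff_fderiv.1 hg).2.continuous
    fun_prop)
  simp only [map_smul, smul_eq_mul, intervalIntegral.integral_const_mul, sub_self, zero_mul,
    zero_smul, sub_zero, one_mul] at hint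
  simp only [F]
  rw [hint, hy, hy1, hy2 (by simp [hw]), sub_zero]

end Hadamard

/-! ### Poincaré lemma with parameters. -/

section Coframe

universe u

variable {E : Type u} [NormedAddCommGroup E] [NormedSpace ℝ E] [FiniteDimensional ℝ E]

/-- A family of closed coframes has a family of primitives. -/
theorem exists_primitive {θ : E × E → E →L[ℝ] E} (hθ : ContDiff ℝ ∞ θ)
    (hclosed : ∀ᶠ z in 𝓝 (0 : E × E), ∀ v w : E, fderiv ℝ θ z (v, 0) w = fderiv ℝ θ z (w, 0) v) :
    ∃ S : E × E → E, ContDiff ℝ ∞ S ∧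
      ∀ᶠ z in 𝓝 (0 : E × E), ∀ w : E, fderiv ℝ S z (w, 0) = θ z w := by
  have : ProperSpace E := FiniteDimensional.proper ℝ E
  -- The radial primitive of the Poincaré lemma: contraction of `θ` with the position vector,
  -- integrated along the segment from the origin. The second factor of `E × E` is a parameter.
  let F : ℝ × (E × E) → E := fun z => θ (z.1 • z.2.1, z.2.2) z.2.1
  have hF : ContDiff ℝ ∞ F := by fun_prop
  refine ⟨fun z => ∫ r in (0 : ℝ)..1, F (r, z), contDiff_integral hF, ?_⟩
  obtain ⟨ρ, hρ, hball⟩ := Metric.eventually_nhds_iff_ball.1 hclosed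
  filter_upwards [Metric.ball_mem_nhds (0 : E × E) hρ] with z hz w
  rw [(hasFDerivAt_integral_of_contDiff (hF.of_le (by simp)) z).fderiv]
  have hFc : Continuous fun r : ℝ => (fderiv ℝ F (r, z)).comp (ContinuousLinearMap.inr ℝ ℝ (E × E)) :=
    ((hF.continuous_fderiv (by simp)).comp (by fun_prop)).clm_comp continuous_const
  rw [ContinuousLinearMap.intervalIntegral_apply (hFc.intervalIntegrable _ _)]
  have hcont : Continuous fun r : ℝ =>
      ((fderiv ℝ F (r, z)).comp (ContinuousLinearMap.inr ℝ ℝ (E × E))) (w, (0 : E)) := by fun_prop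
  -- Closedness turns the derivative of the integrand in direction `w` into the total derivative of
  -- `r • θ (r • z.1, z.2) w`. The integral then telescopes to `θ z w`.
  have hderiv : ∀ r ∈ Set.uIcc (0 : ℝ) 1, HasDerivAt (fun r : ℝ => r • θ (r • z.1, z.2) w)
      (((fderiv ℝ F (r, z)).comp (ContinuousLinearMap.inr ℝ ℝ (E × E))) (w, (0 : E))) r := by
    intro r hr
    rw [Set.uIcc_of_le zero_le_one] at hr
    have hθd : HasFDerivAt θ (fderiv ℝ θ (r • z.1, z.2)) (r • z.1, z.2) :=
      (hθ.differentiable (by simp) _).hasFDerivAt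
    have hmem : (r • z.1, z.2) ∈ Metric.ball (0 : E × E) ρ := by
      rw [mem_ball_zero_iff] at hz ⊢
      refine lt_of_le_of_lt ?_ hz
      rw [Prod.norm_def, Prod.norm_def]
      refine max_le_max ?_ le_rfl
      rw [norm_smul, Real.norm_of_nonneg hr.1]
      exact mul_le_of_le_one_left (norm_nonneg _) hr.2
    have hsymm := hball _ hmem
    have h1 : HasDerivAt (fun r : ℝ => ((r • z.1, z.2) : E × E)) (z.1, 0) r := by
      have := (hasDerivAt_id r).smul_const z.1
      simp only [id, one_smul] at this
      exact this.prodMk (hasDerivAt_const r z.2)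
    have h2 : HasDerivAt (fun r : ℝ => θ (r • z.1, z.2) w)
        (fderiv ℝ θ (r • z.1, z.2) (z.1, 0) w) r :=
      (ContinuousLinearMap.apply ℝ E w).hasFDerivAt.comp_hasDerivAt r (hθd.comp_hasDerivAt r h1)
    have h3 := (hasDerivAt_id r).smul h2
    have h4 : HasFDerivAt (fun z : E × E => F (r, z))
        ((fderiv ℝ F (r, z)).comp (ContinuousLinearMap.inr ℝ ℝ (E × E))) z :=
      (hF.differentiable (by simp) (r, z)).hasFDerivAt.comp z (hasFDerivAt_prodMk_right r z)
    have h5 : HasDerivAt (fun s : ℝ => F (r, (z.1 + s • w, z.2)))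
        (((fderiv ℝ F (r, z)).comp (ContinuousLinearMap.inr ℝ ℝ (E × E))) (w, (0 : E))) 0 := by
      have hl : HasDerivAt (fun s : ℝ => ((z.1 + s • w, z.2) : E × E)) (w, 0) 0 := by
        have := ((hasDerivAt_id (0 : ℝ)).smul_const w).const_add z.1
        simp only [id, one_smul] at this
        exact this.prodMk (hasDerivAt_const _ z.2)
      refine HasFDerivAt.comp_hasDerivAt (0 : ℝ) (f := fun s : ℝ => ((z.1 + s • w, z.2) : E × E))
        (l := fun z : E × E => F (r, z)) ?_ hl
      simpa using h4
    have h6 : HasDerivAt (fun s : ℝ => F (r, (z.1 + s • w, z.2)))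
        (fderiv ℝ θ (r • z.1, z.2) (r • w, 0) z.1 + θ (r • z.1, z.2) w) 0 := by
      have hl : HasDerivAt (fun s : ℝ => z.1 + s • w) w 0 := by
        have := ((hasDerivAt_id (0 : ℝ)).smul_const w).const_add z.1
        simpa only [id, one_smul] using this
      have hl2 : HasDerivAt (fun s : ℝ => ((r • (z.1 + s • w), z.2) : E × E)) (r • w, 0) 0 :=
        (hl.const_smul r).prodMk (hasDerivAt_const _ z.2)
      have hl3 : HasDerivAt (fun s : ℝ => θ (r • (z.1 + s • w), z.2))
          (fderiv ℝ θ (r • z.1, z.2) (r • w, 0)) 0 := by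
        refine HasFDerivAt.comp_hasDerivAt (0 : ℝ)
          (f := fun s : ℝ => ((r • (z.1 + s • w), z.2) : E × E)) (l := θ) ?_ hl2
        simpa using hθd
      have := hl3.clm_apply hl
      simp only [zero_smul, add_zero] at this
      exact this
    rw [h5.unique h6]
    have hrw : ((r • w, 0) : E × E) = r • (w, 0) := by simp
    rw [hrw, map_smul, smul_apply, hsymm w z.1]
    simp only [one_smul] at h3
    exact h3
  rw [intervalIntegral.integral_eq_sub_of_hasDerivAt hderiv (hcont.intervalIntegrable _ _)]
  simp

end Coframe

end BSymplectic

namespace BSymplectic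

/-! ### The inverse function theorem on manifolds. -/

section InverseFunction

variable {d : ℕ} {M : Type*} [TopologicalSpace M] [ChartedSpace (EuclideanSpace ℝ (Fin d)) M]
  [IsManifold (𝓡 d) ∞ M] {F : Type*} [NormedAddCommGroup F] [NormedSpace ℝ F]

/-- The inverse function theorem on a manifold. -/
theorem exists_chart_of_bijective_mfderiv {f : M → F} {x : M} {W : Set M} (hW : W ∈ 𝓝 x)
    (hf : ∀ᶠ q in 𝓝 x, ContMDiffAt (𝓡 d) 𝓘(ℝ, F) ∞ f q)
    (hbij : Function.Bijective (mfderiv (𝓡 d) 𝓘(ℝ, F) f x)) :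
    ∃ ψ : OpenPartialHomeomorph M F, x ∈ ψ.source ∧ ψ.source ⊆ W ∧ (∀ q, ψ q = f q) ∧
      ContMDiffOn (𝓡 d) 𝓘(ℝ, F) ∞ ψ ψ.source ∧
      ContMDiffOn 𝓘(ℝ, F) (𝓡 d) ∞ ψ.symm ψ.target := by
  let Q := EuclideanSpace ℝ (Fin d)
  let e : OpenPartialHomeomorph M Q := chartAt Q x
  have hx : x ∈ e.source := mem_chart_source Q x
  let g : Q → F := f ∘ e.symm
  have hcont : Filter.Tendsto e.symm (𝓝 (e x)) (𝓝 x) := by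
    have := e.symm.continuousAt (e.map_source hx)
    rwa [ContinuousAt, e.left_inv hx] at this
  have hg : ∀ᶠ y in 𝓝 (e x), ContDiffAt ℝ ∞ g y := by
    filter_upwards [hcont.eventually hf, e.open_target.mem_nhds (e.map_source hx)] with y hy hyt
    have h1 : ContMDiffAt 𝓘(ℝ, Q) (𝓡 d) ∞ e.symm y :=
      (contMDiffOn_chart_symm (I := 𝓡 d) (x := x) y hyt).contMDiffAt (e.open_target.mem_nhds hyt)
    exact (ContMDiffAt.comp y hy h1).contDiffAt
  have hder : Function.Bijective (fderiv ℝ g (e x)) := by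
    have h := hf.self_of_nhds.mdifferentiableAt (by simp) |>.mfderiv
    have h2 : ∀ v : Q, mfderiv (𝓡 d) 𝓘(ℝ, F) f x v = fderiv ℝ g (e x) v := by
      intro v
      rw [(𝓡 d).range_eq_univ, fderivWithin_univ] at h
      exact congrArg (fun L : Q →L[ℝ] F => L v) h
    have h3 : (fun v : Q => fderiv ℝ g (e x) v) = fun v : Q => mfderiv (𝓡 d) 𝓘(ℝ, F) f x v :=
      (funext h2).symm
    show Function.Bijective (fun v : Q => fderiv ℝ g (e x) v)
    rw [h3]
    exact hbij
  have : FiniteDimensional ℝ F :=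
    FiniteDimensional.of_surjective (fderiv ℝ g (e x)).toLinearMap hder.2
  let L : Q ≃L[ℝ] F :=
    (LinearEquiv.ofBijective (fderiv ℝ g (e x)).toLinearMap hder).toContinuousLinearEquiv
  have hL : (L : Q →L[ℝ] F) = fderiv ℝ g (e x) := by ext v; rfl
  have hgx := hg.self_of_nhds
  have hgL : HasFDerivAt g (L : Q →L[ℝ] F) (e x) := by
    rw [hL]
    exact (hgx.differentiableAt (by simp)).hasFDerivAt
  let T := hgx.toOpenPartialHomeomorph g hgL (by simp)
  have hTx : e x ∈ T.source := hgx.mem_toOpenPartialHomeomorph_source hgL (by simp)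
  have hinv : ∀ᶠ y in 𝓝 (e x), ∃ A : Q ≃L[ℝ] F, (A : Q →L[ℝ] F) = fderiv ℝ g y := by
    have hc : ContinuousAt (fderiv ℝ g) (e x) :=
      (hgx.fderiv_right (m := 0) (by simp)).continuousAt
    have h1 := ContinuousLinearEquiv.nhds L
    rw [hL] at h1
    exact hc.eventually h1
  have hgood : ∀ᶠ q in 𝓝 x, q ∈ W ∧ ContMDiffAt (𝓡 d) 𝓘(ℝ, F) ∞ f q ∧
      ContDiffAt ℝ ∞ g (e q) ∧ ∃ A : Q ≃L[ℝ] F, (A : Q →L[ℝ] F) = fderiv ℝ g (e q) := by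
    have hce : Filter.Tendsto e (𝓝 x) (𝓝 (e x)) := e.continuousAt hx
    filter_upwards [hW, hf, hce.eventually hg, hce.eventually hinv] with q h1 h2 h3 h4
      using ⟨h1, h2, h3, h4⟩
  obtain ⟨O, hO, hOopen, hxO⟩ := eventually_nhds_iff.1 hgood
  let T' : OpenPartialHomeomorph Q F := T
  let ψ₀ := e.trans T'
  let O' := O ∩ e.source
  have hψ : ∀ q ∈ e.source, ψ₀ q = f q := by
    intro q hq
    exact congrArg f (e.left_inv hq)
  -- On `O` the map is smooth with invertible derivative at every point, not only at `x`. This makes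
  -- the inverse smooth on the whole target.
  let ψ₁ := ψ₀.restrOpen O' (hOopen.inter e.open_source)
  have hsrc : ∀ q ∈ ψ₁.source, q ∈ O ∧ q ∈ e.source ∧ e q ∈ T.source := by
    intro q hq
    rw [OpenPartialHomeomorph.restrOpen_source] at hq
    exact ⟨hq.2.1, hq.2.2, hq.1.2⟩
  have heq : ∀ q ∈ ψ₁.source, ψ₁ q = f q := fun q hq => hψ q (hsrc q hq).2.1
  -- Taking `f` itself as the underlying map makes `ψ q = f q` hold for every `q`, also outside the
  -- source.
  let ψ : OpenPartialHomeomorph M F :=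
    { toFun := f
      invFun := ψ₁.symm
      source := ψ₁.source
      target := ψ₁.target
      map_source' := fun q hq => by rw [← heq q hq]; exact ψ₁.map_source hq
      map_target' := fun y hy => ψ₁.map_target hy
      left_inv' := fun q hq => by rw [← heq q hq]; exact ψ₁.left_inv hq
      right_inv' := fun y hy => by rw [← heq _ (ψ₁.map_target hy)]; exact ψ₁.right_inv hy
      open_source := ψ₁.open_source
      open_target := ψ₁.open_target
      continuousOn_toFun := ψ₁.continuousOn.congr fun q hq => (heq q hq).symm
      continuousOn_invFun := ψ₁.symm.continuousOn }
  refine ⟨ψ, ?_, fun q hq => (hO q (hsrc q hq).1).1, fun q => rfl, ?_, ?_⟩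
  · show x ∈ ψ₁.source
    rw [OpenPartialHomeomorph.restrOpen_source]
    exact ⟨⟨hx, hTx⟩, hxO, hx⟩
  · exact fun q hq => (hO q (hsrc q hq).1).2.1.contMDiffWithinAt
  · intro y hy
    have hy' : y ∈ ψ₁.target := hy
    obtain ⟨h1, h2, h3⟩ := hsrc _ (ψ₁.map_target hy')
    obtain ⟨-, -, h4, A, hA⟩ := hO _ h1
    have hyT : y ∈ T'.target := by
      have : y ∈ ψ₀.target := by
        have := ψ₁.map_target hy'
        rw [OpenPartialHomeomorph.restrOpen_source] at this
        have h5 := ψ₀.map_source this.1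
        have h6 : ψ₁ (ψ₁.symm y) = y := ψ₁.right_inv hy'
        have h7 : ψ₀ (ψ₁.symm y) = y := h6
        rwa [h7] at h5
      exact this.1
    have hsy : e (ψ₁.symm y) = T'.symm y := by
      show e (e.symm (T'.symm y)) = T'.symm y
      refine e.right_inv ?_
      have : y ∈ ψ₀.target := by
        have := ψ₁.map_target hy'
        rw [OpenPartialHomeomorph.restrOpen_source] at this
        have h5 := ψ₀.map_source this.1
        have h6 : ψ₁ (ψ₁.symm y) = y := ψ₁.right_inv hy'
        have h7 : ψ₀ (ψ₁.symm y) = y := h6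
        rwa [h7] at h5
      exact this.2
    rw [hsy] at h4 hA
    have hTs : ContDiffAt ℝ ∞ T'.symm y := by
      refine T'.contDiffAt_symm (f₀' := A) hyT ?_ h4
      rw [hA]
      exact (h4.differentiableAt (by simp)).hasFDerivAt
    have htt : T'.symm y ∈ e.target := by rw [← hsy]; exact e.map_source h2
    have h5 : ContMDiffAt 𝓘(ℝ, Q) (𝓡 d) ∞ e.symm (T'.symm y) :=
      (contMDiffOn_chart_symm (I := 𝓡 d) (x := x) _ htt).contMDiffAt (e.open_target.mem_nhds htt)
    exact (ContMDiffAt.comp y h5 hTs.contMDiffAt).contMDiffWithinAt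

end InverseFunction

/-! ### The Lie bracket as a commutator of derivations. -/

section Derivations

open VectorField Filter

/-- Expanding both iterated derivatives produces the second derivative of `τ` on `V x` and `W x` in
both orders; its symmetry leaves only the bracket term. -/
theorem fderiv_lieBracket_apply {E : Type*} [NormedAddCommGroup E] [NormedSpace ℝ E]
    {τ : E → ℝ} {V W : E → E} {x : E}
    (hτ : ContDiffAt ℝ 2 τ x) (hV : ContDiffAt ℝ 1 V x) (hW : ContDiffAt ℝ 1 W x) :
    fderiv ℝ τ x (lieBracket ℝ V W x) =
      fderiv ℝ (fun y => fderiv ℝ τ y (W y)) x (V x) -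
        fderiv ℝ (fun y => fderiv ℝ τ y (V y)) x (W x) := by
  have hdτ : DifferentiableAt ℝ (fderiv ℝ τ) x :=
    (hτ.fderiv_right (m := 1) (by norm_num)).differentiableAt (by norm_num)
  rw [fderiv_clm_apply hdτ (hW.differentiableAt (by norm_num)),
    fderiv_clm_apply hdτ (hV.differentiableAt (by norm_num)), lieBracket, map_sub]
  have hs : IsSymmSndFDerivAt ℝ τ x := hτ.isSymmSndFDerivAt (by simp)
  have := hs (V x) (W x)
  simp only [add_apply, ContinuousLinearMap.comp_apply, ContinuousLinearMap.flip_apply]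
  linarith

variable {d : ℕ} {M : Type*} [TopologicalSpace M] [ChartedSpace (EuclideanSpace ℝ (Fin d)) M]
  [IsManifold (𝓡 d) ∞ M]

theorem contMDiffOn_mfderiv_apply {F : Type*} [NormedAddCommGroup F] [NormedSpace ℝ F] {f : M → F}
    {O : Set M} (hO : IsOpen O) (hf : ContMDiffOn (𝓡 d) 𝓘(ℝ, F) ∞ f O) (A : VectorFields d M) :
    ContMDiffOn (𝓡 d) 𝓘(ℝ, F) ∞ (fun q => (mfderiv (𝓡 d) 𝓘(ℝ, F) f q (A q) : F)) O := by
  have h1 := hf.contMDiffOn_tangentMapWithin (m := ∞) (by simp) hO.uniqueMDiffOn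
  have h2 : ContMDiffOn (𝓡 d) (𝓡 d).tangent ∞ (fun q => (⟨q, A q⟩ : TangentBundle (𝓡 d) M)) O :=
    A.contMDiff.contMDiffOn
  have h3 := (contMDiff_snd_tangentBundle_modelSpace F 𝓘(ℝ, F) (n := ∞)).comp_contMDiffOn
    (h1.comp h2 fun q hq => hq)
  refine h3.congr fun q hq => ?_
  show _ = mfderivWithin (𝓡 d) 𝓘(ℝ, F) f O q (A q)
  rw [mfderivWithin_of_isOpen hO hq]

theorem eventually_contMDiffAt_mfderiv_apply {F : Type*} [NormedAddCommGroup F] [NormedSpace ℝ F]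
    {f : M → F} {p : M} (hf : ∀ᶠ q in 𝓝 p, ContMDiffAt (𝓡 d) 𝓘(ℝ, F) ∞ f q)
    (A : VectorFields d M) :
    ∀ᶠ q in 𝓝 p, ContMDiffAt (𝓡 d) 𝓘(ℝ, F) ∞
      (fun q => (mfderiv (𝓡 d) 𝓘(ℝ, F) f q (A q) : F)) q := by
  obtain ⟨O, hO, hOo, hp⟩ := eventually_nhds_iff.1 hf
  filter_upwards [hOo.mem_nhds hp] with q hq
  exact (contMDiffOn_mfderiv_apply hOo (fun q hq => (hO q hq).contMDiffWithinAt) A q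
    hq).contMDiffAt (hOo.mem_nhds hq)

/-- The bracket on `M` is the bracket of the pulled back fields in the chart at `p`, and that chart
has identity derivative at `p`. The identity thus reduces to the one in a vector space. -/
theorem dirDeriv_mlieBracket {f : M → ℝ} {p : M}
    (hf : ∀ᶠ q in 𝓝 p, ContMDiffAt (𝓡 d) 𝓘(ℝ, ℝ) ∞ f q) (X Y : VectorFields d M) :
    dirDeriv f p (mlieBracket (𝓡 d) X Y p) =
      dirDeriv (fun q => dirDeriv f q (Y q)) p (X p) -
        dirDeriv (fun q => dirDeriv f q (X q)) p (Y p) := by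
  let E := EuclideanSpace ℝ (Fin d)
  let φ := extChartAt (𝓡 d) p
  let x : E := φ p
  let τ : E → ℝ := f ∘ φ.symm
  let V : E → E := mpullbackWithin 𝓘(ℝ, E) (𝓡 d) φ.symm X (Set.range (𝓡 d))
  let W : E → E := mpullbackWithin 𝓘(ℝ, E) (𝓡 d) φ.symm Y (Set.range (𝓡 d))
  have hr : Set.range (𝓡 d) = Set.univ := (𝓡 d).range_eq_univ
  have hxp : φ.symm x = p := extChartAt_to_inv p
  have hid : (mfderiv (𝓡 d) 𝓘(ℝ, E) φ p) = ContinuousLinearMap.id ℝ E :=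
    mfderiv_extChartAt_self
  have hbr : mlieBracket (𝓡 d) X Y p = (lieBracket ℝ V W x : E) := by
    rw [← mlieBracketWithin_univ, mlieBracketWithin_apply]
    simp only [hr, Set.preimage_univ, Set.inter_univ]
    have := congrArg (fun L : E →L[ℝ] E => L.inverse (lieBracket ℝ V W x)) hid
    simp only [ContinuousLinearMap.inverse_id, ContinuousLinearMap.id_apply] at this
    refine Eq.trans ?_ this
    rw [← lieBracketWithin_univ]
    simp only [V, W, hr]
    rfl
  have htgt : ∀ᶠ y in 𝓝 x, y ∈ φ.target := extChartAt_target_mem_nhds p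
  have hcont : Tendsto φ.symm (𝓝 x) (𝓝 p) := by
    have := continuousAt_extChartAt_symm (I := 𝓡 d) p
    rw [ContinuousAt, extChartAt_to_inv] at this
    exact this
  have hchain : ∀ᶠ y in 𝓝 x, ∀ v : E, fderiv ℝ τ y
      ((mfderivWithin 𝓘(ℝ, E) (𝓡 d) φ.symm (Set.range (𝓡 d)) y).inverse v) =
        mfderiv (𝓡 d) 𝓘(ℝ, ℝ) f (φ.symm y) v := by
    filter_upwards [htgt, hcont.eventually hf] with y hy hty v
    have hinv := isInvertible_mfderivWithin_extChartAt_symm (I := 𝓡 d) hy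
    have hs : MDifferentiableAt 𝓘(ℝ, E) (𝓡 d) φ.symm y := by
      have := mdifferentiableWithinAt_extChartAt_symm (I := 𝓡 d) hy
      rwa [hr, mdifferentiableWithinAt_univ] at this
    have hc : mfderiv 𝓘(ℝ, E) 𝓘(ℝ, ℝ) τ y = _ :=
      mfderiv_comp y (hty.mdifferentiableAt (by simp)) hs
    rw [mfderiv_eq_fderiv] at hc
    have hw : mfderivWithin 𝓘(ℝ, E) (𝓡 d) φ.symm (Set.range (𝓡 d)) y
        = mfderiv 𝓘(ℝ, E) (𝓡 d) φ.symm y := by rw [hr, mfderivWithin_univ]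
    have h1 := congrArg (fun L : E →L[ℝ] ℝ =>
      L ((mfderivWithin 𝓘(ℝ, E) (𝓡 d) φ.symm (Set.range (𝓡 d)) y).inverse v)) hc
    refine h1.trans ?_
    rw [← hw]
    exact congrArg (mfderiv (𝓡 d) 𝓘(ℝ, ℝ) f (φ.symm y)) (hinv.self_apply_inverse v)
  have hsm : ∀ (A : VectorFields d M),
      ContDiffAt ℝ 1 (mpullbackWithin 𝓘(ℝ, E) (𝓡 d) φ.symm A (Set.range (𝓡 d)) : E → E) x := by
    intro A
    have h := contMDiffWithinAt_mpullbackWithin_extChartAt_symm (n := ∞) (m := 1) (s := Set.univ)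
      (V := A) (x := p) (A.contMDiff.contMDiffAt.of_le (by simp)).contMDiffWithinAt
      uniqueMDiffOn_univ (Set.mem_univ _) (by norm_cast)
    rw [Set.preimage_univ, Set.inter_univ] at h
    have h2 := contMDiffWithinAt_vectorSpace_iff_contDiffWithinAt.1 h
    exact h2.contDiffAt (extChartAt_target_mem_nhds p)
  have hv : ∀ (g : M → ℝ), MDifferentiableAt (𝓡 d) 𝓘(ℝ, ℝ) g p → ∀ v : E,
      dirDeriv g p v = fderiv ℝ (g ∘ φ.symm) x v := by
    intro g hg v
    have h := hg.mfderiv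
    rw [hr, fderivWithin_univ] at h
    exact congrArg (fun L : E →L[ℝ] ℝ => L v) h
  have hτ : ContDiffAt ℝ 2 τ x := by
    have h := (contMDiffAt_iff.1 (hf.self_of_nhds.of_le (m := 2) (by norm_cast))).2
    rw [hr, contDiffWithinAt_univ] at h
    exact h
  have hself : ∀ (A : VectorFields d M),
      (mpullbackWithin 𝓘(ℝ, E) (𝓡 d) φ.symm A (Set.range (𝓡 d)) : E → E) x = (A p : E) := by
    intro A
    have h : (A (φ.symm x) : E) = A p := by rw [hxp]
    rw [mpullbackWithin_apply]
    exact (mfderivWithin_extChartAt_symm_inverse_apply (I := 𝓡 d) (x := p) _).trans h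
  have hfun : ∀ (A : VectorFields d M) (v : E),
      dirDeriv (fun q => dirDeriv f q (A q)) p v = fderiv ℝ (fun y => fderiv ℝ τ y
        (mpullbackWithin 𝓘(ℝ, E) (𝓡 d) φ.symm A (Set.range (𝓡 d)) y)) x v := by
    intro A v
    refine (hv _ ((eventually_contMDiffAt_mfderiv_apply hf A).self_of_nhds.mdifferentiableAt
      (by simp)) v).trans ?_
    refine congrArg (fun L : E →L[ℝ] ℝ => L v) (Filter.EventuallyEq.fderiv_eq ?_)
    filter_upwards [hchain] with y hy
    rw [mpullbackWithin_apply]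
    exact (hy _).symm
  rw [hbr]
  refine (hv f (hf.self_of_nhds.mdifferentiableAt (by simp)) _).trans ?_
  rw [fderiv_lieBracket_apply hτ (hsm X) (hsm Y), hself X, hself Y]
  exact congrArg₂ (fun a b : ℝ => a - b) (hfun Y (X p)).symm (hfun X (Y p)).symm

end Derivations

end BSymplectic

namespace BSymplectic

/-! ### Chain rules for maps into vector spaces. -/

section Calculus

variable {d : ℕ} {M : Type*} [TopologicalSpace M] [ChartedSpace (EuclideanSpace ℝ (Fin d)) M]
  {F F' : Type*} [NormedAddCommGroup F] [NormedSpace ℝ F] [NormedAddCommGroup F'] [NormedSpace ℝ F']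

theorem mfderiv_comp_fderiv_apply {φ : F → F'} {f : M → F} {q : M}
    (hφ : DifferentiableAt ℝ φ (f q)) (hf : MDifferentiableAt (𝓡 d) 𝓘(ℝ, F) f q)
    (v : TangentSpace (𝓡 d) q) :
    (mfderiv (𝓡 d) 𝓘(ℝ, F') (fun q => φ (f q)) q v : F') =
      fderiv ℝ φ (f q) (mfderiv (𝓡 d) 𝓘(ℝ, F) f q v) := by
  have h := mfderiv_comp q hφ.mdifferentiableAt hf
  rw [mfderiv_eq_fderiv] at h
  exact congrArg (fun L : EuclideanSpace ℝ (Fin d) →L[ℝ] F' => L v) h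

theorem mfderiv_clm_comp_apply (l : F →L[ℝ] F') {f : M → F} {q : M}
    (hf : MDifferentiableAt (𝓡 d) 𝓘(ℝ, F) f q) (v : TangentSpace (𝓡 d) q) :
    (mfderiv (𝓡 d) 𝓘(ℝ, F') (fun q => l (f q)) q v : F') = l (mfderiv (𝓡 d) 𝓘(ℝ, F) f q v) := by
  rw [mfderiv_comp_fderiv_apply l.differentiableAt hf, l.fderiv]

theorem dirDeriv_congr {f g : M → ℝ} {q : M} (h : f =ᶠ[𝓝 q] g) (v : TangentSpace (𝓡 d) q) :
    dirDeriv f q v = dirDeriv g q v :=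
  congrArg (fun L : EuclideanSpace ℝ (Fin d) →L[ℝ] ℝ => L v) h.mfderiv_eq

theorem dirDeriv_const (c : ℝ) (q : M) (v : TangentSpace (𝓡 d) q) :
    dirDeriv (fun _ => c) q v = 0 :=
  congrArg (fun L : EuclideanSpace ℝ (Fin d) →L[ℝ] ℝ => L v) (mfderiv_const (c := c) (x := q))

theorem dirDeriv_neg (f : M → ℝ) (q : M) (v : TangentSpace (𝓡 d) q) :
    dirDeriv (fun q => -f q) q v = -dirDeriv f q v :=
  congrArg (fun L : EuclideanSpace ℝ (Fin d) →L[ℝ] ℝ => L v) mfderiv_neg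

end Calculus

/-! ### Defining functions and b-functions near a hypersurface. -/

section Hypersurface

variable {d : ℕ} {M : Type*} [TopologicalSpace M] [ChartedSpace (EuclideanSpace ℝ (Fin d)) M]
  {Z : Set M}

theorem IsDefiningFunction.eventually_contMDiffAt {U : Set M} {t : M → ℝ}
    (h : IsDefiningFunction d Z U t) {p : M} (hp : p ∈ U) :
    ∀ᶠ q in 𝓝 p, ContMDiffAt (𝓡 d) 𝓘(ℝ, ℝ) ∞ t q := by
  filter_upwards [h.isOpen.mem_nhds hp] with q hq
    using (h.smooth q hq).contMDiffAt (h.isOpen.mem_nhds hq)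

/-- At an interior point of `Z` a defining function would vanish identically nearby and have zero
differential. Density is the means by which identities proved off `Z`, where the b-functions live,
pass to `Z`. -/
theorem IsHypersurface.dense_compl (hZ : IsHypersurface d Z) : Dense Zᶜ := by
  rw [← interior_eq_empty_iff_dense_compl]
  by_contra hne
  obtain ⟨p, hp⟩ := Set.nonempty_iff_ne_empty.2 hne
  have hpZ : p ∈ Z := interior_subset hp
  obtain ⟨U, t, hpU, ht⟩ := hZ.exists_defining p hpZ
  refine ht.mfderiv_ne_zero p hpU hpZ ?_
  have h0 : t =ᶠ[𝓝 p] fun _ => (0 : ℝ) := by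
    filter_upwards [ht.isOpen.mem_nhds hpU, isOpen_interior.mem_nhds hp] with q hq hqZ
    exact (ht.mem_iff q hq).1 (interior_subset hqZ)
  ext v
  exact (dirDeriv_congr h0 v).trans (dirDeriv_const 0 p v)

variable [IsManifold (𝓡 d) ∞ M]

/-- Two defining functions of a hypersurface differ by a nowhere vanishing smooth factor. -/
theorem IsDefiningFunction.exists_eq_mul {U V : Set M} {t s : M → ℝ}
    (ht : IsDefiningFunction d Z V t) (hs : IsDefiningFunction d Z U s) {x : M} (hxV : x ∈ V)
    (hxU : x ∈ U) (hxZ : x ∈ Z) :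
    ∃ u : M → ℝ, (∀ᶠ q in 𝓝 x, ContMDiffAt (𝓡 d) 𝓘(ℝ, ℝ) ∞ u q) ∧ u x ≠ 0 ∧
      ∀ᶠ q in 𝓝 x, s q = t q * u q := by
  let Q := EuclideanSpace ℝ (Fin d)
  let e : M → Q := extChartAt (𝓡 d) x
  have he : ∀ᶠ q in 𝓝 x, ContMDiffAt (𝓡 d) 𝓘(ℝ, Q) ∞ e q := by
    filter_upwards [(chartAt Q x).open_source.mem_nhds (mem_chart_source Q x)] with q hq
      using contMDiffAt_extChartAt' hq
  have hed : ∀ v : Q, (mfderiv (𝓡 d) 𝓘(ℝ, Q) e x v : Q) = v := fun v =>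
    congrArg (fun L : Q →L[ℝ] Q => L v) (mfderiv_extChartAt_self (I := 𝓡 d) (x := x))
  let l : Q →L[ℝ] ℝ := mfderiv (𝓡 d) 𝓘(ℝ, ℝ) t x
  have hl : l ≠ 0 := ht.mfderiv_ne_zero x hxV hxZ
  obtain ⟨w, hw⟩ : ∃ w, l w = 1 := by
    obtain ⟨v, hv⟩ : ∃ v, l v ≠ 0 := by
      by_contra! h
      exact hl (ContinuousLinearMap.ext h)
    exact ⟨(l v)⁻¹ • v, by simp [hv]⟩
  have htx : t x = 0 := (ht.mem_iff x hxV).1 hxZ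
  -- The chart is corrected in the direction `w` so that `l (ζ q) = t q`. The correction vanishes to
  -- first order at `x`, so `ζ` is again a chart, in which `Z` is the hyperplane `ker l` and
  -- Hadamard's lemma applies.
  let φ : ℝ × Q → Q := fun z => (z.2 - e x) + (z.1 - l (z.2 - e x)) • w
  have hφ : ContDiff ℝ ∞ φ := by fun_prop
  let ζ : M → Q := fun q => φ (t q, e q)
  have hpair : ∀ᶠ q in 𝓝 x, ContMDiffAt (𝓡 d) 𝓘(ℝ, ℝ × Q) ∞ (fun q => (t q, e q)) q := by
    filter_upwards [he, ht.eventually_contMDiffAt hxV] with q h1 h2 using h2.prodMk_space h1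
  have hζ : ∀ᶠ q in 𝓝 x, ContMDiffAt (𝓡 d) 𝓘(ℝ, Q) ∞ ζ q := by
    filter_upwards [hpair] with q h
    exact hφ.contMDiff.contMDiffAt.comp q h
  have hdζ : ∀ v : Q, (mfderiv (𝓡 d) 𝓘(ℝ, Q) ζ x v : Q) = v := by
    intro v
    have hp := hpair.self_of_nhds.mdifferentiableAt (by simp)
    refine (mfderiv_comp_fderiv_apply (φ := φ) (hφ.differentiable (by simp) _) hp v).trans ?_
    have h1 := mfderiv_clm_comp_apply (ContinuousLinearMap.fst ℝ ℝ Q) hp v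
    have h2 := mfderiv_clm_comp_apply (ContinuousLinearMap.snd ℝ ℝ Q) hp v
    have hL : HasFDerivAt φ ((ContinuousLinearMap.snd ℝ ℝ Q) +
        ((ContinuousLinearMap.fst ℝ ℝ Q) - l.comp (ContinuousLinearMap.snd ℝ ℝ Q)).smulRight w)
        (t x, e x) := by
      have h3 : HasFDerivAt (fun z : ℝ × Q => z.2 - e x) (ContinuousLinearMap.snd ℝ ℝ Q)
        (t x, e x) := hasFDerivAt_snd.sub_const _
      exact h3.add ((hasFDerivAt_fst.sub (l.hasFDerivAt.comp _ h3)).smul_const w)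
    rw [hL.fderiv]
    have h4 : (mfderiv (𝓡 d) 𝓘(ℝ, ℝ × Q) (fun q => (t q, e q)) x v : ℝ × Q) = (l v, v) :=
      Prod.ext h1.symm (h2.symm.trans (hed v))
    rw [h4]
    simp
    rfl
  have hbij : Function.Bijective (mfderiv (𝓡 d) 𝓘(ℝ, Q) ζ x) := by
    have : (fun v : Q => (mfderiv (𝓡 d) 𝓘(ℝ, Q) ζ x v : Q)) = id := funext hdζ
    show Function.Bijective (fun v : Q => (mfderiv (𝓡 d) 𝓘(ℝ, Q) ζ x v : Q))
    rw [this]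
    exact Function.bijective_id
  have hsx := hs.eventually_contMDiffAt hxU
  obtain ⟨O, hO, hOo, hxO⟩ := eventually_nhds_iff.1 ((hζ.and hsx).and
    (Filter.Eventually.and (ht.isOpen.mem_nhds hxV)
      (hs.isOpen.mem_nhds hxU)))
  obtain ⟨ψ, hxψ, hψW, hψζ, hψ, hψs⟩ :=
    exists_chart_of_bijective_mfderiv (hOo.mem_nhds hxO) hζ hbij
  have hlζ : ∀ q, l (ζ q) = t q := by
    intro q
    simp only [ζ, φ, map_add, map_smul, hw, smul_eq_mul, mul_one]
    ring
  have hψx : ψ x ∈ ψ.target := ψ.map_source hxψ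
  have hk : ∀ᶠ y in 𝓝 (ψ x), ContDiffAt ℝ ∞ (fun y => s (ψ.symm y)) y := by
    filter_upwards [ψ.open_target.mem_nhds hψx] with y hy
    have h1 := (hO _ (hψW (ψ.map_target hy))).1.2
    exact (ContMDiffAt.comp y h1 ((hψs y hy).contMDiffAt (ψ.open_target.mem_nhds hy))).contDiffAt
  have h0 : ∀ᶠ y in 𝓝 (ψ x), l y = 0 → s (ψ.symm y) = 0 := by
    filter_upwards [ψ.open_target.mem_nhds hψx] with y hy hly
    obtain ⟨-, h1, h2⟩ := hO _ (hψW (ψ.map_target hy))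
    rw [← hs.mem_iff _ h2, ht.mem_iff _ h1, ← hlζ, ← hψζ, ψ.right_inv hy, hly]
  obtain ⟨u, hu, huk⟩ := exists_eq_mul_of_eq_zero hk (by rw [hψζ, hlζ, htx]) hl h0
  have hev : ∀ᶠ q in 𝓝 x, s q = t q * u (ψ q) := by
    filter_upwards [(ψ.continuousAt hxψ).eventually huk, ψ.open_source.mem_nhds hxψ] with q h1 h2
    rw [ψ.left_inv h2, hψζ q, hlζ] at h1
    rw [h1, hψζ]
  have hus : ∀ᶠ q in 𝓝 x, ContMDiffAt (𝓡 d) 𝓘(ℝ, ℝ) ∞ (fun q => u (ψ q)) q := by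
    filter_upwards [ψ.open_source.mem_nhds hxψ] with q h2
    exact hu.contMDiff.contMDiffAt.comp q ((hψ q h2).contMDiffAt (ψ.open_source.mem_nhds h2))
  -- At `x` the product rule gives `ds = u dt + t du` with `t x = 0`; a zero of `u` at `x` would
  -- force `ds = 0`.
  refine ⟨fun q => u (ψ q), hus, fun hu0 => ?_, hev⟩
  refine hs.mfderiv_ne_zero x hxU hxZ ?_
  ext v
  have hpr : MDifferentiableAt (𝓡 d) 𝓘(ℝ, ℝ × ℝ) (fun q => (t q, u (ψ q))) x :=
    ((ht.eventually_contMDiffAt hxV).self_of_nhds.prodMk_space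
      hus.self_of_nhds).mdifferentiableAt (by simp)
  refine (dirDeriv_congr hev v).trans ?_
  refine (mfderiv_comp_fderiv_apply (φ := fun z : ℝ × ℝ => z.1 * z.2)
    (f := fun q => (t q, u (ψ q))) (by fun_prop) hpr v).trans ?_
  have : HasFDerivAt (fun z : ℝ × ℝ => z.1 * z.2) (0 : ℝ × ℝ →L[ℝ] ℝ) (t x, u (ψ x)) := by
    have := (hasFDerivAt_fst (𝕜 := ℝ) (p := (t x, u (ψ x)))).mul
      (hasFDerivAt_snd (𝕜 := ℝ) (p := (t x, u (ψ x))))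
    have h0 : (t x) • ContinuousLinearMap.snd ℝ ℝ ℝ + (u (ψ x)) • ContinuousLinearMap.fst ℝ ℝ ℝ
        = 0 := by rw [htx, show u (ψ x) = 0 from hu0]; simp
    rw [← h0]
    exact this
  rw [this.fderiv]
  rfl

/-- A b-function in terms of a prescribed defining function. -/
theorem IsBFunction.exists_eq_log {f : M → ℝ} (hf : IsBFunction d Z f) {V : Set M} {t : M → ℝ}
    (ht : IsDefiningFunction d Z V t) {x : M} (hxV : x ∈ V) (hxZ : x ∈ Z) :
    ∃ (c : ℝ) (g : M → ℝ), (∀ᶠ q in 𝓝 x, ContMDiffAt (𝓡 d) 𝓘(ℝ, ℝ) ∞ g q) ∧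
      ∀ᶠ q in 𝓝 x, q ∉ Z → f q = c * Real.log |t q| + g q := by
  obtain ⟨U, s, g, c, hxU, hs, hg, hfg⟩ := hf.2 x hxZ
  obtain ⟨u, hu, hux, hsu⟩ := ht.exists_eq_mul hs hxV hxU hxZ
  have hu0 : ∀ᶠ q in 𝓝 x, u q ≠ 0 :=
    hu.self_of_nhds.continuousAt.eventually (isOpen_ne.mem_nhds hux)
  -- `Real.log` depends only on the absolute value of its argument, so `log (u q)` is smooth
  -- wherever `u ≠ 0`, whatever the sign of `u`.
  refine ⟨c, fun q => c * Real.log (u q) + g q, ?_, ?_⟩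
  · filter_upwards [hu, hu0, hs.isOpen.mem_nhds hxU] with q h1 h2 h3
    have hl : ContMDiffAt (𝓡 d) 𝓘(ℝ, ℝ) ∞ (fun q => Real.log (u q)) q :=
      (Real.contDiffAt_log.2 h2).contMDiffAt.comp q h1
    exact (contMDiffAt_const.mul hl).add ((hg q h3).contMDiffAt (hs.isOpen.mem_nhds h3))
  · filter_upwards [hsu, hu0, hs.isOpen.mem_nhds hxU, ht.isOpen.mem_nhds hxV] with q h1 h2 h3 h4 h5
    have ht0 : t q ≠ 0 := fun h => h5 ((ht.mem_iff q h4).2 h)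
    rw [hfg q h3 h5, h1, Real.log_abs, Real.log_abs, Real.log_mul ht0 h2]
    ring

end Hypersurface

end BSymplectic

namespace BSymplectic

/-! ### Pointwise algebra of b-vector fields. -/

section Fibre

variable {d : ℕ} {M : Type*} [TopologicalSpace M] [ChartedSpace (EuclideanSpace ℝ (Fin d)) M]
  [IsManifold (𝓡 d) ∞ M] {Z : Set M}

theorem eq_zero_of_mem_bVanishingAt {p : M} {X : BVectorFields d Z}
    (hX : X ∈ bVanishingAt d Z p) : X.1 p = 0 := by
  refine Submodule.smul_induction_on hX (fun g hg Y _ => ?_) (fun Y W hY hW => ?_)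
  · have hg0 : g p = 0 := hg
    show g p • Y.1 p = 0
    rw [hg0, zero_smul]
  · show Y.1 p + W.1 p = 0
    rw [hY, hW, add_zero]

theorem exists_combination {k : ℕ} (Ω : BBilinForm d Z) (X : Fin k → BVectorFields d Z)
    (a : Fin k → ℝ) : ∃ W : BVectorFields d Z, (∀ p, W.1 p = ∑ i, a i • (X i).1 p) ∧
      ∀ (Y : BVectorFields d Z) (p : M), Ω W Y p = ∑ i, a i * Ω (X i) Y p := by
  induction k with
  | zero => exact ⟨0, fun p => by simp, fun Y p => by simp⟩
  | succ k ih =>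
    obtain ⟨W, h1, h2⟩ := ih (fun i => X i.succ) (fun i => a i.succ)
    let c : SmoothFunctions d M := ⟨fun _ => a 0, contMDiff_const⟩
    refine ⟨c • X 0 + W, fun p => ?_, fun Y p => ?_⟩
    · rw [Fin.sum_univ_succ, ← h1]
      rfl
    · rw [Fin.sum_univ_succ, ← h2, map_add, map_smul]
      rfl

end Fibre

/-! ### Commutation of the b-Hamiltonian vector fields. -/

section Hamiltonian

variable {n : ℕ} {M : Type*} [TopologicalSpace M]
  [ChartedSpace (EuclideanSpace ℝ (Fin (2 * n))) M] [IsManifold (𝓡 (2 * n)) ∞ M]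
  {Z : Set M} {Ω : BBilinForm (2 * n) Z} (F : BIntegrableSystem Ω)

theorem IsBSymplectic.swap {d : ℕ} {M : Type*} [TopologicalSpace M]
    [ChartedSpace (EuclideanSpace ℝ (Fin d)) M] [IsManifold (𝓡 d) ∞ M] {Z : Set M}
    {Ω : BBilinForm d Z} (hΩ : IsBSymplectic Ω) (X Y : BVectorFields d Z) :
    Ω X Y = -Ω Y X := by
  have h := hΩ.alternating (X + Y)
  simp only [map_add, LinearMap.add_apply, hΩ.alternating, zero_add, add_zero] at h
  exact eq_neg_of_add_eq_zero_right h

namespace BIntegrableSystem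

theorem apply_eq_dirDeriv (i : Fin n) (Y : BVectorFields (2 * n) Z) {p : M} (hp : p ∉ Z) :
    Ω (F.X i) Y p = -dirDeriv (F.f i) p (Y.1 p) := by
  rw [← F.isBHamiltonian i Y p hp]
  show _ = -(-(Ω (F.X i) Y p))
  ring

theorem eventually_contMDiffAt (hZ : IsHypersurface (2 * n) Z) (i : Fin n) {p : M} (hp : p ∉ Z) :
    ∀ᶠ q in 𝓝 p, ContMDiffAt (𝓡 (2 * n)) 𝓘(ℝ, ℝ) ∞ (F.f i) q := by
  filter_upwards [hZ.isClosed.isOpen_compl.mem_nhds hp] with q hq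
  exact ((F.isBFunction i).1 q hq).contMDiffAt (hZ.isClosed.isOpen_compl.mem_nhds hq)

theorem dirDeriv_apply (hZ : IsHypersurface (2 * n) Z) (i : Fin n) (Y : BVectorFields (2 * n) Z)
    {p : M} (hp : p ∉ Z) (v : TangentSpace (𝓡 (2 * n)) p) :
    dirDeriv (Ω (F.X i) Y) p v = -dirDeriv (fun q => dirDeriv (F.f i) q (Y.1 q)) p v := by
  rw [← dirDeriv_neg]
  refine dirDeriv_congr ?_ v
  filter_upwards [hZ.isClosed.isOpen_compl.mem_nhds hp] with q hq using F.apply_eq_dirDeriv i Y hq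

/-- The b-Hamiltonian vector fields of a b-integrable system commute. -/
theorem mlieBracket_eq_zero (hZ : IsHypersurface (2 * n) Z) (hΩ : IsBSymplectic Ω) (i j : Fin n)
    (p : M) : VectorField.mlieBracket (𝓡 (2 * n)) (F.X i).1 (F.X j).1 p = 0 := by
  -- Off `Z` all terms of the Cartan formula for `X i`, `X j`, `W` are iterated derivatives of the
  -- integrals. Poisson commutation kills those that differentiate `f k` along `X l`; the others
  -- cancel in pairs, except the term with the bracket of `X i` and `X j`.
  have key : ∀ (W : BVectorFields (2 * n) Z) (q : M), q ∉ Z →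
      Ω (bracket (F.X i) (F.X j)) W q = 0 := by
    intro W q hq
    have h := hΩ.closed (F.X i) (F.X j) W q
    have hzero : ∀ k l, dirDeriv (fun q => dirDeriv (F.f k) q ((F.X l).1 q)) q (W.1 q) = 0 := by
      intro k l
      have h1 := F.dirDeriv_apply hZ k (F.X l) hq (W.1 q)
      rw [F.commute] at h1
      have h2 : dirDeriv (⇑(0 : SmoothFunctions (2 * n) M)) q (W.1 q) = 0 := dirDeriv_const 0 q _
      linarith
    have h1 : dirDeriv (Ω (F.X i) (F.X j)) q (W.1 q) = 0 := by
      rw [F.commute]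
      exact dirDeriv_const 0 q _
    have hbr : ∀ k l, Ω (bracket (F.X k) W) (F.X l) q =
        dirDeriv (fun q => dirDeriv (F.f l) q (W.1 q)) q ((F.X k).1 q) := by
      intro k l
      rw [hΩ.swap]
      have h2 := F.apply_eq_dirDeriv l (bracket (F.X k) W) hq
      have h3 := dirDeriv_mlieBracket (F.eventually_contMDiffAt hZ l hq) (F.X k).1 W.1
      have h4 : dirDeriv (F.f l) q ((bracket (F.X k) W).1 q) =
        dirDeriv (F.f l) q (VectorField.mlieBracket (𝓡 (2 * n)) (F.X k).1 W.1 q) := rfl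
      rw [h4, h3, hzero l k] at h2
      show -(Ω (F.X l) (bracket (F.X k) W) q) = _
      rw [h2]
      ring
    rw [h1, hbr i j, hbr j i, F.dirDeriv_apply hZ j W hq, F.dirDeriv_apply hZ i W hq] at h
    linarith
  have key' : ∀ W : BVectorFields (2 * n) Z, Ω (bracket (F.X i) (F.X j)) W p = 0 := by
    intro W
    have hc : Continuous (Ω (bracket (F.X i) (F.X j)) W) := (ContMDiffMap.contMDiff _).continuous
    exact congrFun (hc.ext_on hZ.dense_compl continuous_const (fun q hq => key W q hq)) p
  exact eq_zero_of_mem_bVanishingAt (hΩ.nondegenerate p _ key')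

end BIntegrableSystem

end Hamiltonian

end BSymplectic

namespace BSymplectic

section Calculus

variable {d : ℕ} {M : Type*} [TopologicalSpace M] [ChartedSpace (EuclideanSpace ℝ (Fin d)) M]
  {F F' : Type*} [NormedAddCommGroup F] [NormedSpace ℝ F] [NormedAddCommGroup F'] [NormedSpace ℝ F']

theorem mfderiv_prodMk_apply {f : M → F} {g : M → F'} {q : M}
    (hf : MDifferentiableAt (𝓡 d) 𝓘(ℝ, F) f q) (hg : MDifferentiableAt (𝓡 d) 𝓘(ℝ, F') g q)
    (v : TangentSpace (𝓡 d) q) :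
    (mfderiv (𝓡 d) 𝓘(ℝ, F × F') (fun q => (f q, g q)) q v : F × F') =
      (mfderiv (𝓡 d) 𝓘(ℝ, F) f q v, mfderiv (𝓡 d) 𝓘(ℝ, F') g q v) := by
  have hp := hf.prodMk_space hg
  exact Prod.ext (mfderiv_clm_comp_apply (ContinuousLinearMap.fst ℝ F F') hp v).symm
    (mfderiv_clm_comp_apply (ContinuousLinearMap.snd ℝ F F') hp v).symm

end Calculus

/-! ### Frames spanned by the vector fields, and flow boxes. -/

section LinearAlgebra

/-- A preimage under `L` can be moved within the image of `ι` to correct `l` without disturbing `L`.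
In the applications `ι` is the frame of the `X i` and `L` the differential of functions constant
along the leaves. -/
theorem surjective_prod_of_section {Q A B : Type*} [AddCommGroup Q] [Module ℝ Q] [AddCommGroup A]
    [Module ℝ A] [AddCommGroup B] [Module ℝ B] {l : Q →ₗ[ℝ] A} {L : Q →ₗ[ℝ] B} {ι : A →ₗ[ℝ] Q}
    (hl : ∀ a, l (ι a) = a) (hL : ∀ a, L (ι a) = 0) (hs : Function.Surjective L) :
    Function.Surjective (l.prod L) := by
  rintro ⟨a, b⟩
  obtain ⟨v, rfl⟩ := hs b
  exact ⟨v + ι (a - l v), by simp [hl, hL]⟩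

end LinearAlgebra

section Frame

variable {n d : ℕ} {M : Type*} [TopologicalSpace M] [ChartedSpace (EuclideanSpace ℝ (Fin d)) M]
  [IsManifold (𝓡 d) ∞ M]

/-- The linear map that sends the coefficients `s` to the combination `∑ i, s i • X i p`. -/
noncomputable def frame (X : Fin n → VectorFields d M) (p : M) :
    EuclideanSpace ℝ (Fin n) →L[ℝ] TangentSpace (𝓡 d) p :=
  ∑ i, (EuclideanSpace.proj i : EuclideanSpace ℝ (Fin n) →L[ℝ] ℝ).smulRight (X i p)

theorem frame_apply (X : Fin n → VectorFields d M) (p : M) (s : EuclideanSpace ℝ (Fin n)) :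
    frame X p s = ∑ i, s i • X i p := by
  simp only [frame, FunLike.coe_sum, Finset.sum_apply]
  rfl

theorem frame_single (X : Fin n → VectorFields d M) (p : M) (i : Fin n) :
    frame X p (EuclideanSpace.single i 1) = X i p := by
  rw [frame_apply, Finset.sum_eq_single i]
  · simp
  · intro j _ hj
    simp [hj]
  · simp

theorem frame_injective {X : Fin n → VectorFields d M} {p : M}
    (h : LinearIndependent ℝ fun i => X i p) : Function.Injective (frame X p) := by
  rw [injective_iff_map_eq_zero]
  intro s hs
  rw [frame_apply] at hs
  ext i
  exact Fintype.linearIndependent_iff.1 h (fun i => s i) hs i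

theorem linearIndependent_of_frame_injective {X : Fin n → VectorFields d M} {p : M}
    (h : Function.Injective (frame X p)) : LinearIndependent ℝ fun i => X i p := by
  rw [Fintype.linearIndependent_iff]
  intro s hs i
  have := (injective_iff_map_eq_zero (frame X p)).1 h (WithLp.toLp 2 s)
    (by rw [frame_apply]; exact hs)
  exact congrArg (fun v : EuclideanSpace ℝ (Fin n) => v i) this

theorem frame_mem_span (X : Fin n → VectorFields d M) (p : M) (s : EuclideanSpace ℝ (Fin n)) :
    frame X p s ∈ Submodule.span ℝ (Set.range fun i => X i p) := by
  rw [frame_apply]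
  exact Submodule.sum_mem _ fun i _ => Submodule.smul_mem _ _ (Submodule.subset_span ⟨i, rfl⟩)

/-- A chart in which the vector fields `X i` are the first coordinate vector fields. -/
structure IsFlowBox (X : Fin n → VectorFields d M)
    (ψ : OpenPartialHomeomorph M (EuclideanSpace ℝ (Fin n) × EuclideanSpace ℝ (Fin n))) :
    Prop where
  smooth : ContMDiffOn (𝓡 d) 𝓘(ℝ, EuclideanSpace ℝ (Fin n) × EuclideanSpace ℝ (Fin n)) ∞ ψ ψ.source
  smooth_symm :
    ContMDiffOn 𝓘(ℝ, EuclideanSpace ℝ (Fin n) × EuclideanSpace ℝ (Fin n)) (𝓡 d) ∞ ψ.symm ψ.target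
  mfderiv_frame : ∀ q ∈ ψ.source, ∀ s : EuclideanSpace ℝ (Fin n),
    (mfderiv (𝓡 d) 𝓘(ℝ, EuclideanSpace ℝ (Fin n) × EuclideanSpace ℝ (Fin n)) ψ q (frame X q s) :
      EuclideanSpace ℝ (Fin n) × EuclideanSpace ℝ (Fin n)) = (s, 0)

end Frame

/-! ### Logarithmic normal form of the integrals near `Z`. -/

section NormalForm

variable {n : ℕ} {M : Type*} [TopologicalSpace M]
  [ChartedSpace (EuclideanSpace ℝ (Fin (2 * n))) M] [IsManifold (𝓡 (2 * n)) ∞ M]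
  {Z : Set M} {Ω : BBilinForm (2 * n) Z}

namespace BIntegrableSystem

/-- On the open set `O` the integrals are `c i * log |t| + g i` with `g i` smooth. -/
structure IsNormalForm (F : BIntegrableSystem Ω) (t : M → ℝ) (O : Set M) (c : Fin n → ℝ)
    (g : Fin n → M → ℝ) : Prop where
  defining : IsDefiningFunction (2 * n) Z O t
  smooth : ∀ i, ∀ q ∈ O, ContMDiffAt (𝓡 (2 * n)) 𝓘(ℝ, ℝ) ∞ (g i) q
  eq_log : ∀ i, ∀ q ∈ O, q ∉ Z → F.f i q = c i * Real.log |t q| + g i q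

theorem exists_isNormalForm (F : BIntegrableSystem Ω) {V : Set M} {t : M → ℝ}
    (ht : IsDefiningFunction (2 * n) Z V t) {x : M} (hxV : x ∈ V) (hxZ : x ∈ Z) :
    ∃ O c g, x ∈ O ∧ O ⊆ V ∧ F.IsNormalForm t O c g := by
  choose c g hg hf using fun i => (F.isBFunction i).exists_eq_log ht hxV hxZ
  obtain ⟨O, hO, hOo, hx⟩ := eventually_nhds_iff.1 ((Filter.eventually_all.2 hg).and
    (Filter.eventually_all.2 hf))
  refine ⟨O ∩ V, c, g, ⟨hx, hxV⟩, Set.inter_subset_right, ⟨hOo.inter ht.isOpen, ?_, ?_, ?_⟩, ?_, ?_⟩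
  · exact ht.smooth.mono Set.inter_subset_right
  · exact fun p hp => ht.mem_iff p hp.2
  · exact fun p hp => ht.mfderiv_ne_zero p hp.2
  · exact fun i q hq => (hO q hq.1).1 i
  · exact fun i q hq => (hO q hq.1).2 i

namespace IsNormalForm

variable {F : BIntegrableSystem Ω} {t : M → ℝ} {O : Set M} {c : Fin n → ℝ} {g : Fin n → M → ℝ}

theorem contMDiffAt (h : F.IsNormalForm t O c g) {q : M} (hq : q ∈ O) :
    ContMDiffAt (𝓡 (2 * n)) 𝓘(ℝ, ℝ) ∞ t q :=
  (h.defining.smooth q hq).contMDiffAt (h.defining.isOpen.mem_nhds hq)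

/-- Multiplication by `t` clears the pole of `df i = c i dt / t + dg i`. On `Z` both sides vanish
because b-vector fields are tangent to `Z`. -/
theorem mul_apply (h : F.IsNormalForm t O c g) {q : M} (hq : q ∈ O) (i : Fin n)
    (Y : BVectorFields (2 * n) Z) :
    t q * Ω (F.X i) Y q =
      -(c i * dirDeriv t q (Y.1 q) + t q * dirDeriv (g i) q (Y.1 q)) := by
  by_cases hqZ : q ∈ Z
  · have h0 : t q = 0 := (h.defining.mem_iff q hq).1 hqZ
    have h1 : dirDeriv t q (Y.1 q) = 0 := Y.2 O t h.defining q hq hqZ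
    rw [h0, h1]
    ring
  · have h0 : t q ≠ 0 := fun h0 => hqZ ((h.defining.mem_iff q hq).2 h0)
    have hc : Filter.Tendsto t (𝓝 q) (𝓝 (t q)) := (h.contMDiffAt hq).continuousAt
    have heq : F.f i =ᶠ[𝓝 q] fun q => c i * Real.log (t q) + g i q := by
      filter_upwards [h.defining.isOpen.mem_nhds hq, hc.eventually (isOpen_ne.mem_nhds h0)]
        with r hr hr0
      rw [h.eq_log i r hr fun hrZ => hr0 ((h.defining.mem_iff r hr).1 hrZ), Real.log_abs]
    rw [F.apply_eq_dirDeriv i Y hqZ, dirDeriv_congr heq]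
    have hd : HasFDerivAt (fun z : ℝ × ℝ => c i * Real.log z.1 + z.2)
        (c i • (t q)⁻¹ • ContinuousLinearMap.fst ℝ ℝ ℝ + ContinuousLinearMap.snd ℝ ℝ ℝ)
        (t q, g i q) :=
      (((hasFDerivAt_fst (𝕜 := ℝ) (p := (t q, g i q))).log h0).const_mul (c i)).add hasFDerivAt_snd
    have ht' := (h.contMDiffAt hq).mdifferentiableAt (by simp)
    have hg' := (h.smooth i q hq).mdifferentiableAt (by simp)
    have h1 := mfderiv_comp_fderiv_apply (φ := fun z : ℝ × ℝ => c i * Real.log z.1 + z.2)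
      (f := fun q => (t q, g i q)) hd.differentiableAt (ht'.prodMk_space hg') (Y.1 q)
    rw [hd.fderiv, mfderiv_prodMk_apply ht' hg'] at h1
    have h2 : dirDeriv (fun q => c i * Real.log (t q) + g i q) q (Y.1 q) =
      c i * ((t q)⁻¹ * dirDeriv t q (Y.1 q)) + dirDeriv (g i) q (Y.1 q) := h1
    rw [h2]
    field_simp

/-- When `∑ i, a i * c i = 0` the logarithms cancel. The identity is clear off `Z` after division by
`t`, and both sides are continuous, so it extends over `Z` by density. -/
theorem sum_apply (hZ : IsHypersurface (2 * n) Z) (h : F.IsNormalForm t O c g) {q : M} (hq : q ∈ O)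
    (Y : BVectorFields (2 * n) Z) {a : Fin n → ℝ} (ha : ∑ i, a i * c i = 0) :
    ∑ i, a i * Ω (F.X i) Y q = -∑ i, a i * dirDeriv (g i) q (Y.1 q) := by
  have hO := h.defining.isOpen
  have hclos : q ∈ closure (O ∩ Zᶜ) := hZ.dense_compl.open_subset_closure_inter hO hq
  have hcl : ContinuousAt (fun q => ∑ i, a i * Ω (F.X i) Y q +
      ∑ i, a i * dirDeriv (g i) q (Y.1 q)) q := by
    refine ContinuousAt.add (tendsto_finsetSum _ fun i _ => ?_)
      (tendsto_finsetSum _ fun i _ => ?_)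
    · exact continuousAt_const.mul (ContMDiffMap.contMDiff (Ω (F.X i) Y)).continuous.continuousAt
    · refine continuousAt_const.mul ?_
      have := (contMDiffOn_mfderiv_apply hO
        (fun r hr => (h.smooth i r hr).contMDiffWithinAt) Y.1 q hq).contMDiffAt (hO.mem_nhds hq)
      exact this.continuousAt
  have hzero : ∀ r ∈ O ∩ Zᶜ, ∑ i, a i * Ω (F.X i) Y r +
      ∑ i, a i * dirDeriv (g i) r (Y.1 r) = 0 := by
    intro r hr
    have h0 : t r ≠ 0 := fun h0 => hr.2 ((h.defining.mem_iff r hr.1).2 h0)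
    refine (mul_eq_zero.1 (?_ : t r * _ = 0)).resolve_left h0
    rw [← Finset.sum_add_distrib, Finset.mul_sum]
    have h1 : ∀ i, t r * (a i * Ω (F.X i) Y r + a i * dirDeriv (g i) r (Y.1 r)) =
        -(dirDeriv t r (Y.1 r)) * (a i * c i) := by
      intro i
      have := h.mul_apply hr.1 i Y
      linear_combination a i * this
    rw [Finset.sum_congr rfl fun i _ => h1 i, ← Finset.mul_sum, ha, mul_zero]
  have hlim : (fun q => ∑ i, a i * Ω (F.X i) Y q + ∑ i, a i * dirDeriv (g i) q (Y.1 q)) q = 0 := by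
    have h1 := hcl.continuousWithinAt (s := O ∩ Zᶜ)
    have h2 := h1.mem_closure (t := {0}) hclos (fun r hr => hzero r hr)
    simpa using h2
  simp only at hlim
  linarith

/-- On b-vector fields the term with `dt` disappears at `x`, so the relation says that `∑ i, a i • X
i` is `Ω`-orthogonal to all of them at `x`. Nondegeneracy makes this combination vanish at `x`,
regularity gives `a = 0`, and `dt ≠ 0` then gives `b = 0`. -/
theorem eq_zero_of_sum_eq_zero (hZ : IsHypersurface (2 * n) Z) (hΩ : IsBSymplectic Ω)
    (h : F.IsNormalForm t O c g) {x : M} (hx : x ∈ O) (hxZ : x ∈ Z) (hreg : F.IsRegular x)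
    {a : Fin n → ℝ} (ha : ∑ i, a i * c i = 0) {b : ℝ}
    (h0 : ∀ v : TangentSpace (𝓡 (2 * n)) x,
      b * dirDeriv t x v + ∑ i, a i * dirDeriv (g i) x v = 0) : a = 0 ∧ b = 0 := by
  obtain ⟨W, hW, hWΩ⟩ := exists_combination Ω F.X a
  have hW0 : W.1 x = 0 := by
    refine eq_zero_of_mem_bVanishingAt (hΩ.nondegenerate x W fun Y => ?_)
    have h1 := h0 (Y.1 x)
    have h2 : dirDeriv t x (Y.1 x) = 0 := Y.2 O t h.defining x hx hxZ
    rw [h2, mul_zero, zero_add] at h1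
    rw [hWΩ, h.sum_apply hZ hx Y ha, h1, neg_zero]
  rw [hW] at hW0
  have ha0 : a = 0 := funext fun i => Fintype.linearIndependent_iff.1 hreg a hW0 i
  refine ⟨ha0, ?_⟩
  by_contra hb
  refine h.defining.mfderiv_ne_zero x hx hxZ ?_
  ext v
  have h1 := h0 v
  simp only [ha0, Pi.zero_apply, zero_mul, Finset.sum_const_zero, add_zero] at h1
  exact (mul_eq_zero.1 h1).resolve_left hb

end IsNormalForm

end BIntegrableSystem

end NormalForm

end BSymplectic

namespace BSymplectic

/-! ### Simultaneous straightening of commuting vector fields. -/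

section Straightening

variable {n d : ℕ} {M : Type*} [TopologicalSpace M] [ChartedSpace (EuclideanSpace ℝ (Fin d)) M]
  [IsManifold (𝓡 d) ∞ M]

/-- The frame is a section of `df₁` inside the kernel of the surjection `df₂`, so the pair is onto.
Source and target both have dimension `2n`. -/
theorem bijective_mfderiv_prodMk (hd : d = 2 * n) {X : Fin n → VectorFields d M} {x : M}
    {f₁ f₂ : M → EuclideanSpace ℝ (Fin n)}
    (hf₁ : MDifferentiableAt (𝓡 d) 𝓘(ℝ, EuclideanSpace ℝ (Fin n)) f₁ x)
    (hf₂ : MDifferentiableAt (𝓡 d) 𝓘(ℝ, EuclideanSpace ℝ (Fin n)) f₂ x)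
    (h₁ : ∀ s, (mfderiv (𝓡 d) 𝓘(ℝ, EuclideanSpace ℝ (Fin n)) f₁ x (frame X x s) :
      EuclideanSpace ℝ (Fin n)) = s)
    (h₂ : ∀ s, (mfderiv (𝓡 d) 𝓘(ℝ, EuclideanSpace ℝ (Fin n)) f₂ x (frame X x s) :
      EuclideanSpace ℝ (Fin n)) = 0)
    (hs : Function.Surjective (mfderiv (𝓡 d) 𝓘(ℝ, EuclideanSpace ℝ (Fin n)) f₂ x)) :
    Function.Bijective (mfderiv (𝓡 d)
      𝓘(ℝ, EuclideanSpace ℝ (Fin n) × EuclideanSpace ℝ (Fin n)) (fun q => (f₁ q, f₂ q)) x) := by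
  let Q := EuclideanSpace ℝ (Fin d)
  let E := EuclideanSpace ℝ (Fin n)
  let l : Q →ₗ[ℝ] E := (mfderiv (𝓡 d) 𝓘(ℝ, E) f₁ x : Q →L[ℝ] E).toLinearMap
  let L : Q →ₗ[ℝ] E := (mfderiv (𝓡 d) 𝓘(ℝ, E) f₂ x : Q →L[ℝ] E).toLinearMap
  have hsur : Function.Surjective (l.prod L) :=
    surjective_prod_of_section (ι := (frame X x : E →L[ℝ] Q).toLinearMap) h₁ h₂ hs
  have hrank : Module.finrank ℝ Q = Module.finrank ℝ (E × E) := by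
    simp [Q, E, hd]
    ring
  have heq : (fun v : Q => (mfderiv (𝓡 d) 𝓘(ℝ, E × E) (fun q => (f₁ q, f₂ q)) x v : E × E)) =
      l.prod L := funext fun v => mfderiv_prodMk_apply hf₁ hf₂ v
  show Function.Bijective
    (fun v : Q => (mfderiv (𝓡 d) 𝓘(ℝ, E × E) (fun q => (f₁ q, f₂ q)) x v : E × E))
  rw [heq]
  exact ⟨(LinearMap.injective_iff_surjective_of_finrank_eq_finrank hrank).2 hsur, hsur⟩

theorem mfderiv_frame_eq {F : Type*} [NormedAddCommGroup F] [NormedSpace ℝ F]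
    (X : Fin n → VectorFields d M) (f : M → F) (q : M) (s : EuclideanSpace ℝ (Fin n)) :
    (mfderiv (𝓡 d) 𝓘(ℝ, F) f q (frame X q s) : F) =
      ∑ i, s i • (mfderiv (𝓡 d) 𝓘(ℝ, F) f q (X i q) : F) := by
  rw [frame_apply]
  refine (map_sum (mfderiv (𝓡 d) 𝓘(ℝ, F) f q : EuclideanSpace ℝ (Fin d) →L[ℝ] F) _ _).trans ?_
  exact Finset.sum_congr rfl fun i _ =>
    map_smul (mfderiv (𝓡 d) 𝓘(ℝ, F) f q : EuclideanSpace ℝ (Fin d) →L[ℝ] F) (s i) (X i q)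

theorem mfderiv_mfderiv_comm {X Y : VectorFields d M} {y : M → EuclideanSpace ℝ (Fin n)} {q : M}
    (hXY : VectorField.mlieBracket (𝓡 d) X Y q = 0)
    (hy : ∀ᶠ r in 𝓝 q, ContMDiffAt (𝓡 d) 𝓘(ℝ, EuclideanSpace ℝ (Fin n)) ∞ y r) :
    (mfderiv (𝓡 d) 𝓘(ℝ, EuclideanSpace ℝ (Fin n)) (fun r =>
      (mfderiv (𝓡 d) 𝓘(ℝ, EuclideanSpace ℝ (Fin n)) y r (Y r) : EuclideanSpace ℝ (Fin n))) q (X q) :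
        EuclideanSpace ℝ (Fin n)) =
    mfderiv (𝓡 d) 𝓘(ℝ, EuclideanSpace ℝ (Fin n)) (fun r =>
      (mfderiv (𝓡 d) 𝓘(ℝ, EuclideanSpace ℝ (Fin n)) y r (X r) : EuclideanSpace ℝ (Fin n)))
        q (Y q) := by
  let E := EuclideanSpace ℝ (Fin n)
  refine PiLp.ext fun k => ?_
  let π : E →L[ℝ] ℝ := EuclideanSpace.proj k
  have hyk : ∀ᶠ r in 𝓝 q, ContMDiffAt (𝓡 d) 𝓘(ℝ, ℝ) ∞ (fun r => π (y r)) r := by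
    filter_upwards [hy] with r hr using π.contDiff.contMDiff.contMDiffAt.comp r hr
  have key : ∀ (A B : VectorFields d M),
      π (mfderiv (𝓡 d) 𝓘(ℝ, E) (fun r => (mfderiv (𝓡 d) 𝓘(ℝ, E) y r (A r) : E)) q (B q)) =
        dirDeriv (fun r => dirDeriv (fun r => π (y r)) r (A r)) q (B q) := by
    intro A B
    have h1 := (eventually_contMDiffAt_mfderiv_apply hy A).self_of_nhds.mdifferentiableAt (by simp)
    refine (mfderiv_clm_comp_apply π h1 (B q)).symm.trans (dirDeriv_congr ?_ (B q))
    filter_upwards [hy] with r hr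
    exact (mfderiv_clm_comp_apply π (hr.mdifferentiableAt (by simp)) (A r)).symm
  have h := dirDeriv_mlieBracket hyk X Y
  rw [hXY] at h
  have h0 : dirDeriv (fun r => π (y r)) q 0 = 0 :=
    map_zero (mfderiv (𝓡 d) 𝓘(ℝ, ℝ) (fun r => π (y r)) q)
  rw [h0] at h
  refine (key Y X).trans ((sub_eq_zero.1 h.symm).trans (key X Y).symm)

/-- Commuting vector fields with enough common first integrals can be straightened. -/
theorem exists_isFlowBox (hd : d = 2 * n) {X : Fin n → VectorFields d M}
    (hX : ∀ i j p, VectorField.mlieBracket (𝓡 d) (X i) (X j) p = 0) {x : M}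
    (hreg : LinearIndependent ℝ fun i => X i x) {G : M → EuclideanSpace ℝ (Fin n)} {O : Set M}
    (hO : IsOpen O) (hx : x ∈ O)
    (hG : ∀ q ∈ O, ContMDiffAt (𝓡 d) 𝓘(ℝ, EuclideanSpace ℝ (Fin n)) ∞ G q)
    (hGX : ∀ q ∈ O, ∀ i, (mfderiv (𝓡 d) 𝓘(ℝ, EuclideanSpace ℝ (Fin n)) G q (X i q) :
      EuclideanSpace ℝ (Fin n)) = 0)
    (hGs : Function.Surjective (mfderiv (𝓡 d) 𝓘(ℝ, EuclideanSpace ℝ (Fin n)) G x)) :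
    ∃ ψ : OpenPartialHomeomorph M (EuclideanSpace ℝ (Fin n) × EuclideanSpace ℝ (Fin n)),
      IsFlowBox X ψ ∧ x ∈ ψ.source ∧ ψ.source ⊆ O ∧ ∀ q, (ψ q).2 = G q - G x := by
  let Q := EuclideanSpace ℝ (Fin d)
  let E := EuclideanSpace ℝ (Fin n)
  let e : M → Q := extChartAt (𝓡 d) x
  have he : ∀ᶠ q in 𝓝 x, ContMDiffAt (𝓡 d) 𝓘(ℝ, Q) ∞ e q := by
    filter_upwards [(chartAt Q x).open_source.mem_nhds (mem_chart_source Q x)] with q hq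
      using contMDiffAt_extChartAt' hq
  have hed : ∀ v : Q, (mfderiv (𝓡 d) 𝓘(ℝ, Q) e x v : Q) = v := fun v =>
    congrArg (fun L : Q →L[ℝ] Q => L v) (mfderiv_extChartAt_self (I := 𝓡 d) (x := x))
  obtain ⟨l₀, hl₀⟩ := LinearMap.exists_leftInverse_of_injective
    (frame X x : E →L[ℝ] Q).toLinearMap (LinearMap.ker_eq_bot.2 (frame_injective hreg))
  let l : Q →L[ℝ] E := LinearMap.toContinuousLinearMap l₀
  have hl : ∀ s : E, l (frame X x s) = s := fun s => congrArg (fun L : E →ₗ[ℝ] E => L s) hl₀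
  -- Provisional coordinates along the leaves: the fields are the coordinate fields of `y` only at
  -- the point `x`. The chart `ψ = (y, G')` already has the level sets of `G` as its slices.
  let y : M → E := fun q => l (e q) - l (e x)
  let G' : M → E := fun q => G q - G x
  have hsub : ∀ {F : Type} [NormedAddCommGroup F] [NormedSpace ℝ F] (f : M → F) (a : F) (q : M)
      (v : TangentSpace (𝓡 d) q), MDifferentiableAt (𝓡 d) 𝓘(ℝ, F) f q →
      (mfderiv (𝓡 d) 𝓘(ℝ, F) (fun q => f q - a) q v : F) = mfderiv (𝓡 d) 𝓘(ℝ, F) f q v := by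
    intro F _ _ f a q v hf
    have h1 : HasFDerivAt (fun z : F => z - a) (ContinuousLinearMap.id ℝ F) (f q) :=
      (hasFDerivAt_id _).sub_const a
    rw [mfderiv_comp_fderiv_apply (φ := fun z : F => z - a) h1.differentiableAt hf, h1.fderiv]
    rfl
  have hle : ∀ᶠ q in 𝓝 x, ContMDiffAt (𝓡 d) 𝓘(ℝ, E) ∞ (fun q => l (e q)) q := by
    filter_upwards [he] with q hq using l.contDiff.contMDiff.contMDiffAt.comp q hq
  have hy : ∀ᶠ q in 𝓝 x, ContMDiffAt (𝓡 d) 𝓘(ℝ, E) ∞ y q := by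
    filter_upwards [hle] with q hq using hq.sub contMDiffAt_const
  have hG' : ∀ᶠ q in 𝓝 x, ContMDiffAt (𝓡 d) 𝓘(ℝ, E) ∞ G' q := by
    filter_upwards [hO.mem_nhds hx] with q hq using (hG q hq).sub contMDiffAt_const
  have hyx : ∀ s, (mfderiv (𝓡 d) 𝓘(ℝ, E) y x (frame X x s) : E) = s := by
    intro s
    refine (hsub _ _ _ _ (hle.self_of_nhds.mdifferentiableAt (by simp))).trans ?_
    refine (mfderiv_clm_comp_apply l (he.self_of_nhds.mdifferentiableAt (by simp)) _).trans ?_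
    exact (congrArg l (hed _)).trans (hl s)
  have hGd : ∀ q ∈ O, ∀ v : TangentSpace (𝓡 d) q, (mfderiv (𝓡 d) 𝓘(ℝ, E) G' q v : E) =
      mfderiv (𝓡 d) 𝓘(ℝ, E) G q v :=
    fun q hq v => hsub _ _ _ _ ((hG q hq).mdifferentiableAt (by simp))
  have hGf : ∀ q ∈ O, ∀ s, (mfderiv (𝓡 d) 𝓘(ℝ, E) G' q (frame X q s) : E) = 0 := by
    intro q hq s
    rw [hGd q hq, mfderiv_frame_eq]
    exact Finset.sum_eq_zero fun i _ => by rw [hGX q hq i]; exact smul_zero (A := E) (s i)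
  have hGs' : Function.Surjective (mfderiv (𝓡 d) 𝓘(ℝ, E) G' x) := by
    intro w
    obtain ⟨v, hv⟩ := hGs w
    exact ⟨v, (hGd x hx v).trans hv⟩
  have hpair : ∀ᶠ q in 𝓝 x, ContMDiffAt (𝓡 d) 𝓘(ℝ, E × E) ∞ (fun q => (y q, G' q)) q := by
    filter_upwards [hy, hG'] with q h1 h2 using h1.prodMk_space h2
  obtain ⟨O₁, hO₁, hO₁o, hxO₁⟩ := eventually_nhds_iff.1 ((hy.and hG').and (hO.mem_nhds hx))
  obtain ⟨ψ, hxψ, hψW, hψf, hψ, hψs⟩ := exists_chart_of_bijective_mfderiv (hO₁o.mem_nhds hxO₁) hpair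
    (bijective_mfderiv_prodMk hd (hy.self_of_nhds.mdifferentiableAt (by simp))
      (hG'.self_of_nhds.mdifferentiableAt (by simp)) hyx (hGf x hx) hGs')
  have hψx : ψ x = 0 := by rw [hψf]; simp [y, G']
  have hsO : ∀ q ∈ ψ.source, q ∈ O := fun q hq => (hO₁ q (hψW hq)).2
  have hsy : ∀ q ∈ ψ.source, ∀ᶠ r in 𝓝 q, ContMDiffAt (𝓡 d) 𝓘(ℝ, E) ∞ y r := by
    intro q hq
    filter_upwards [hO₁o.mem_nhds (hψW hq)] with r hr using (hO₁ r hr).1.1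
  have hψd : ∀ q ∈ ψ.source, ∀ s, (mfderiv (𝓡 d) 𝓘(ℝ, E × E) ψ q (frame X q s) : E × E) =
      (mfderiv (𝓡 d) 𝓘(ℝ, E) y q (frame X q s), 0) := by
    intro q hq s
    have h1 : (ψ : M → E × E) = fun q => (y q, G' q) := funext hψf
    obtain ⟨⟨h2, h3⟩, -⟩ := hO₁ q (hψW hq)
    rw [h1, mfderiv_prodMk_apply (h2.mdifferentiableAt (by simp)) (h3.mdifferentiableAt (by simp)),
      hGf q (hsO q hq)]
    rfl
  have hψm : ∀ q ∈ ψ.source, MDifferentiableAt (𝓡 d) 𝓘(ℝ, E × E) ψ q := fun q hq =>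
    ((hψ q hq).contMDiffAt (ψ.open_source.mem_nhds hq)).mdifferentiableAt (by simp)
  let Λ : (Fin n → E) →L[ℝ] (E →L[ℝ] E) :=
    ∑ i, (ContinuousLinearMap.smulRightL ℝ E E (EuclideanSpace.proj i)).comp
      (ContinuousLinearMap.proj i)
  have hΛ : ∀ w s, Λ w s = ∑ i, s i • w i := by
    intro w s
    simp only [Λ, FunLike.coe_sum, Finset.sum_apply]
    rfl
  -- The matrix of the fields in the coordinates `y`. Its inverse `θ`, read in the chart, is the
  -- coframe dual to the `X i` along the slices, and a primitive of `θ` straightens the fields.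
  let A : M → (E →L[ℝ] E) := fun q => Λ fun i => mfderiv (𝓡 d) 𝓘(ℝ, E) y q (X i q)
  have hA : ∀ q s, A q s = (mfderiv (𝓡 d) 𝓘(ℝ, E) y q (frame X q s) : E) := by
    intro q s
    rw [mfderiv_frame_eq]
    exact hΛ _ _
  have hAs : ∀ q ∈ ψ.source, ContMDiffAt (𝓡 d) 𝓘(ℝ, E →L[ℝ] E) ∞ A q := by
    intro q hq
    refine Λ.contDiff.contMDiff.contMDiffAt.comp q ?_
    exact contMDiffAt_pi_space.2 fun i =>
      (eventually_contMDiffAt_mfderiv_apply (hsy q hq) (X i)).self_of_nhds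
  let B : E × E → (E →L[ℝ] E) := fun z => A (ψ.symm z)
  have h0t : (0 : E × E) ∈ ψ.target := hψx ▸ ψ.map_source hxψ
  have hBs : ∀ z ∈ ψ.target, ContDiffAt ℝ ∞ B z := fun z hz =>
    ((hAs _ (ψ.map_target hz)).comp z
      ((hψs z hz).contMDiffAt (ψ.open_target.mem_nhds hz))).contDiffAt
  have hB0 : B 0 = (ContinuousLinearEquiv.refl ℝ E : E →L[ℝ] E) := by
    ext1 s
    have : ψ.symm 0 = x := by rw [← hψx, ψ.left_inv hxψ]
    show A (ψ.symm 0) s = s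
    rw [this, hA, hyx]
  have hBinv : ∀ᶠ z in 𝓝 (0 : E × E), ∃ L : E ≃L[ℝ] E, (L : E →L[ℝ] E) = B z := by
    have h1 := ContinuousLinearEquiv.nhds (ContinuousLinearEquiv.refl ℝ E)
    rw [← hB0] at h1
    exact (hBs 0 h0t).continuousAt.eventually h1
  have htgt : ∀ᶠ z in 𝓝 (0 : E × E), z ∈ ψ.target := ψ.open_target.mem_nhds h0t
  obtain ⟨θ, hθ, hθB⟩ := exists_contDiff_eventuallyEq (f := fun z => (B z).inverse)
    (x := (0 : E × E)) (by
      filter_upwards [hBinv, htgt] with z hz hzt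
      obtain ⟨L, hL⟩ := hz
      have h1 : ContDiffAt ℝ ∞ (ContinuousLinearMap.inverse : (E →L[ℝ] E) → _) (B z) :=
        hL ▸ contDiffAt_map_inverse L
      exact h1.comp z (hBs z hzt))
  have hθinv : ∀ᶠ z in 𝓝 (0 : E × E), (θ z).comp (B z) = ContinuousLinearMap.id ℝ E ∧
      (B z).comp (θ z) = ContinuousLinearMap.id ℝ E := by
    filter_upwards [hBinv, hθB] with z hz h1
    obtain ⟨L, hL⟩ := hz
    rw [h1, ← hL, ContinuousLinearMap.inverse_equiv]
    constructor <;> ext1 s <;> simp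
  -- In the chart `X i` is `(B z eᵢ, 0)`, so the left side is the derivative along `X i` of the
  -- derivative of `y` along `X j`. It is symmetric in `i` and `j` because the fields commute.
  have hsymB : ∀ z ∈ ψ.target, ∀ i j : Fin n,
      fderiv ℝ B z (B z (EuclideanSpace.single i 1), 0) (EuclideanSpace.single j 1) =
        (mfderiv (𝓡 d) 𝓘(ℝ, E) (fun q => (mfderiv (𝓡 d) 𝓘(ℝ, E) y q (X j q) : E)) (ψ.symm z)
          (X i (ψ.symm z)) : E) := by
    intro z hz i j
    have hq := ψ.map_target hz
    let ej : (E →L[ℝ] E) →L[ℝ] E := ContinuousLinearMap.apply ℝ E (EuclideanSpace.single j 1)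
    have hAj : ∀ q, ej (A q) = (mfderiv (𝓡 d) 𝓘(ℝ, E) y q (X j q) : E) := by
      intro q
      exact (hA q _).trans (by rw [frame_single])
    have h1 : (fun q => (mfderiv (𝓡 d) 𝓘(ℝ, E) y q (X j q) : E)) =ᶠ[𝓝 (ψ.symm z)]
        fun q => ej (B (ψ q)) := by
      filter_upwards [ψ.open_source.mem_nhds hq] with q hq'
      show _ = ej (A (ψ.symm (ψ q)))
      rw [ψ.left_inv hq', hAj]
    have h2 := congrArg (fun L : Q →L[ℝ] E => L (X i (ψ.symm z))) (h1.mfderiv_eq (I := 𝓡 d) (I' := 𝓘(ℝ, E)))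
    refine Eq.symm (Eq.trans h2 ?_)
    have hBd : DifferentiableAt ℝ B (ψ (ψ.symm z)) := by
      rw [ψ.right_inv hz]
      exact (hBs z hz).differentiableAt (by simp)
    have h3 : HasFDerivAt (fun w => ej (B w)) (ej.comp (fderiv ℝ B (ψ (ψ.symm z))))
        (ψ (ψ.symm z)) := ej.hasFDerivAt.comp _ hBd.hasFDerivAt
    refine (mfderiv_comp_fderiv_apply (φ := fun w => ej (B w)) h3.differentiableAt
      (hψm _ hq) (X i (ψ.symm z))).trans ?_
    have h4 := hψd _ hq (EuclideanSpace.single i 1)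
    rw [← hA, frame_single] at h4
    rw [h3.fderiv, h4, ψ.right_inv hz]
    rfl
  have hsymB' : ∀ z ∈ ψ.target, ∀ s r : E, fderiv ℝ B z (B z s, 0) r = fderiv ℝ B z (B z r, 0) s := by
    intro z hz s r
    let β : E →ₗ[ℝ] E →ₗ[ℝ] E :=
      LinearMap.mk₂ ℝ (fun s r => fderiv ℝ B z (B z s, 0) r)
        (fun s s' r => by
          rw [map_add, ← add_zero (0 : E), ← Prod.mk_add_mk, map_add]
          simp)
        (fun c s r => by
          have : ((c • B z s, 0) : E × E) = c • (B z s, 0) := by simp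
          rw [map_smul, this, map_smul]
          simp)
        (fun s r r' => map_add _ _ _) (fun c s r => map_smul _ _ _)
    have hβ : β = β.flip := by
      refine (EuclideanSpace.basisFun (Fin n) ℝ).toBasis.ext fun i =>
        (EuclideanSpace.basisFun (Fin n) ℝ).toBasis.ext fun j => ?_
      simp only [OrthonormalBasis.coe_toBasis, EuclideanSpace.basisFun_apply, LinearMap.flip_apply,
        β, LinearMap.mk₂_apply]
      rw [hsymB z hz i j, hsymB z hz j i]
      exact mfderiv_mfderiv_comm (hX i j _) (hsy _ (ψ.map_target hz))
    exact congrArg (fun b : E →ₗ[ℝ] E →ₗ[ℝ] E => b s r) hβ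
  have hclosed : ∀ᶠ z in 𝓝 (0 : E × E), ∀ v w : E,
      fderiv ℝ θ z (v, 0) w = fderiv ℝ θ z (w, 0) v := by
    filter_upwards [hθinv.eventually_nhds, htgt] with z hz hzt v w
    obtain ⟨-, hBθ⟩ := hz.self_of_nhds
    have hθd : HasFDerivAt θ (fderiv ℝ θ z) z := (hθ.differentiable (by simp) z).hasFDerivAt
    have hBd : HasFDerivAt B (fderiv ℝ B z) z :=
      ((hBs z hzt).differentiableAt (by simp)).hasFDerivAt
    -- Differentiation of `θ ∘ B = id` turns the symmetry of the derivative of `B` into closedness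
    -- of `θ` along the slices.
    have hprod : ∀ (u : E × E) (s : E), fderiv ℝ θ z u (B z s) = -θ z (fderiv ℝ B z u s) := by
      intro u s
      have h1 := (hθd.clm_comp hBd)
      have h2 : HasFDerivAt (fun z => (θ z).comp (B z)) (0 : E × E →L[ℝ] E →L[ℝ] E) z := by
        refine (hasFDerivAt_const (ContinuousLinearMap.id ℝ E) z).congr_of_eventuallyEq ?_
        filter_upwards [hz] with z' hz' using hz'.1
      have h3 := congrArg (fun L : E × E →L[ℝ] E →L[ℝ] E => L u s) (h1.unique h2)
      simp only [add_apply, zero_apply, ContinuousLinearMap.comp_apply,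
        ContinuousLinearMap.flip_apply, ContinuousLinearMap.compL_apply] at h3
      exact eq_neg_of_add_eq_zero_right h3
    have hr : ∀ w : E, B z (θ z w) = w := fun w => congrArg (fun L : E →L[ℝ] E => L w) hBθ
    have h1 := hprod (v, 0) (θ z w)
    have h2 := hprod (w, 0) (θ z v)
    have h3 := hsymB' z hzt (θ z v) (θ z w)
    rw [hr] at h1 h2
    rw [hr, hr] at h3
    rw [h1, h2, h3]
  obtain ⟨S, hS, hSθ⟩ := exists_primitive hθ hclosed
  let f : M → E := fun q => S (ψ q)
  have hψx' : Filter.Tendsto ψ (𝓝 x) (𝓝 0) := hψx ▸ ψ.continuousAt hxψ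
  have hgood : ∀ᶠ q in 𝓝 x, q ∈ ψ.source ∧
      ∀ s, (mfderiv (𝓡 d) 𝓘(ℝ, E) f q (frame X q s) : E) = s := by
    filter_upwards [ψ.open_source.mem_nhds hxψ, hψx'.eventually (hSθ.and hθinv)] with q hq h2
    refine ⟨hq, fun s => ?_⟩
    refine (mfderiv_comp_fderiv_apply (φ := S) (hS.differentiable (by simp) _)
      (hψm q hq) (frame X q s)).trans ?_
    have h4 : (mfderiv (𝓡 d) 𝓘(ℝ, E × E) ψ q (frame X q s) : E × E) = (A q s, 0) := by
      rw [hA]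
      exact hψd q hq s
    rw [h4, h2.1]
    have h3 : A q = B (ψ q) := by
      show A q = A (ψ.symm (ψ q))
      rw [ψ.left_inv hq]
    rw [h3]
    exact congrArg (fun L : E →L[ℝ] E => L s) h2.2.1
  have hf : ∀ q ∈ ψ.source, ContMDiffAt (𝓡 d) 𝓘(ℝ, E) ∞ f q := fun q hq =>
    hS.contMDiff.contMDiffAt.comp q ((hψ q hq).contMDiffAt (ψ.open_source.mem_nhds hq))
  have hfG : ∀ᶠ q in 𝓝 x, ContMDiffAt (𝓡 d) 𝓘(ℝ, E × E) ∞ (fun q => (f q, G' q)) q := by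
    filter_upwards [ψ.open_source.mem_nhds hxψ, hG'] with q h1 h2 using (hf q h1).prodMk_space h2
  obtain ⟨Ψ, hxΨ, hΨW, hΨf, hΨ, hΨs⟩ := exists_chart_of_bijective_mfderiv hgood hfG
    (bijective_mfderiv_prodMk hd ((hf x hxψ).mdifferentiableAt (by simp))
      (hG'.self_of_nhds.mdifferentiableAt (by simp)) hgood.self_of_nhds.2 (hGf x hx) hGs')
  refine ⟨Ψ, ⟨hΨ, hΨs, fun q hq s => ?_⟩, hxΨ, fun q hq => hsO q (hΨW hq).1,
    fun q => by rw [hΨf]⟩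
  have h1 : (Ψ : M → E × E) = fun q => (f q, G' q) := funext hΨf
  obtain ⟨h2, h3⟩ := hΨW hq
  rw [h1, mfderiv_prodMk_apply ((hf q h2).mdifferentiableAt (by simp))
    ((hO₁ q (hψW h2)).1.2.mdifferentiableAt (by simp)), h3 s, hGf q (hsO q h2)]
  rfl

end Straightening

end BSymplectic

namespace BSymplectic

/-! ### Smooth first integrals and their relation to the level. -/

section FirstIntegrals

variable {n : ℕ} {M : Type*} [TopologicalSpace M]
  [ChartedSpace (EuclideanSpace ℝ (Fin (2 * n))) M] [IsManifold (𝓡 (2 * n)) ∞ M]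
  {Z : Set M} {Ω : BBilinForm (2 * n) Z}

namespace BIntegrableSystem

/-- The sign of the defining function and, away from `Z`, the values of the integrals. -/
noncomputable def level (F : BIntegrableSystem Ω) (t : M → ℝ) (q : M) : SignType × (Fin n → ℝ) :=
  (SignType.sign (t q), fun i => if t q = 0 then 0 else F.f i q)

namespace IsNormalForm

variable {F : BIntegrableSystem Ω} {t : M → ℝ} {O : Set M} {c : Fin n → ℝ} {g : Fin n → M → ℝ}

/-- Without logarithms every relation between `dt` and the `dg i` at `x` is trivial, so they map
onto a space of dimension `n + 1`. All of them kill the `n` independent vectors `X j x`, which would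
need dimension at least `2n + 1`. -/
theorem exists_ne_zero (hZ : IsHypersurface (2 * n) Z) (hΩ : IsBSymplectic Ω)
    (h : F.IsNormalForm t O c g) {x : M} (hx : x ∈ O) (hxZ : x ∈ Z) (hreg : F.IsRegular x) :
    ∃ i, c i ≠ 0 := by
  by_contra! hc
  let Q := EuclideanSpace ℝ (Fin (2 * n))
  let E := EuclideanSpace ℝ (Fin n)
  let X : Fin n → VectorFields (2 * n) M := fun i => (F.X i).1
  let L : Q →ₗ[ℝ] ℝ × (Fin n → ℝ) :=
    (mfderiv (𝓡 (2 * n)) 𝓘(ℝ, ℝ) t x : Q →L[ℝ] ℝ).toLinearMap.prod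
      (LinearMap.pi fun i => (mfderiv (𝓡 (2 * n)) 𝓘(ℝ, ℝ) (g i) x : Q →L[ℝ] ℝ).toLinearMap)
  have hL : ∀ v : Q, L v = (dirDeriv t x v, fun i => dirDeriv (g i) x v) := fun v => rfl
  have hsum : ∀ a : Fin n → ℝ, ∑ i, a i * c i = 0 := fun a =>
    Finset.sum_eq_zero fun i _ => by rw [hc i, mul_zero]
  have hs : Function.Surjective L := by
    rw [← LinearMap.dualMap_injective_iff, injective_iff_map_eq_zero]
    intro φ hφ
    let a : Fin n → ℝ := fun i => φ (0, Pi.single i 1)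
    have hφa : ∀ z, φ z = φ (1, 0) * z.1 + ∑ i, a i * z.2 i := by
      rintro ⟨r, w⟩
      have h1 : ((r, w) : ℝ × (Fin n → ℝ)) =
          r • (1, 0) + ∑ i, w i • ((0, Pi.single i 1) : ℝ × (Fin n → ℝ)) := by
        refine Prod.ext ?_ ?_
        · simp [Prod.fst_sum]
        · simp only [Prod.snd_add, Prod.smul_snd, Prod.snd_sum, smul_zero, zero_add]
          exact pi_eq_sum_univ' w
      rw [h1, map_add, map_smul, map_sum]
      simp only [map_smul, smul_eq_mul, ← h1]
      rw [mul_comm]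
      exact congrArg₂ (· + ·) rfl (Finset.sum_congr rfl fun i _ => mul_comm _ _)
    have h0 := h.eq_zero_of_sum_eq_zero hZ hΩ hx hxZ hreg (hsum a) (b := φ (1, 0)) (by
      intro v
      exact (hφa (L v)).symm.trans (congrArg (fun l : Module.Dual ℝ Q => l v) hφ))
    refine LinearMap.ext fun z => ?_
    rw [hφa z, h0.1, h0.2]
    simp
  have hι : ∀ s : E, L (frame X x s) = 0 := by
    intro s
    rw [frame_apply]
    refine (map_sum L _ _).trans (Finset.sum_eq_zero fun j _ => ?_)
    refine (map_smul L (s j) (X j x)).trans ?_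
    have h1 : L (X j x) = 0 := by
      refine (hL _).trans (Prod.ext ((F.X j).2 O t h.defining x hx hxZ) (funext fun i => ?_))
      have h2 := h.sum_apply hZ hx (F.X j) (hsum (Pi.single i 1))
      simp only [F.commute, Pi.single_apply, ite_mul, one_mul, zero_mul, Finset.sum_ite_eq',
        Finset.mem_univ, if_true] at h2
      have h3 : (0 : SmoothFunctions (2 * n) M) x = 0 := rfl
      rw [h3] at h2
      exact neg_eq_zero.1 h2.symm
    exact (congrArg (s j • ·) h1).trans (smul_zero (s j))
  obtain ⟨l, hl⟩ := LinearMap.exists_leftInverse_of_injective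
    (frame X x : E →L[ℝ] Q).toLinearMap (LinearMap.ker_eq_bot.2 (frame_injective hreg))
  let l' : Q →ₗ[ℝ] E := l
  have hsur : Function.Surjective (l'.prod L) :=
    surjective_prod_of_section (ι := (frame X x : E →L[ℝ] Q).toLinearMap)
      (fun s => congrArg (fun L : E →ₗ[ℝ] E => L s) hl) hι hs
  have hrank : Module.finrank ℝ (E × (ℝ × (Fin n → ℝ))) ≤ Module.finrank ℝ Q :=
    LinearMap.finrank_le_finrank_of_surjective hsur
  simp only [Q, E, Module.finrank_prod, finrank_euclideanSpace, Fintype.card_fin,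
    Module.finrank_self, Module.finrank_fin_fun] at hrank
  omega

/-- The common first integrals of a b-integrable system near a regular point of `Z`. -/
noncomputable def _root_.BSymplectic.firstIntegrals (t : M → ℝ) (c : Fin n → ℝ) (g : Fin n → M → ℝ)
    (k : Fin n) (q : M) : EuclideanSpace ℝ (Fin n) :=
  WithLp.toLp 2 fun i => if i = k then t q * Real.exp (g k q / c k) else g i q - c i / c k * g k q

theorem contMDiffAt_firstIntegrals (h : F.IsNormalForm t O c g) (k : Fin n) {q : M} (hq : q ∈ O) :
    ContMDiffAt (𝓡 (2 * n)) 𝓘(ℝ, EuclideanSpace ℝ (Fin n)) ∞ (firstIntegrals t c g k) q := by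
  let Φ : ℝ × (Fin n → ℝ) → EuclideanSpace ℝ (Fin n) := fun z =>
    WithLp.toLp 2 fun i => if i = k then z.1 * Real.exp (z.2 k / c k) else z.2 i - c i / c k * z.2 k
  have hΦ : ContDiff ℝ ∞ Φ := by
    rw [contDiff_euclidean]
    intro i
    by_cases hi : i = k
    · simp only [Φ, hi, if_true]
      fun_prop
    · simp only [Φ, hi, if_false]
      fun_prop
  have h1 : ContMDiffAt (𝓡 (2 * n)) 𝓘(ℝ, ℝ × (Fin n → ℝ)) ∞ (fun q => (t q, fun i => g i q)) q :=
    (h.contMDiffAt hq).prodMk_space (contMDiffAt_pi_space.2 fun i => h.smooth i q hq)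
  exact hΦ.contMDiff.contMDiffAt.comp q h1

theorem mfderiv_firstIntegrals (h : F.IsNormalForm t O c g) (k : Fin n) {q : M} (hq : q ∈ O)
    (v : TangentSpace (𝓡 (2 * n)) q) (i : Fin n) :
    (EuclideanSpace.proj i : EuclideanSpace ℝ (Fin n) →L[ℝ] ℝ)
        (mfderiv (𝓡 (2 * n)) 𝓘(ℝ, EuclideanSpace ℝ (Fin n)) (firstIntegrals t c g k) q v) =
      if i = k then Real.exp (g k q / c k) *
        (dirDeriv t q v + t q / c k * dirDeriv (g k) q v)
      else dirDeriv (g i) q v - c i / c k * dirDeriv (g k) q v := by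
  have hG := (h.contMDiffAt_firstIntegrals k hq).mdifferentiableAt (by simp)
  have ht' := (h.contMDiffAt hq).mdifferentiableAt (by simp)
  have hg' := fun i => (h.smooth i q hq).mdifferentiableAt (by simp)
  have h1 := mfderiv_clm_comp_apply
    (EuclideanSpace.proj i : EuclideanSpace ℝ (Fin n) →L[ℝ] ℝ) hG v
  refine h1.symm.trans ?_
  by_cases hi : i = k
  · subst hi
    rw [if_pos rfl]
    have h2 : (fun q => (EuclideanSpace.proj i : EuclideanSpace ℝ (Fin n) →L[ℝ] ℝ)
        (firstIntegrals t c g i q)) = fun q => t q * Real.exp (g i q / c i) := by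
      funext q
      simp [firstIntegrals]
    rw [h2]
    have hd : HasFDerivAt (fun z : ℝ × ℝ => z.1 * Real.exp (z.2 / c i))
        (t q • (Real.exp (g i q / c i) • (c i)⁻¹ • ContinuousLinearMap.snd ℝ ℝ ℝ) +
          Real.exp (g i q / c i) • ContinuousLinearMap.fst ℝ ℝ ℝ) (t q, g i q) := by
      have h3 : HasFDerivAt (fun z : ℝ × ℝ => z.2 / c i)
          ((c i)⁻¹ • ContinuousLinearMap.snd ℝ ℝ ℝ) (t q, g i q) := by
        simp only [div_eq_mul_inv]
        exact (hasFDerivAt_snd (𝕜 := ℝ) (p := (t q, g i q))).mul_const _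
      exact (hasFDerivAt_fst (𝕜 := ℝ) (p := (t q, g i q))).mul h3.exp
    have h4 := mfderiv_comp_fderiv_apply (φ := fun z : ℝ × ℝ => z.1 * Real.exp (z.2 / c i))
      (f := fun q => (t q, g i q)) hd.differentiableAt (ht'.prodMk_space (hg' i)) v
    rw [hd.fderiv, mfderiv_prodMk_apply ht' (hg' i)] at h4
    refine h4.trans ?_
    have h5 : t q * (Real.exp (g i q / c i) * ((c i)⁻¹ * dirDeriv (g i) q v)) +
      Real.exp (g i q / c i) * dirDeriv t q v = Real.exp (g i q / c i) *
        (dirDeriv t q v + t q / c i * dirDeriv (g i) q v) := by ring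
    exact h5
  · rw [if_neg hi]
    have h2 : (fun q => (EuclideanSpace.proj i : EuclideanSpace ℝ (Fin n) →L[ℝ] ℝ)
        (firstIntegrals t c g k q)) = fun q => g i q - c i / c k * g k q := by
      funext q
      simp [firstIntegrals, hi]
    rw [h2]
    have hd : HasFDerivAt (fun z : ℝ × ℝ => z.1 - c i / c k * z.2)
        (ContinuousLinearMap.fst ℝ ℝ ℝ - (c i / c k) • ContinuousLinearMap.snd ℝ ℝ ℝ)
        (g i q, g k q) :=
      (hasFDerivAt_fst (𝕜 := ℝ) (p := (g i q, g k q))).sub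
        ((hasFDerivAt_snd (𝕜 := ℝ) (p := (g i q, g k q))).const_mul _)
    have h4 := mfderiv_comp_fderiv_apply (φ := fun z : ℝ × ℝ => z.1 - c i / c k * z.2)
      (f := fun q => (g i q, g k q)) hd.differentiableAt ((hg' i).prodMk_space (hg' k)) v
    rw [hd.fderiv, mfderiv_prodMk_apply (hg' i) (hg' k)] at h4
    exact h4

/-- Everything reduces to `Ω (X i) (X j) = 0`: by `mul_apply` for the component `k`, and for the
others by `sum_apply` with coefficients `1` at `i` and `-c i / c k` at `k`, for which the logarithms
cancel. -/
theorem mfderiv_firstIntegrals_X (hZ : IsHypersurface (2 * n) Z) (h : F.IsNormalForm t O c g)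
    {k : Fin n} (hk : c k ≠ 0) {q : M} (hq : q ∈ O) (j : Fin n) :
    (mfderiv (𝓡 (2 * n)) 𝓘(ℝ, EuclideanSpace ℝ (Fin n)) (firstIntegrals t c g k) q
      ((F.X j).1 q) : EuclideanSpace ℝ (Fin n)) = 0 := by
  refine PiLp.ext fun i => ?_
  refine (h.mfderiv_firstIntegrals k hq _ i).trans ?_
  have h3 : ∀ i, Ω (F.X i) (F.X j) q = 0 := fun i => by rw [F.commute]; rfl
  show _ = (0 : ℝ)
  by_cases hi : i = k
  · rw [if_pos hi]
    have h1 := h.mul_apply hq k (F.X j)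
    rw [h3, mul_zero] at h1
    have h2 : dirDeriv t q ((F.X j).1 q) + t q / c k * dirDeriv (g k) q ((F.X j).1 q) = 0 := by
      field_simp
      linarith
    rw [h2, mul_zero]
  · rw [if_neg hi]
    let a : Fin n → ℝ := fun l => (if l = i then 1 else 0) - (if l = k then c i / c k else 0)
    have hsum : ∀ w : Fin n → ℝ, ∑ l, a l * w l = w i - c i / c k * w k := by
      intro w
      simp [a, sub_mul, Finset.sum_sub_distrib]
    have h1 := h.sum_apply hZ hq (F.X j) (a := a) (by
      rw [hsum]
      field_simp
      ring)
    rw [hsum fun l => dirDeriv (g l) q ((F.X j).1 q)] at h1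
    simp only [h3, mul_zero, Finset.sum_const_zero] at h1
    exact neg_eq_zero.1 h1.symm

theorem surjective_mfderiv_firstIntegrals (hZ : IsHypersurface (2 * n) Z) (hΩ : IsBSymplectic Ω)
    (h : F.IsNormalForm t O c g) {k : Fin n} (hk : c k ≠ 0) {x : M} (hx : x ∈ O) (hxZ : x ∈ Z)
    (hreg : F.IsRegular x) : Function.Surjective (mfderiv (𝓡 (2 * n))
      𝓘(ℝ, EuclideanSpace ℝ (Fin n)) (firstIntegrals t c g k) x) := by
  let Q := EuclideanSpace ℝ (Fin (2 * n))
  let E := EuclideanSpace ℝ (Fin n)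
  let L : Q →ₗ[ℝ] E :=
    (mfderiv (𝓡 (2 * n)) 𝓘(ℝ, E) (firstIntegrals t c g k) x : Q →L[ℝ] E).toLinearMap
  show Function.Surjective L
  rw [← LinearMap.dualMap_injective_iff, injective_iff_map_eq_zero]
  intro φ hφ
  let a : Fin n → ℝ := fun i => φ (EuclideanSpace.single i 1)
  have hφa : ∀ z, φ z = ∑ i, a i * z i := by
    intro z
    conv_lhs => rw [← (EuclideanSpace.basisFun (Fin n) ℝ).sum_repr z]
    rw [map_sum]
    simp only [map_smul, smul_eq_mul, EuclideanSpace.basisFun_repr, EuclideanSpace.basisFun_apply]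
    exact Finset.sum_congr rfl fun i _ => mul_comm _ _
  have htx : t x = 0 := (h.defining.mem_iff x hx).1 hxZ
  let r : ℝ := ∑ i ∈ Finset.univ.erase k, a i * (c i / c k)
  -- A functional that annihilates the image is a relation between `dt` and the `dg i`. The
  -- coefficient `-r` collects the contributions of `g k` to the components `i ≠ k`, and makes `∑ i,
  -- a' i * c i = 0`, as `eq_zero_of_sum_eq_zero` requires. Because `t x = 0`, component `k`
  -- contributes only to the coefficient of `dt`.
  let a' : Fin n → ℝ := fun i => if i = k then -r else a i
  have hsum : ∀ w : Fin n → ℝ,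
      ∑ i, a' i * w i = ∑ i ∈ Finset.univ.erase k, a i * (w i - c i / c k * w k) := by
    intro w
    rw [← Finset.add_sum_erase _ _ (Finset.mem_univ k)]
    have h1 : ∑ i ∈ Finset.univ.erase k, a' i * w i = ∑ i ∈ Finset.univ.erase k, a i * w i :=
      Finset.sum_congr rfl fun i hi => by simp [a', Finset.ne_of_mem_erase hi]
    rw [h1]
    simp only [a', if_true, r, mul_sub, Finset.sum_sub_distrib, neg_mul, Finset.sum_mul]
    rw [neg_add_eq_sub]
    exact congrArg₂ (· - ·) rfl (Finset.sum_congr rfl fun i _ => by ring)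
  have h0 := h.eq_zero_of_sum_eq_zero hZ hΩ hx hxZ hreg (a := a')
    (b := a k * Real.exp (g k x / c k)) (by
      rw [hsum]
      refine Finset.sum_eq_zero fun i _ => ?_
      field_simp
      ring) (by
    intro v
    rw [hsum fun i => dirDeriv (g i) x v]
    have h1 : φ (L v) = 0 := congrArg (fun l : Module.Dual ℝ Q => l v) hφ
    rw [hφa, ← Finset.add_sum_erase _ _ (Finset.mem_univ k)] at h1
    have h2 : ∀ i, (L v) i = _ := fun i => h.mfderiv_firstIntegrals k hx v i
    simp only [h2, if_true, htx, zero_div, zero_mul, add_zero] at h1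
    rw [← h1]
    refine congrArg₂ (· + ·) (by ring) (Finset.sum_congr rfl fun i hi => ?_)
    rw [if_neg (Finset.ne_of_mem_erase hi)])
  have hak : a k = 0 := (mul_eq_zero.1 h0.2).resolve_right (Real.exp_pos _).ne'
  have ha : ∀ i, a i = 0 := by
    intro i
    by_cases hi : i = k
    · rw [hi, hak]
    · have := congrFun h0.1 i
      simpa [a', hi] using this
  refine LinearMap.ext fun z => ?_
  rw [hφa z]
  simp [ha]

theorem log_abs_mul_exp {a x y : ℝ} (ha : a ≠ 0) (hx : x ≠ 0) :
    a * Real.log |x * Real.exp (y / a)| = a * Real.log |x| + y := by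
  rw [Real.log_abs, Real.log_abs, Real.log_mul hx (Real.exp_pos _).ne', Real.log_exp]
  field_simp

/-- Component `k` has the sign of `t`, and `c k` times the logarithm of its absolute value is `f k`
off `Z`. The other components are `f i - c i / c k * f k` there, so all the `f i` can be recovered.
-/
theorem level_eq_of_firstIntegrals_eq (h : F.IsNormalForm t O c g) {k : Fin n} (hk : c k ≠ 0)
    {q q' : M} (hq : q ∈ O) (hq' : q' ∈ O)
    (heq : firstIntegrals t c g k q = firstIntegrals t c g k q') :
    F.level t q = F.level t q' := by
  have hτ : t q * Real.exp (g k q / c k) = t q' * Real.exp (g k q' / c k) := by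
    simpa [firstIntegrals] using congrArg (fun v : EuclideanSpace ℝ (Fin n) => v k) heq
  have hg : ∀ i, i ≠ k → g i q - c i / c k * g k q = g i q' - c i / c k * g k q' := by
    intro i hi
    simpa [firstIntegrals, hi] using congrArg (fun v : EuclideanSpace ℝ (Fin n) => v i) heq
  have hsign : ∀ q, SignType.sign (t q) = SignType.sign (t q * Real.exp (g k q / c k)) := by
    intro q
    rw [sign_mul, sign_pos (Real.exp_pos _), mul_one]
  have hs : SignType.sign (t q) = SignType.sign (t q') := by rw [hsign, hτ, ← hsign]
  refine Prod.ext hs (funext fun i => ?_)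
  by_cases h0 : t q = 0
  · have h0' : t q' = 0 := by rwa [h0, sign_zero, eq_comm, sign_eq_zero_iff] at hs
    simp [level, h0, h0']
  · have h0' : t q' ≠ 0 := by
      intro h0'
      rw [h0', sign_zero, sign_eq_zero_iff] at hs
      exact h0 hs
    have hqZ : q ∉ Z := fun hZ => h0 ((h.defining.mem_iff q hq).1 hZ)
    have hqZ' : q' ∉ Z := fun hZ => h0' ((h.defining.mem_iff q' hq').1 hZ)
    simp only [level, h0, h0', if_false]
    rw [h.eq_log i q hq hqZ, h.eq_log i q' hq' hqZ']
    have h1 := log_abs_mul_exp (y := g k q) hk h0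
    have h2 := log_abs_mul_exp (y := g k q') hk h0'
    rw [hτ, h2] at h1
    by_cases hi : i = k
    · rw [hi, h1]
    · have h3 := hg i hi
      field_simp at h3
      have : c k * (c i * Real.log |t q| + g i q) = c k * (c i * Real.log |t q'| + g i q') := by
        linear_combination h3 - c i * h1
      exact mul_left_cancel₀ hk this

/-- The converse computation is possible only off `Z`: at all points of `Z` the level takes the same
value and separates nothing. -/
theorem firstIntegrals_eq_of_level_eq (h : F.IsNormalForm t O c g) {k : Fin n} (hk : c k ≠ 0)
    {q q' : M} (hq : q ∈ O) (hq' : q' ∈ O) (hqZ : q ∉ Z) (heq : F.level t q = F.level t q') :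
    firstIntegrals t c g k q = firstIntegrals t c g k q' := by
  have h0 : t q ≠ 0 := fun h0 => hqZ ((h.defining.mem_iff q hq).2 h0)
  have hs : SignType.sign (t q) = SignType.sign (t q') := congrArg Prod.fst heq
  have h0' : t q' ≠ 0 := by
    intro h0'
    rw [h0', sign_zero, sign_eq_zero_iff] at hs
    exact h0 hs
  have hqZ' : q' ∉ Z := fun hZ => h0' ((h.defining.mem_iff q' hq').1 hZ)
  have hf : ∀ i, c i * Real.log |t q| + g i q = c i * Real.log |t q'| + g i q' := by
    intro i
    have h1 := congrFun (congrArg Prod.snd heq) i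
    simp only [level, h0, h0', if_false] at h1
    rwa [h.eq_log i q hq hqZ, h.eq_log i q' hq' hqZ'] at h1
  refine PiLp.ext fun i => ?_
  by_cases hi : i = k
  · subst hi
    simp only [firstIntegrals, if_true]
    have h1 := log_abs_mul_exp (y := g i q) hk h0
    have h2 := log_abs_mul_exp (y := g i q') hk h0'
    rw [hf i, ← h2] at h1
    have h3 := mul_left_cancel₀ hk h1
    have h4 := Real.log_injOn_pos
      (Set.mem_Ioi.2 (abs_pos.2 (mul_ne_zero h0 (Real.exp_pos (g i q / c i)).ne')))
      (Set.mem_Ioi.2 (abs_pos.2 (mul_ne_zero h0' (Real.exp_pos (g i q' / c i)).ne'))) h3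
    have hsign : ∀ q, SignType.sign (t q) = SignType.sign (t q * Real.exp (g i q / c i)) := by
      intro q
      rw [sign_mul, sign_pos (Real.exp_pos _), mul_one]
    rw [hsign q, hsign q'] at hs
    rw [← sign_mul_abs (t q * Real.exp (g i q / c i)), hs, h4, sign_mul_abs]
  · simp only [firstIntegrals, hi, if_false]
    have h1 := hf i
    have h2 := hf k
    field_simp
    linear_combination c k * h1 - c i * h2

end IsNormalForm

/-- The last two clauses compare the slices with `level`, which does not involve the local data `c`,
`g`, `k`. This is what allows different boxes to be compared with one another. -/
theorem exists_isFlowBox (F : BIntegrableSystem Ω) (hZ : IsHypersurface (2 * n) Z)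
    (hΩ : IsBSymplectic Ω) {V : Set M} {t : M → ℝ} (ht : IsDefiningFunction (2 * n) Z V t) {x : M}
    (hxV : x ∈ V) (hxZ : x ∈ Z) (hreg : F.IsRegular x) :
    ∃ ψ : OpenPartialHomeomorph M (EuclideanSpace ℝ (Fin n) × EuclideanSpace ℝ (Fin n)),
      IsFlowBox (fun i => (F.X i).1) ψ ∧ x ∈ ψ.source ∧ ψ.source ⊆ V ∧
      (∀ q ∈ ψ.source, ∀ q' ∈ ψ.source, (ψ q).2 = (ψ q').2 → F.level t q = F.level t q') ∧
      ∀ q ∈ ψ.source, ∀ q' ∈ ψ.source, q ∉ Z → F.level t q = F.level t q' →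
        (ψ q).2 = (ψ q').2 := by
  obtain ⟨O, c, g, hxO, hOV, h⟩ := F.exists_isNormalForm ht hxV hxZ
  obtain ⟨k, hk⟩ := h.exists_ne_zero hZ hΩ hxO hxZ hreg
  obtain ⟨ψ, hψ, hxψ, hψO, hψG⟩ := BSymplectic.exists_isFlowBox rfl
    (X := fun i => (F.X i).1) (fun i j p => F.mlieBracket_eq_zero hZ hΩ i j p) hreg
    h.defining.isOpen hxO (fun q hq => h.contMDiffAt_firstIntegrals k hq)
    (fun q hq j => h.mfderiv_firstIntegrals_X hZ hk hq j)
    (h.surjective_mfderiv_firstIntegrals hZ hΩ hk hxO hxZ hreg)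
  refine ⟨ψ, hψ, hxψ, hψO.trans hOV, fun q hq q' hq' heq => ?_, fun q hq q' hq' hqZ heq => ?_⟩
  · rw [hψG, hψG, sub_left_inj] at heq
    exact h.level_eq_of_firstIntegrals_eq hk (hψO hq) (hψO hq') heq
  · rw [hψG, hψG, sub_left_inj]
    exact h.firstIntegrals_eq_of_level_eq hk (hψO hq) (hψO hq') hqZ heq

end BIntegrableSystem

end FirstIntegrals

end BSymplectic

namespace BSymplectic

/-! ### Tangent curves and leaves. -/

section Leaves

variable {n d : ℕ} {M : Type*} [TopologicalSpace M] [ChartedSpace (EuclideanSpace ℝ (Fin d)) M]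
  [IsManifold (𝓡 d) ∞ M] {X : Fin n → VectorFields d M}

/-- A smooth curve of points where the `X i` are independent, tangent to the span of the `X i`. -/
structure IsTangentCurve (X : Fin n → VectorFields d M) (γ : ℝ → M) : Prop where
  smooth : ContMDiff 𝓘(ℝ, ℝ) (𝓡 d) ∞ γ
  tangent : ∀ s : ℝ, (LinearIndependent ℝ fun i => X i (γ s)) ∧
    mfderiv 𝓘(ℝ, ℝ) (𝓡 d) γ s (1 : ℝ) ∈ Submodule.span ℝ (Set.range fun i => X i (γ s))

/-- The points that can be joined to `p` by a tangent curve. -/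
def tangentLeaf (X : Fin n → VectorFields d M) (p : M) : Set M :=
  {q | ∃ γ : ℝ → M, IsTangentCurve X γ ∧ γ 0 = p ∧ γ 1 = q}

theorem BIntegrableSystem.leaf_eq_tangentLeaf {n : ℕ} {M : Type*} [TopologicalSpace M]
    [ChartedSpace (EuclideanSpace ℝ (Fin (2 * n))) M] [IsManifold (𝓡 (2 * n)) ∞ M]
    {Z : Set M} {Ω : BBilinForm (2 * n) Z} (F : BIntegrableSystem Ω) (p : M) :
    F.leaf p = tangentLeaf (fun i => (F.X i).1) p := by
  ext q
  constructor
  · rintro ⟨γ, h1, h2, h3, h4⟩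
    exact ⟨γ, ⟨h1, h4⟩, h2, h3⟩
  · rintro ⟨γ, ⟨h1, h4⟩, h2, h3⟩
    exact ⟨γ, h1, h2, h3, h4⟩

namespace IsTangentCurve

theorem comp {γ : ℝ → M} (h : IsTangentCurve X γ) {φ : ℝ → ℝ} (hφ : ContDiff ℝ ∞ φ) :
    IsTangentCurve X (fun s => γ (φ s)) := by
  refine ⟨h.smooth.comp hφ.contMDiff, fun s => ⟨(h.tangent (φ s)).1, ?_⟩⟩
  have h1 := mfderiv_comp s (h.smooth.contMDiffAt.mdifferentiableAt (by simp) :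
    MDifferentiableAt 𝓘(ℝ, ℝ) (𝓡 d) γ (φ s))
    (hφ.differentiable (by simp) s).mdifferentiableAt
  have h2 : (mfderiv 𝓘(ℝ, ℝ) (𝓡 d) (γ ∘ φ) s (1 : ℝ) : EuclideanSpace ℝ (Fin d)) =
      (deriv φ s) • (mfderiv 𝓘(ℝ, ℝ) (𝓡 d) γ (φ s) (1 : ℝ) : EuclideanSpace ℝ (Fin d)) := by
    refine (congrArg (fun L : ℝ →L[ℝ] EuclideanSpace ℝ (Fin d) => L 1) h1).trans ?_
    rw [mfderiv_eq_fderiv]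
    have h3 : (fderiv ℝ φ s) 1 = deriv φ s • (1 : ℝ) := by simp
    show (mfderiv 𝓘(ℝ, ℝ) (𝓡 d) γ (φ s) : ℝ →L[ℝ] EuclideanSpace ℝ (Fin d)) ((fderiv ℝ φ s) 1) = _
    rw [h3]
    exact map_smul (mfderiv 𝓘(ℝ, ℝ) (𝓡 d) γ (φ s) : ℝ →L[ℝ] EuclideanSpace ℝ (Fin d)) _ _
  have h4 : (mfderiv 𝓘(ℝ, ℝ) (𝓡 d) (fun s => γ (φ s)) s (1 : ℝ) : EuclideanSpace ℝ (Fin d)) ∈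
      Submodule.span ℝ (Set.range fun i => (X i (γ (φ s)) : EuclideanSpace ℝ (Fin d))) := by
    refine (congrArg (fun v => v ∈ Submodule.span ℝ
      (Set.range fun i => (X i (γ (φ s)) : EuclideanSpace ℝ (Fin d)))) h2).mpr ?_
    exact Submodule.smul_mem _ _ (h.tangent (φ s)).2
  exact h4

theorem congr_of_eventually {γ : ℝ → M}
    (h : ∀ s, ∃ δ : ℝ → M, IsTangentCurve X δ ∧ γ =ᶠ[𝓝 s] δ) : IsTangentCurve X γ := by
  refine ⟨fun s => ?_, fun s => ?_⟩
  · obtain ⟨δ, hδ, heq⟩ := h s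
    exact (hδ.smooth s).congr_of_eventuallyEq heq
  · obtain ⟨δ, hδ, heq⟩ := h s
    have h1 := hδ.tangent s
    have h2 := congrArg (fun L : ℝ →L[ℝ] EuclideanSpace ℝ (Fin d) => L 1)
      (heq.mfderiv_eq (I := 𝓘(ℝ, ℝ)) (I' := 𝓡 d))
    have h3 : γ s = δ s := heq.self_of_nhds
    have h4 : (mfderiv 𝓘(ℝ, ℝ) (𝓡 d) γ s (1 : ℝ) : EuclideanSpace ℝ (Fin d)) =
      mfderiv 𝓘(ℝ, ℝ) (𝓡 d) δ s (1 : ℝ) := h2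
    have h5 : (fun i => (X i (γ s) : EuclideanSpace ℝ (Fin d))) = fun i => X i (δ s) := by
      rw [h3]
    refine ⟨?_, ?_⟩
    · have : LinearIndependent ℝ (fun i => (X i (γ s) : EuclideanSpace ℝ (Fin d))) := by
        rw [h5]
        exact h1.1
      exact this
    · have : (mfderiv 𝓘(ℝ, ℝ) (𝓡 d) γ s (1 : ℝ) : EuclideanSpace ℝ (Fin d)) ∈
          Submodule.span ℝ (Set.range fun i => (X i (γ s) : EuclideanSpace ℝ (Fin d))) := by
        rw [h4, h5]
        exact h1.2
      exact this

theorem mem_tangentLeaf {γ : ℝ → M} (h : IsTangentCurve X γ) (r s : ℝ) :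
    γ s ∈ tangentLeaf X (γ r) :=
  ⟨_, h.comp (φ := fun u => r + u * (s - r)) (by fun_prop), by simp, by simp⟩

end IsTangentCurve

theorem isTangentCurve_const {p : M} (h : LinearIndependent ℝ fun i => X i p) :
    IsTangentCurve X fun _ => p := by
  refine ⟨contMDiff_const, fun s => ⟨h, ?_⟩⟩
  have h1 : (mfderiv 𝓘(ℝ, ℝ) (𝓡 d) (fun _ : ℝ => p) s (1 : ℝ) : EuclideanSpace ℝ (Fin d)) = 0 :=
    congrArg (fun L : ℝ →L[ℝ] EuclideanSpace ℝ (Fin d) => L 1) mfderiv_const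
  have h2 : (mfderiv 𝓘(ℝ, ℝ) (𝓡 d) (fun _ : ℝ => p) s (1 : ℝ) : EuclideanSpace ℝ (Fin d)) ∈
      Submodule.span ℝ (Set.range fun i => (X i p : EuclideanSpace ℝ (Fin d))) := by
    rw [h1]
    exact Submodule.zero_mem _
  exact h2

theorem mem_tangentLeaf_self {p : M} (h : LinearIndependent ℝ fun i => X i p) :
    p ∈ tangentLeaf X p :=
  ⟨_, isTangentCurve_const h, rfl, rfl⟩

theorem linearIndependent_of_mem_tangentLeaf {p q : M} (h : q ∈ tangentLeaf X p) :
    LinearIndependent ℝ fun i => X i q := by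
  obtain ⟨γ, hγ, -, rfl⟩ := h
  exact (hγ.tangent 1).1

theorem mem_tangentLeaf_symm {p q : M} (h : q ∈ tangentLeaf X p) : p ∈ tangentLeaf X q := by
  obtain ⟨γ, hγ, rfl, rfl⟩ := h
  exact hγ.mem_tangentLeaf 1 0

theorem mem_tangentLeaf_trans {p q r : M} (hpq : q ∈ tangentLeaf X p) (hqr : r ∈ tangentLeaf X q) :
    r ∈ tangentLeaf X p := by
  obtain ⟨γ, hγ, rfl, rfl⟩ := hpq
  obtain ⟨δ, hδ, h0, rfl⟩ := hqr
  -- The first curve rests at its end for `s ≥ 1 / 3`, the second rests at its start for `s ≤ 2 /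
  -- 3`. Gluing at `1 / 2` is therefore smooth.
  have h1 := hγ.comp (φ := fun s => Real.smoothTransition (3 * s))
    (Real.smoothTransition.contDiff.comp (by fun_prop))
  have h2 := hδ.comp (φ := fun s => Real.smoothTransition (3 * s - 2))
    (Real.smoothTransition.contDiff.comp (by fun_prop))
  refine ⟨fun s => if s < 1 / 2 then γ (Real.smoothTransition (3 * s))
    else δ (Real.smoothTransition (3 * s - 2)), IsTangentCurve.congr_of_eventually fun s => ?_,
    ?_, ?_⟩
  · rcases lt_or_ge s (1 / 2) with hs | hs
    · refine ⟨_, h1, ?_⟩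
      filter_upwards [isOpen_Iio.mem_nhds hs] with u hu
      rw [if_pos (show u < 1 / 2 from hu)]
    · refine ⟨_, h2, ?_⟩
      filter_upwards [isOpen_Ioi.mem_nhds (show (1 / 3 : ℝ) < s by linarith)] with u hu
      have hu' : 1 / 3 < u := hu
      split_ifs with hlt
      · rw [Real.smoothTransition.one_of_one_le (by linarith),
          Real.smoothTransition.zero_of_nonpos (by linarith), h0]
      · rfl
  · norm_num
  · norm_num

end Leaves

/-! ### Tangent curves and integral curves in flow boxes. -/

section FlowBoxes

variable {n d : ℕ} {M : Type*} [TopologicalSpace M] [ChartedSpace (EuclideanSpace ℝ (Fin d)) M]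
  [IsManifold (𝓡 d) ∞ M] {X : Fin n → VectorFields d M}
  {ψ : OpenPartialHomeomorph M (EuclideanSpace ℝ (Fin n) × EuclideanSpace ℝ (Fin n))}

namespace IsFlowBox

theorem mdifferentiableAt (h : IsFlowBox X ψ) {q : M} (hq : q ∈ ψ.source) :
    MDifferentiableAt (𝓡 d) 𝓘(ℝ, EuclideanSpace ℝ (Fin n) × EuclideanSpace ℝ (Fin n)) ψ q :=
  ((h.smooth q hq).contMDiffAt (ψ.open_source.mem_nhds hq)).mdifferentiableAt (by simp)

theorem linearIndependent (h : IsFlowBox X ψ) {q : M} (hq : q ∈ ψ.source) :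
    LinearIndependent ℝ fun i => X i q := by
  refine linearIndependent_of_frame_injective fun s s' hs => ?_
  have h1 := h.mfderiv_frame q hq s
  rw [hs, h.mfderiv_frame q hq s'] at h1
  exact (congrArg Prod.fst h1).symm

theorem mfderiv_symm (h : IsFlowBox X ψ)
    {z : EuclideanSpace ℝ (Fin n) × EuclideanSpace ℝ (Fin n)}
    (hz : z ∈ ψ.target) (s : EuclideanSpace ℝ (Fin n)) :
    (mfderiv 𝓘(ℝ, EuclideanSpace ℝ (Fin n) × EuclideanSpace ℝ (Fin n)) (𝓡 d) ψ.symm z (s, 0) :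
      EuclideanSpace ℝ (Fin d)) = frame X (ψ.symm z) s := by
  let Q := EuclideanSpace ℝ (Fin d)
  let E := EuclideanSpace ℝ (Fin n)
  have hq := ψ.map_target hz
  have hsm : MDifferentiableAt 𝓘(ℝ, E × E) (𝓡 d) ψ.symm (ψ (ψ.symm z)) := by
    rw [ψ.right_inv hz]
    exact ((h.smooth_symm z hz).contMDiffAt (ψ.open_target.mem_nhds hz)).mdifferentiableAt (by simp)
  have h1 := mfderiv_comp (ψ.symm z) hsm (h.mdifferentiableAt hq)
  have h2 : (ψ.symm ∘ ψ) =ᶠ[𝓝 (ψ.symm z)] id := by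
    filter_upwards [ψ.open_source.mem_nhds hq] with q hq' using ψ.left_inv hq'
  have h3 : (mfderiv (𝓡 d) (𝓡 d) (ψ.symm ∘ ψ) (ψ.symm z) : Q →L[ℝ] Q) =
      ContinuousLinearMap.id ℝ Q := (h2.mfderiv_eq (I := 𝓡 d) (I' := 𝓡 d)).trans mfderiv_id
  have h4 := congrArg (fun L : Q →L[ℝ] Q => L (frame X (ψ.symm z) s)) (h1.symm.trans h3)
  have h5 : (mfderiv 𝓘(ℝ, E × E) (𝓡 d) ψ.symm (ψ (ψ.symm z)) : E × E →L[ℝ] Q)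
      (mfderiv (𝓡 d) 𝓘(ℝ, E × E) ψ (ψ.symm z) (frame X (ψ.symm z) s)) =
      frame X (ψ.symm z) s := h4
  have h6 : (mfderiv (𝓡 d) 𝓘(ℝ, E × E) ψ (ψ.symm z) (frame X (ψ.symm z) s) : E × E) = (s, 0) :=
    h.mfderiv_frame _ hq s
  rw [← h5]
  refine Eq.trans ?_ (congrArg
    (mfderiv 𝓘(ℝ, E × E) (𝓡 d) ψ.symm (ψ (ψ.symm z)) : E × E →L[ℝ] Q) h6.symm)
  rw [ψ.right_inv hz]

theorem hasMFDerivAt_symm_line (h : IsFlowBox X ψ)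
    {z : EuclideanSpace ℝ (Fin n) × EuclideanSpace ℝ (Fin n)} {σ : ℝ → ℝ} {σ' r : ℝ}
    (hσ : HasDerivAt σ σ' r) {s : EuclideanSpace ℝ (Fin n)} (hz : z + (σ r • s, 0) ∈ ψ.target) :
    HasMFDerivAt 𝓘(ℝ, ℝ) (𝓡 d) (fun r => ψ.symm (z + (σ r • s, 0))) r
      ((1 : ℝ →L[ℝ] ℝ).smulRight (frame X (ψ.symm (z + (σ r • s, 0))) (σ' • s))) := by
  let Q := EuclideanSpace ℝ (Fin d)
  let E := EuclideanSpace ℝ (Fin n)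
  have hsm : MDifferentiableAt 𝓘(ℝ, E × E) (𝓡 d) ψ.symm (z + (σ r • s, 0)) :=
    ((h.smooth_symm _ hz).contMDiffAt (ψ.open_target.mem_nhds hz)).mdifferentiableAt (by simp)
  have h1 : HasDerivAt (fun r => z + ((σ r • s, 0) : E × E)) (σ' • s, 0) r :=
    ((hσ.smul_const s).prodMk (hasDerivAt_const r (0 : E))).const_add z
  have h2 := hsm.hasMFDerivAt.comp r (f := fun r => z + ((σ r • s, 0) : E × E))
    h1.hasFDerivAt.hasMFDerivAt
  refine h2.congr_mfderiv ?_
  have key : ((mfderiv 𝓘(ℝ, E × E) (𝓡 d) ψ.symm (z + (σ r • s, 0)) : E × E →L[ℝ] Q).comp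
      (ContinuousLinearMap.toSpanSingleton ℝ ((σ' • s, 0) : E × E))) =
      (1 : ℝ →L[ℝ] ℝ).smulRight (frame X (ψ.symm (z + (σ r • s, 0))) (σ' • s) : Q) := by
    ext1
    have h3 := h.mfderiv_symm hz (σ' • s)
    exact (congrArg (mfderiv 𝓘(ℝ, E × E) (𝓡 d) ψ.symm (z + (σ r • s, 0)) : E × E →L[ℝ] Q)
      (one_smul ℝ ((σ' • s, 0) : E × E))).trans (h3.trans (one_smul ℝ (_ : Q)).symm)
  exact key

/-- A tangent curve stays on the slice of a flow box where it starts. -/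
theorem eventually_snd_eq (h : IsFlowBox X ψ) {γ : ℝ → M} (hγ : IsTangentCurve X γ) {r₀ : ℝ}
    (h₀ : γ r₀ ∈ ψ.source) :
    ∀ᶠ r in 𝓝 r₀, γ r ∈ ψ.source ∧ (ψ (γ r)).2 = (ψ (γ r₀)).2 := by
  let Q := EuclideanSpace ℝ (Fin d)
  let E := EuclideanSpace ℝ (Fin n)
  have hev : ∀ᶠ r in 𝓝 r₀, γ r ∈ ψ.source :=
    hγ.smooth.continuous.continuousAt.eventually (ψ.open_source.mem_nhds h₀)
  obtain ⟨ε, hε, hball⟩ := Metric.eventually_nhds_iff_ball.1 hev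
  have hder : ∀ r ∈ Metric.ball r₀ ε, HasDerivAt (fun r => (ψ (γ r)).2) 0 r := by
    intro r hr
    have hq := hball r hr
    have h1 := (h.mdifferentiableAt hq).hasMFDerivAt.comp r
      (hγ.smooth.contMDiffAt.mdifferentiableAt (by simp) :
        MDifferentiableAt 𝓘(ℝ, ℝ) (𝓡 d) γ r).hasMFDerivAt
    have h2 := h1.hasFDerivAt
    obtain ⟨w, hw⟩ := (Submodule.mem_span_range_iff_exists_fun ℝ).1 (hγ.tangent r).2
    have h3 : frame X (γ r) (WithLp.toLp 2 w) = mfderiv 𝓘(ℝ, ℝ) (𝓡 d) γ r (1 : ℝ) := by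
      rw [frame_apply, ← hw]
    have h4 := h.mfderiv_frame _ hq (WithLp.toLp 2 w)
    rw [h3] at h4
    have h5 : HasDerivAt (ψ ∘ γ) (WithLp.toLp 2 w, 0) r := by
      have h6 : HasDerivAt (ψ ∘ γ) (((mfderiv (𝓡 d) 𝓘(ℝ, E × E) ψ (γ r) : Q →L[ℝ] E × E).comp
        (mfderiv 𝓘(ℝ, ℝ) (𝓡 d) γ r : ℝ →L[ℝ] Q)) 1) r := HasFDerivAt.hasDerivAt h2
      have h7 : ((mfderiv (𝓡 d) 𝓘(ℝ, E × E) ψ (γ r) : Q →L[ℝ] E × E).comp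
        (mfderiv 𝓘(ℝ, ℝ) (𝓡 d) γ r : ℝ →L[ℝ] Q)) 1 = (WithLp.toLp 2 w, 0) := h4
      rwa [h7] at h6
    exact (hasFDerivAt_snd (𝕜 := ℝ) (p := ψ (γ r))).comp_hasDerivAt r h5
  filter_upwards [Metric.ball_mem_nhds r₀ hε] with r hr
  refine ⟨hball r hr, ?_⟩
  exact (convex_ball r₀ ε).is_const_of_fderivWithin_eq_zero (𝕜 := ℝ)
    (f := fun r => (ψ (γ r)).2)
    (fun r hr => (hder r hr).differentiableAt.differentiableWithinAt)
    (fun r hr => by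
      rw [fderivWithin_of_isOpen Metric.isOpen_ball hr]
      have := (hder r hr).hasFDerivAt.fderiv
      rw [this]
      ext
      simp) hr (Metric.mem_ball_self hε)

theorem symm_add_mem_tangentLeaf (h : IsFlowBox X ψ)
    {z : EuclideanSpace ℝ (Fin n) × EuclideanSpace ℝ (Fin n)} {s : EuclideanSpace ℝ (Fin n)}
    (hz : ∀ r ∈ Set.Icc (0 : ℝ) 1, z + (r • s, 0) ∈ ψ.target) :
    ψ.symm (z + (s, 0)) ∈ tangentLeaf X (ψ.symm z) := by
  let E := EuclideanSpace ℝ (Fin n)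
  -- Tangent curves are defined on all of `ℝ`, whereas the segment lies in the box only for
  -- parameters in `[0, 1]`; the reparametrization never leaves that interval.
  have hmem : ∀ r, z + (Real.smoothTransition r • s, 0) ∈ ψ.target := fun r =>
    hz _ ⟨Real.smoothTransition.nonneg r, Real.smoothTransition.le_one r⟩
  refine ⟨fun r => ψ.symm (z + (Real.smoothTransition r • s, 0)), ⟨fun r => ?_, fun r => ⟨?_, ?_⟩⟩,
    ?_, ?_⟩
  · have h1 : ContDiff ℝ ∞ fun r => z + ((Real.smoothTransition r • s, 0) : E × E) :=
      contDiff_const.add ((Real.smoothTransition.contDiff.smul contDiff_const).prodMk contDiff_const)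
    exact ((h.smooth_symm _ (hmem r)).contMDiffAt (ψ.open_target.mem_nhds (hmem r))).comp r
      h1.contMDiff.contMDiffAt
  · exact h.linearIndependent (ψ.map_target (hmem r))
  · have h1 : HasDerivAt Real.smoothTransition (deriv Real.smoothTransition r) r :=
      ((Real.smoothTransition.contDiff (n := 1)).differentiable (by simp) r).hasDerivAt
    have h2 := (h.hasMFDerivAt_symm_line h1 (hmem r)).mfderiv
    have h3 := congrArg (fun L : ℝ →L[ℝ] EuclideanSpace ℝ (Fin d) => L 1) h2
    have h4 : (mfderiv 𝓘(ℝ, ℝ) (𝓡 d) (fun r => ψ.symm (z + (Real.smoothTransition r • s, 0))) r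
        (1 : ℝ) : EuclideanSpace ℝ (Fin d)) =
        frame X (ψ.symm (z + (Real.smoothTransition r • s, 0)))
          (deriv Real.smoothTransition r • s) := h3.trans (one_smul ℝ (_ : EuclideanSpace ℝ (Fin d)))
    have h5 : (mfderiv 𝓘(ℝ, ℝ) (𝓡 d) (fun r => ψ.symm (z + (Real.smoothTransition r • s, 0))) r
        (1 : ℝ) : EuclideanSpace ℝ (Fin d)) ∈ Submodule.span ℝ (Set.range fun i =>
          (X i (ψ.symm (z + (Real.smoothTransition r • s, 0))) : EuclideanSpace ℝ (Fin d))) := by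
      rw [h4]
      exact frame_mem_span X _ _
    exact h5
  · simp only [Real.smoothTransition.zero_of_nonpos le_rfl, zero_smul]
    congr 1
    exact add_zero z
  · simp only [Real.smoothTransition.one_of_one_le le_rfl, one_smul]

/-- Uniqueness of integral curves, read in two flow boxes. -/
theorem symm_add_eq [T2Space M] (h : IsFlowBox X ψ)
    {ψ' : OpenPartialHomeomorph M (EuclideanSpace ℝ (Fin n) × EuclideanSpace ℝ (Fin n))}
    (h' : IsFlowBox X ψ') {z z' : EuclideanSpace ℝ (Fin n) × EuclideanSpace ℝ (Fin n)}
    {s : EuclideanSpace ℝ (Fin n)} (heq : ψ.symm z = ψ'.symm z')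
    (hz : ∀ r ∈ Set.Ioo (-1 : ℝ) 2, z + (r • s, 0) ∈ ψ.target)
    (hz' : ∀ r ∈ Set.Ioo (-1 : ℝ) 2, z' + (r • s, 0) ∈ ψ'.target) :
    ψ.symm (z + (s, 0)) = ψ'.symm (z' + (s, 0)) := by
  let E := EuclideanSpace ℝ (Fin n)
  let v : (p : M) → TangentSpace (𝓡 d) p := fun p => frame X p s
  have hv : ContMDiff (𝓡 d) (𝓡 d).tangent 1 (fun p => (⟨p, v p⟩ : TangentBundle (𝓡 d) M)) := by
    let W : VectorFields d M := ∑ i, s i • X i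
    have hW : ∀ p, W p = v p := by
      intro p
      have h1 := map_sum (ContMDiffSection.coeAddHom (𝓡 d) (EuclideanSpace ℝ (Fin d)) ∞
        (TangentSpace (𝓡 d) : M → Type)) (fun i => s i • X i) Finset.univ
      have h2 : W p = (∑ i, ContMDiffSection.coeAddHom (𝓡 d) (EuclideanSpace ℝ (Fin d)) ∞
        (TangentSpace (𝓡 d) : M → Type) (s i • X i)) p := congrFun h1 p
      rw [h2, Finset.sum_apply]
      exact (frame_apply X p s).symm
    have h1 : (fun p => (⟨p, v p⟩ : TangentBundle (𝓡 d) M)) = fun p => ⟨p, W p⟩ := by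
      funext p
      rw [hW]
    rw [h1]
    exact W.contMDiff.of_le (by simp)
  have hcurve : ∀ {ψ : OpenPartialHomeomorph M (E × E)}, IsFlowBox X ψ → ∀ {z : E × E},
      (∀ r ∈ Set.Ioo (-1 : ℝ) 2, z + (r • s, 0) ∈ ψ.target) →
      IsMIntegralCurveOn (fun r => ψ.symm (z + (r • s, 0))) v (Set.Ioo (-1 : ℝ) 2) := by
    intro ψ h z hz r hr
    have h1 := h.hasMFDerivAt_symm_line (hasDerivAt_id r) (hz r hr)
    simp only [id, one_smul] at h1
    exact h1.hasMFDerivWithinAt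
  -- Both lines are integral curves of the single field `∑ i, s i • X i` with the same value at time
  -- `0`, on an open interval that also contains time `1`.
  have key := isMIntegralCurveOn_Ioo_eqOn_of_contMDiff_boundaryless (t₀ := 0)
    (by norm_num : (0 : ℝ) ∈ Set.Ioo (-1 : ℝ) 2) hv (hcurve h hz) (hcurve h' hz') (by
      simp only [zero_smul]
      have h0 : ∀ z : E × E, z + (0, 0) = z := add_zero
      rw [h0, h0, heq])
  have := key (by norm_num : (1 : ℝ) ∈ Set.Ioo (-1 : ℝ) 2)
  simpa using this

end IsFlowBox

end FlowBoxes

end BSymplectic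

namespace BSymplectic

/-! ### The joint flow near a compact leaf. -/

section LocalActions

variable {n d : ℕ} {M : Type*} [TopologicalSpace M] [ChartedSpace (EuclideanSpace ℝ (Fin d)) M]
  [IsManifold (𝓡 d) ∞ M] {X : Fin n → VectorFields d M} {A : Type*} {J : M → A}
  {m : M} {R : ℝ} {N : Set M} {h : EuclideanSpace ℝ (Fin n) → M → M}

/-- On the neighbourhood `N` of the leaf of `m`, and for times of norm less than `R`, the map `h`
is the joint flow of the commuting vector fields `X i`; the function `J` is invariant. -/
structure IsLocalAction (X : Fin n → VectorFields d M) (m : M) (J : M → A) (R : ℝ) (N : Set M)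
    (h : EuclideanSpace ℝ (Fin n) → M → M) : Prop where
  isOpen : IsOpen N
  leaf_subset : tangentLeaf X m ⊆ N
  smooth : ContMDiffOn (𝓘(ℝ, EuclideanSpace ℝ (Fin n)).prod (𝓡 d)) (𝓡 d) ∞
    (fun z : EuclideanSpace ℝ (Fin n) × M => h z.1 z.2) (Metric.ball 0 R ×ˢ N)
  add : ∀ p ∈ N, ∀ a b, ‖a‖ < R → ‖b‖ < R → ‖a + b‖ < R → h b p ∈ N → h a (h b p) = h (a + b) p
  inv : ∀ p ∈ N, ∀ s, ‖s‖ < R → J (h s p) = J p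
  mem_leaf : ∀ p ∈ N, ∀ s, ‖s‖ < R → h s p ∈ tangentLeaf X p
  exists_box : ∀ p ∈ N, ∃ ψ, IsFlowBox X ψ ∧ p ∈ ψ.source
  box : ∀ p ∈ N, ∀ ψ, IsFlowBox X ψ → p ∈ ψ.source →
    ∀ᶠ z : EuclideanSpace ℝ (Fin n) × M in 𝓝 (0, p), h z.1 z.2 = ψ.symm (ψ z.2 + (z.1, 0))

/-- Bookkeeping of radii: starting in the ball of radius `2 * ρ` leaves room for one earlier move of
length less than `ρ` from the ball of radius `ρ`, and `4 * ρ` contains the line on the open interval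
used in `symm_add_eq`. -/
theorem add_smul_mem_ball {E : Type*} [NormedAddCommGroup E] [NormedSpace ℝ E] {c z : E × E}
    {ρ r : ℝ} {s : E} (hz : z ∈ Metric.ball c (2 * ρ)) (hs : ‖s‖ < ρ)
    (hr : r ∈ Set.Ioo (-1 : ℝ) 2) : z + (r • s, 0) ∈ Metric.ball c (4 * ρ) := by
  rw [Metric.mem_ball, dist_eq_norm] at hz ⊢
  have h1 : ‖((r • s, 0) : E × E)‖ ≤ 2 * ‖s‖ := by
    rw [Prod.norm_def]
    simp only [norm_zero, norm_smul, Real.norm_eq_abs]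
    refine max_le (mul_le_mul_of_nonneg_right (abs_le.2 ⟨by linarith [hr.1], hr.2.le⟩)
      (norm_nonneg s)) (by positivity)
  calc ‖z + (r • s, 0) - c‖ = ‖(z - c) + (r • s, 0)‖ := by congr 1; abel
    _ ≤ ‖z - c‖ + ‖((r • s, 0) : E × E)‖ := norm_add_le _ _
    _ < 4 * ρ := by linarith

theorem exists_pos_le_of_finset {ι : Type*} (T : Finset ι) (ρ : ι → ℝ) (hρ : ∀ i ∈ T, 0 < ρ i) :
    ∃ ε, 0 < ε ∧ ∀ i ∈ T, ε ≤ ρ i := by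
  classical
  induction T using Finset.induction_on with
  | empty => exact ⟨1, one_pos, by simp⟩
  | insert a T ha ih =>
    obtain ⟨ε, hε, h⟩ := ih fun i hi => hρ i (Finset.mem_insert_of_mem hi)
    refine ⟨min ε (ρ a), lt_min hε (hρ a (Finset.mem_insert_self _ _)), fun i hi => ?_⟩
    rcases Finset.mem_insert.1 hi with rfl | hi
    · exact min_le_right _ _
    · exact (min_le_left _ _).trans (h i hi)

theorem IsFlowBox.contMDiffAt_symm_add
    {ψ : OpenPartialHomeomorph M (EuclideanSpace ℝ (Fin n) × EuclideanSpace ℝ (Fin n))}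
    (hψ : IsFlowBox X ψ) {s : EuclideanSpace ℝ (Fin n)} {q : M} (hq : q ∈ ψ.source)
    (hs : ψ q + (s, 0) ∈ ψ.target) :
    ContMDiffAt (𝓘(ℝ, EuclideanSpace ℝ (Fin n)).prod (𝓡 d)) (𝓡 d) ∞
      (fun z : EuclideanSpace ℝ (Fin n) × M => ψ.symm (ψ z.2 + (z.1, 0))) (s, q) := by
  let E := EuclideanSpace ℝ (Fin n)
  have h1 : ContMDiffAt (𝓘(ℝ, E).prod (𝓡 d)) 𝓘(ℝ, E × E) ∞ (fun z : E × M => ψ z.2) (s, q) :=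
    ((hψ.smooth q hq).contMDiffAt (ψ.open_source.mem_nhds hq)).comp (s, q) contMDiffAt_snd
  have h2 : ContMDiffAt (𝓘(ℝ, E).prod (𝓡 d)) 𝓘(ℝ, E × E) ∞
      (fun z : E × M => ((z.1, 0) : E × E)) (s, q) :=
    contMDiffAt_fst.prodMk_space contMDiffAt_const
  exact ContMDiffAt.comp (s, q) ((hψ.smooth_symm _ hs).contMDiffAt (ψ.open_target.mem_nhds hs))
    (h1.add h2)

/-- Near a compact leaf that is covered by flow boxes there is a local action for small times. -/
theorem exists_isLocalAction [T2Space M] (hm : m ∈ tangentLeaf X m) (hL : IsCompact (tangentLeaf X m))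
    (hbox : ∀ x ∈ tangentLeaf X m, ∃ ψ, IsFlowBox X ψ ∧ x ∈ ψ.source ∧
      ∀ q ∈ ψ.source, ∀ q' ∈ ψ.source, (ψ q).2 = (ψ q').2 → J q = J q') :
    ∃ ε N h, 0 < ε ∧ IsLocalAction X m J ε N h := by
  classical
  let E := EuclideanSpace ℝ (Fin n)
  have : Nonempty (OpenPartialHomeomorph M (E × E)) := ⟨(hbox m hm).choose⟩
  choose! ψ hψ hxψ hJ using hbox
  have hρ' : ∀ x ∈ tangentLeaf X m, ∃ ρ, 0 < ρ ∧ Metric.ball (ψ x x) (4 * ρ) ⊆ (ψ x).target := by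
    intro x hx
    obtain ⟨ρ, hρ, hb⟩ := Metric.isOpen_iff.1 (ψ x).open_target _ ((ψ x).map_source (hxψ x hx))
    exact ⟨ρ / 4, by positivity, by rwa [mul_div_cancel₀ _ (by norm_num)]⟩
  choose! ρ hρ hρt using hρ'
  let B : M → Set M := fun x => (ψ x).source ∩ ψ x ⁻¹' Metric.ball (ψ x x) (ρ x)
  have hBo : ∀ x, IsOpen (B x) := fun x => (ψ x).isOpen_inter_preimage Metric.isOpen_ball
  obtain ⟨T, hTL, hT⟩ := hL.elim_nhds_subcover B fun x hx =>
    (hBo x).mem_nhds ⟨hxψ x hx, Metric.mem_ball_self (hρ x hx)⟩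
  obtain ⟨ε, hε, hεT⟩ := exists_pos_le_of_finset T ρ fun x hx => hρ x (hTL x hx)
  let N : Set M := ⋃ x ∈ T, B x
  have hN : ∀ {q}, q ∈ N → ∃ x, x ∈ T ∧ q ∈ B x := by
    intro q hq
    simpa [N] using hq
  -- The flow is read in an arbitrary box of the finite cover. By uniqueness of integral curves
  -- (`key`) any other box of the cover gives the same result for times of norm less than `ε`. The
  -- value outside `N` is irrelevant.
  let h : E → M → M := fun s q =>
    if hq : ∃ x, x ∈ T ∧ q ∈ B x then (ψ hq.choose).symm (ψ hq.choose q + (s, 0)) else q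
  have hline : ∀ {x}, x ∈ T → ∀ {z : E × E}, z ∈ Metric.ball (ψ x x) (2 * ρ x) → ∀ {s : E},
      ‖s‖ < ε → ∀ r ∈ Set.Ioo (-1 : ℝ) 2, z + (r • s, 0) ∈ (ψ x).target := by
    intro x hx z hz s hs r hr
    exact hρt x (hTL x hx) (add_smul_mem_ball hz (hs.trans_le (hεT x hx)) hr)
  have hball : ∀ {x}, x ∈ T → ∀ {q}, q ∈ B x → ψ x q ∈ Metric.ball (ψ x x) (2 * ρ x) := by
    intro x hx q hq
    exact Metric.ball_subset_ball (by linarith [hρ x (hTL x hx)]) hq.2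
  have key : ∀ {x}, x ∈ T → ∀ {q}, q ∈ B x → ∀ {s : E}, ‖s‖ < ε →
      h s q = (ψ x).symm (ψ x q + (s, 0)) := by
    intro x hx q hq s hs
    have hex : ∃ x, x ∈ T ∧ q ∈ B x := ⟨x, hx, hq⟩
    have hy := hex.choose_spec
    simp only [h, dif_pos hex]
    refine (hψ _ (hTL _ hy.1)).symm_add_eq (hψ x (hTL x hx)) ?_ (hline hy.1 (hball hy.1 hy.2) hs)
      (hline hx (hball hx hq) hs)
    rw [(ψ _).left_inv hy.2.1, (ψ x).left_inv hq.1]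
  have hone : ∀ {x}, x ∈ T → ∀ {q}, q ∈ B x → ∀ {s : E}, ‖s‖ < ε →
      ψ x q + (s, 0) ∈ (ψ x).target := by
    intro x hx q hq s hs
    have := hline hx (hball hx hq) hs 1 (by norm_num)
    rwa [one_smul] at this
  refine ⟨ε, N, h, hε, ⟨isOpen_biUnion fun x _ => hBo x, hT, ?_, ?_, ?_, ?_, ?_, ?_⟩⟩
  · rintro ⟨s, q⟩ ⟨hs, hq⟩
    obtain ⟨x, hx, hqx⟩ := hN hq
    have hs' : ‖s‖ < ε := mem_ball_zero_iff.1 hs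
    refine (((hψ x (hTL x hx)).contMDiffAt_symm_add hqx.1 (hone hx hqx hs')).congr_of_eventuallyEq
      ?_).contMDiffWithinAt
    filter_upwards [(Metric.isOpen_ball.prod (hBo x)).mem_nhds
      (show ((s, q) : E × M) ∈ Metric.ball (0 : E) ε ×ˢ B x from ⟨hs, hqx⟩)] with z hz
    exact key hx hz.2 (mem_ball_zero_iff.1 hz.1)
  · intro p hp a b ha hb hab hbN
    obtain ⟨x, hx, hpx⟩ := hN hp
    obtain ⟨y, hy, hqy⟩ := hN hbN
    rw [key hy hqy ha, key hx hpx hab]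
    have h1 : ψ x p + (a + b, 0) = (ψ x p + (b, 0)) + (a, 0) := by
      rw [add_assoc]
      congr 1
      simp [add_comm]
    rw [h1]
    refine (hψ y (hTL y hy)).symm_add_eq (hψ x (hTL x hx)) ?_ (hline hy (hball hy hqy) ha)
      (hline hx ?_ ha)
    · rw [(ψ y).left_inv hqy.1, key hx hpx hb]
    · have h2 : ψ x p ∈ Metric.ball (ψ x x) (ρ x) := hpx.2
      rw [Metric.mem_ball, dist_eq_norm] at h2 ⊢
      have h3 : ‖((b, 0) : E × E)‖ < ρ x := by
        rw [Prod.norm_def]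
        simpa [hρ x (hTL x hx)] using hb.trans_le (hεT x hx)
      calc ‖ψ x p + (b, 0) - ψ x x‖ = ‖(ψ x p - ψ x x) + (b, 0)‖ := by congr 1; abel
        _ ≤ ‖ψ x p - ψ x x‖ + ‖((b, 0) : E × E)‖ := norm_add_le _ _
        _ < 2 * ρ x := by linarith
  · intro p hp s hs
    obtain ⟨x, hx, hpx⟩ := hN hp
    rw [key hx hpx hs]
    refine hJ x (hTL x hx) _ ((ψ x).map_target (hone hx hpx hs)) p hpx.1 ?_
    rw [(ψ x).right_inv (hone hx hpx hs)]
    simp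
  · intro p hp s hs
    obtain ⟨x, hx, hpx⟩ := hN hp
    rw [key hx hpx hs]
    have h1 := (hψ x (hTL x hx)).symm_add_mem_tangentLeaf (z := ψ x p) (s := s)
      fun r hr => hline hx (hball hx hpx) hs r ⟨by linarith [hr.1], by linarith [hr.2]⟩
    rwa [(ψ x).left_inv hpx.1] at h1
  · intro p hp
    obtain ⟨x, hx, hpx⟩ := hN hp
    exact ⟨ψ x, hψ x (hTL x hx), hpx.1⟩
  · intro p hp φ hφ hpφ
    obtain ⟨x, hx, hpx⟩ := hN hp
    obtain ⟨δ, hδ, hb⟩ := Metric.isOpen_iff.1 φ.open_target _ (φ.map_source hpφ)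
    have h1 : IsOpen (Metric.ball (0 : E) (min ε (δ / 4)) ×ˢ
        (B x ∩ (φ.source ∩ φ ⁻¹' Metric.ball (φ p) (2 * (δ / 4))))) :=
      Metric.isOpen_ball.prod ((hBo x).inter (φ.isOpen_inter_preimage Metric.isOpen_ball))
    filter_upwards [h1.mem_nhds ⟨Metric.mem_ball_self (by positivity), hpx, hpφ,
      Metric.mem_ball_self (by positivity)⟩] with z hz
    have hs := mem_ball_zero_iff.1 hz.1
    rw [key hx hz.2.1 (hs.trans_le (min_le_left _ _))]
    refine (hψ x (hTL x hx)).symm_add_eq hφ ?_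
      (hline hx (hball hx hz.2.1) (hs.trans_le (min_le_left _ _))) fun r hr => ?_
    · rw [(ψ x).left_inv hz.2.1.1, φ.left_inv hz.2.2.1]
    · refine hb ?_
      have := add_smul_mem_ball hz.2.2.2 (hs.trans_le (min_le_right _ _)) hr
      rwa [mul_div_cancel₀ _ (by norm_num)] at this

namespace IsLocalAction

theorem zero (H : IsLocalAction X m J R N h) {p : M} (hp : p ∈ N) : h 0 p = p := by
  obtain ⟨ψ, hψ, hpψ⟩ := H.exists_box p hp
  have h1 := (H.box p hp ψ hψ hpψ).self_of_nhds
  have h2 : ∀ z : EuclideanSpace ℝ (Fin n) × EuclideanSpace ℝ (Fin n), z + (0, 0) = z := add_zero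
  rw [h1, h2, ψ.left_inv hpψ]

theorem congr (H : IsLocalAction X m J R N h) (hR : 0 < R) {h' : EuclideanSpace ℝ (Fin n) → M → M}
    (heq : ∀ s, ‖s‖ < R → ∀ p ∈ N, h' s p = h s p) : IsLocalAction X m J R N h' := by
  refine ⟨H.isOpen, H.leaf_subset, ?_, ?_, ?_, ?_, H.exists_box, ?_⟩
  · exact H.smooth.congr fun z hz => heq z.1 (mem_ball_zero_iff.1 hz.1) z.2 hz.2
  · intro p hp a b ha hb hab hN
    rw [heq b hb p hp] at hN
    rw [heq b hb p hp, heq a ha _ hN, heq _ hab p hp, H.add p hp a b ha hb hab hN]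
  · intro p hp s hs
    rw [heq s hs p hp, H.inv p hp s hs]
  · intro p hp s hs
    rw [heq s hs p hp]
    exact H.mem_leaf p hp s hs
  · intro p hp ψ hψ hpψ
    filter_upwards [H.box p hp ψ hψ hpψ, (Metric.isOpen_ball.prod H.isOpen).mem_nhds
      (show ((0, p) : EuclideanSpace ℝ (Fin n) × M) ∈ Metric.ball 0 R ×ˢ N from
        ⟨Metric.mem_ball_self hR, hp⟩)] with z hz hz'
    rw [heq z.1 (mem_ball_zero_iff.1 hz'.1) z.2 hz'.2, hz]

/-- A tube argument over the compact ball of times. It serves to shrink a neighbourhood of the leaf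
so that subsequent moves stay in a prescribed one. -/
theorem isOpen_shrink (H : IsLocalAction X m J R N h) {r : ℝ} (hr : r < R) {K : Set M}
    (hK : IsOpen K) (hKN : K ⊆ N) :
    IsOpen {p | p ∈ K ∧ ∀ s ∈ Metric.closedBall (0 : EuclideanSpace ℝ (Fin n)) r, h s p ∈ K} := by
  rw [isOpen_iff_eventually]
  rintro p ⟨hp, hs⟩
  refine (hK.eventually_mem hp).and ?_
  refine (isCompact_closedBall (0 : EuclideanSpace ℝ (Fin n)) r).eventually_forall_of_forall_eventually
    fun s hs' => ?_
  have h1 : ContinuousAt (fun z : EuclideanSpace ℝ (Fin n) × M => h z.1 z.2) (s, p) :=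
    H.smooth.continuousOn.continuousAt ((Metric.isOpen_ball.prod H.isOpen).mem_nhds
      ⟨Metric.closedBall_subset_ball hr hs', hKN hp⟩)
  have h2 : Filter.Tendsto (fun z : M × EuclideanSpace ℝ (Fin n) => h z.2 z.1) (𝓝 (p, s))
      (𝓝 (h s p)) := h1.tendsto.comp (continuous_swap.tendsto (p, s))
  exact h2.eventually (hK.mem_nhds (hs s hs'))

theorem mem_leaf_of_mem_leaf (H : IsLocalAction X m J R N h) {p : M} (hp : p ∈ tangentLeaf X m)
    {s : EuclideanSpace ℝ (Fin n)} (hs : ‖s‖ < R) : h s p ∈ tangentLeaf X m :=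
  mem_tangentLeaf_trans hp (H.mem_leaf p (H.leaf_subset hp) s hs)

/-- A local action for times less than `R` extends to times less than `3 / 2 * R`. -/
theorem exists_extend (H : IsLocalAction X m J R N h) (hR : 0 < R) :
    ∃ N' ⊆ N, IsLocalAction X m J (3 / 2 * R) N' (fun s p => h ((1 / 2 : ℝ) • s)
        (h ((1 / 2 : ℝ) • s) p)) ∧
      ∀ s, ‖s‖ < R → ∀ p ∈ N', h ((1 / 2 : ℝ) • s) (h ((1 / 2 : ℝ) • s) p) = h s p := by
  let E := EuclideanSpace ℝ (Fin n)
  -- `T K` consists of the points that remain in `K` under half of any time less than `3 / 2 * R`.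
  -- It still contains the leaf, because the leaf is invariant. Iterating `T` leaves room for
  -- several half moves in succession.
  let T : Set M → Set M := fun K => {p | p ∈ K ∧ ∀ s ∈ Metric.closedBall (0 : E) (3 / 4 * R),
    h s p ∈ K}
  have hr : 3 / 4 * R < R := by linarith
  have hTo : ∀ {K}, IsOpen K → K ⊆ N → IsOpen (T K) := fun hK hKN => H.isOpen_shrink hr hK hKN
  have hTs : ∀ K, T K ⊆ K := fun K p hp => hp.1
  have hTL : ∀ {K}, tangentLeaf X m ⊆ K → tangentLeaf X m ⊆ T K := fun hK p hp =>
    ⟨hK hp, fun s hs => hK (H.mem_leaf_of_mem_leaf hp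
      ((mem_closedBall_zero_iff.1 hs).trans_lt hr))⟩
  have hN' : T (T (T N)) ⊆ N := ((hTs _).trans (hTs _)).trans (hTs _)
  have hhalf : ∀ {s : E}, ‖s‖ < 3 / 2 * R → ‖(1 / 2 : ℝ) • s‖ ≤ 3 / 4 * R := by
    intro s hs
    rw [norm_smul, Real.norm_eq_abs, abs_of_pos (by norm_num)]
    linarith
  have hmem : ∀ {K p} {s : E}, p ∈ T K → ‖s‖ ≤ 3 / 4 * R → h s p ∈ K := fun hp hs =>
    hp.2 _ (mem_closedBall_zero_iff.2 hs)
  have hcomm : ∀ {p}, p ∈ T N → ∀ {a b : E}, ‖a‖ ≤ 3 / 4 * R → ‖b‖ ≤ 3 / 4 * R →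
      ‖a + b‖ < R → h a (h b p) = h (a + b) p := fun hp a b ha hb hab =>
    H.add _ hp.1 _ _ (ha.trans_lt hr) (hb.trans_lt hr) hab (hmem hp hb)
  have hagree : ∀ s, ‖s‖ < R → ∀ p ∈ T (T (T N)),
      h ((1 / 2 : ℝ) • s) (h ((1 / 2 : ℝ) • s) p) = h s p := by
    intro s hs p hp
    have h1 : (1 / 2 : ℝ) • s + (1 / 2 : ℝ) • s = s := by
      rw [← add_smul]
      norm_num
    have hs' := hhalf (s := s) (by linarith)
    rw [hcomm (hTs _ (hTs _ hp)) hs' hs' (by rwa [h1]), h1]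
  refine ⟨T (T (T N)), hN', ⟨?_, ?_, ?_, ?_, ?_, ?_, ?_, ?_⟩, hagree⟩
  · exact hTo (hTo (hTo H.isOpen subset_rfl) (hTs _)) ((hTs _).trans (hTs _))
  · exact hTL (hTL (hTL H.leaf_subset))
  · have hs : ContMDiff (𝓘(ℝ, E).prod (𝓡 d)) 𝓘(ℝ, E) ∞ (fun z : E × M => (1 / 2 : ℝ) • z.1) :=
      ((1 / 2 : ℝ) • ContinuousLinearMap.id ℝ E).contDiff.contMDiff.comp contMDiff_fst
    have h1 : ContMDiffOn (𝓘(ℝ, E).prod (𝓡 d)) (𝓡 d) ∞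
        (fun z : E × M => h ((1 / 2 : ℝ) • z.1) z.2) (Metric.ball 0 (3 / 2 * R) ×ˢ T (T (T N))) :=
      H.smooth.comp (hs.contMDiffOn.prodMk contMDiffOn_snd) fun z hz =>
        ⟨mem_ball_zero_iff.2 ((hhalf (mem_ball_zero_iff.1 hz.1)).trans_lt hr), hN' hz.2⟩
    exact H.smooth.comp (hs.contMDiffOn.prodMk h1) fun z hz =>
      ⟨mem_ball_zero_iff.2 ((hhalf (mem_ball_zero_iff.1 hz.1)).trans_lt hr),
        hTs _ (hTs _ (hmem hz.2 (hhalf (mem_ball_zero_iff.1 hz.1))))⟩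
  · intro p hp a b ha hb hab _
    have ha' := hhalf ha
    have hb' := hhalf hb
    have hab' := hhalf hab
    rw [smul_add] at hab'
    have hab'' := hab'.trans_lt hr
    have hba'' : ‖(1 / 2 : ℝ) • b + (1 / 2 : ℝ) • a‖ < R := by rwa [add_comm]
    simp only [smul_add]
    have hq := hmem hp hb'
    have hq' : h ((1 / 2 : ℝ) • a + (1 / 2 : ℝ) • b) p ∈ T (T N) := hmem hp hab'
    -- Of the four half moves the middle two are interchanged, after which they merge in pairs. Each
    -- merged time is half of `a + b`, hence of norm less than `R`.
    rw [hcomm (hTs _ hq) ha' hb' hab'', add_comm, ← hcomm (hTs _ hq) hb' ha' hba'',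
      hcomm (hTs _ (hTs _ hp)) ha' hb' hab'', hcomm (hTs _ hq') ha' hb' hab'',
      add_comm ((1 / 2 : ℝ) • b)]
  · intro p hp s hs
    have hs' := hhalf hs
    have h2 := hTs _ (hTs _ (hmem hp hs'))
    rw [H.inv _ h2 _ (hs'.trans_lt hr), H.inv p (hN' hp) _ (hs'.trans_lt hr)]
  · intro p hp s hs
    have hs' := hhalf hs
    have h2 := hTs _ (hTs _ (hmem hp hs'))
    exact mem_tangentLeaf_trans (H.mem_leaf p (hN' hp) _ (hs'.trans_lt hr))
      (H.mem_leaf _ h2 _ (hs'.trans_lt hr))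
  · exact fun p hp => H.exists_box p (hN' hp)
  · intro p hp ψ hψ hpψ
    have hopen : IsOpen (T (T (T N))) :=
      hTo (hTo (hTo H.isOpen subset_rfl) (hTs _)) ((hTs _).trans (hTs _))
    filter_upwards [H.box p (hN' hp) ψ hψ hpψ, (Metric.isOpen_ball.prod hopen).mem_nhds
      (show ((0, p) : E × M) ∈ Metric.ball 0 R ×ˢ T (T (T N)) from
        ⟨Metric.mem_ball_self hR, hp⟩)] with z hz hz'
    rw [hagree z.1 (mem_ball_zero_iff.1 hz'.1) z.2 hz'.2, hz]

/-- A local action extends to one map that is a local action for all bounds on the times. -/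
theorem exists_forall (H : IsLocalAction X m J R N h) (hR : 0 < R) :
    ∃ H : EuclideanSpace ℝ (Fin n) → M → M, ∀ R, ∃ N, IsLocalAction X m J R N H := by
  classical
  let E := EuclideanSpace ℝ (Fin n)
  let dbl : (E → M → M) → E → M → M := fun h s p =>
    h ((1 / 2 : ℝ) • s) (h ((1 / 2 : ℝ) • s) p)
  let ρ : ℕ → ℝ := fun k => (3 / 2) ^ k * R
  have hρ : ∀ k, 0 < ρ k := fun k => by positivity
  have hstep : ∀ k, ρ (k + 1) = 3 / 2 * ρ k := fun k => by
    simp only [ρ, pow_succ]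
    ring
  have hseq : ∃ K : ℕ → Set M, ∀ k, IsLocalAction X m J (ρ k) (K k) (dbl^[k] h) ∧ (K (k + 1) ⊆ K k ∧
      ∀ s, ‖s‖ < ρ k → ∀ p ∈ K (k + 1), dbl^[k + 1] h s p = dbl^[k] h s p) := by
    have hext : ∀ k K, IsLocalAction X m J (ρ k) K (dbl^[k] h) → ∃ K' ⊆ K,
        IsLocalAction X m J (ρ (k + 1)) K' (dbl^[k + 1] h) ∧
        ∀ s, ‖s‖ < ρ k → ∀ p ∈ K', dbl^[k + 1] h s p = dbl^[k] h s p := by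
      intro k K hK
      obtain ⟨K', hK', h1, h2⟩ := hK.exists_extend (hρ k)
      rw [hstep, Function.iterate_succ_apply']
      exact ⟨K', hK', h1, h2⟩
    choose! nxt hn1 hn2 hn3 using hext
    let K : ℕ → Set M := fun k => Nat.rec N (fun k K => nxt k K) k
    have hK : ∀ k, IsLocalAction X m J (ρ k) (K k) (dbl^[k] h) := by
      intro k
      induction k with
      | zero =>
        have : ρ 0 = R := by simp [ρ]
        rw [this]
        exact H
      | succ k ih => exact hn2 k _ ih
    exact ⟨K, fun k => ⟨hK k, hn1 k _ (hK k), hn3 k _ (hK k)⟩⟩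
  obtain ⟨K, hK⟩ := hseq
  have hlarge : ∀ r : ℝ, ∃ k, r < ρ k := by
    intro r
    obtain ⟨k, hk⟩ := pow_unbounded_of_one_lt (r / R) (by norm_num : (1 : ℝ) < 3 / 2)
    exact ⟨k, (div_lt_iff₀ hR).1 hk⟩
  -- Each time uses the first doubling defined for it. Later doublings agree with it on the smaller
  -- sets `K k`, so a single map serves all bounds, although the neighbourhood depends on the bound.
  let G : E → M → M := fun s => dbl^[Nat.find (hlarge ‖s‖)] h s
  have hmono : ∀ i j, K (i + j) ⊆ K i := by
    intro i j
    induction j with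
    | zero => exact subset_rfl
    | succ j ih => exact (hK (i + j)).2.1.trans ih
  have hρmono : ∀ i j, ρ i ≤ ρ (i + j) := by
    intro i j
    induction j with
    | zero => exact le_rfl
    | succ j ih =>
      have := hstep (i + j)
      have := hρ (i + j)
      rw [← add_assoc]
      linarith
  have hagree : ∀ i j s, ‖s‖ < ρ i → ∀ p ∈ K (i + j), dbl^[i + j] h s p = dbl^[i] h s p := by
    intro i j s hs
    induction j with
    | zero => exact fun p _ => rfl
    | succ j ih =>
      intro p hp
      rw [← add_assoc, (hK (i + j)).2.2 s (hs.trans_le (hρmono i j)) p hp]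
      exact ih p ((hK (i + j)).2.1 hp)
  have hG : ∀ k s, ‖s‖ < ρ k → ∀ p ∈ K k, G s p = dbl^[k] h s p := by
    intro k s hs p hp
    obtain ⟨j, hj⟩ := Nat.exists_eq_add_of_le (Nat.find_min' (hlarge ‖s‖) hs)
    have := hagree (Nat.find (hlarge ‖s‖)) j s (Nat.find_spec (hlarge ‖s‖)) p (by rwa [← hj])
    rw [← hj] at this
    exact this.symm
  refine ⟨G, fun r => ?_⟩
  obtain ⟨k, hk⟩ := hlarge r
  have h1 := (hK k).1.congr (hρ k) (hG k)
  refine ⟨K k, ⟨h1.isOpen, h1.leaf_subset, ?_, ?_, ?_, ?_, h1.exists_box, h1.box⟩⟩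
  · exact h1.smooth.mono (Set.prod_mono (Metric.ball_subset_ball hk.le) subset_rfl)
  · exact fun p hp a b ha hb hab => h1.add p hp a b (ha.trans hk) (hb.trans hk) (hab.trans hk)
  · exact fun p hp s hs => h1.inv p hp s (hs.trans hk)
  · exact fun p hp s hs => h1.mem_leaf p hp s (hs.trans hk)

/-- A tangent curve is locally contained in an orbit. -/
theorem eventually_exists_eq (H : IsLocalAction X m J R N h) {γ : ℝ → M} (hγ : IsTangentCurve X γ)
    {r₀ : ℝ} (hr : γ r₀ ∈ N) {η : ℝ} (hη : 0 < η) :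
    ∀ᶠ r in 𝓝 r₀, ∃ a, ‖a‖ < η ∧ γ r = h a (γ r₀) := by
  let E := EuclideanSpace ℝ (Fin n)
  obtain ⟨ψ, hψ, hpψ⟩ := H.exists_box _ hr
  have hγc := hγ.smooth.continuous.continuousAt (x := r₀)
  have hψc : ContinuousAt (fun r => (ψ (γ r)).1 - (ψ (γ r₀)).1) r₀ :=
    (continuousAt_fst.comp ((ψ.continuousAt hpψ).comp hγc)).sub continuousAt_const
  have hψt : Filter.Tendsto (fun r => (ψ (γ r)).1 - (ψ (γ r₀)).1) (𝓝 r₀) (𝓝 0) := by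
    have := hψc.tendsto
    rwa [sub_self] at this
  have hbox := (hψt.prodMk_nhds (tendsto_const_nhds (x := γ r₀))).eventually
    (H.box _ hr ψ hψ hpψ)
  filter_upwards [hψ.eventually_snd_eq hγ hpψ, hbox, hψt.eventually (Metric.ball_mem_nhds 0 hη)]
    with r h1 h2 h3
  refine ⟨_, mem_ball_zero_iff.1 h3, ?_⟩
  rw [h2]
  have h4 : ψ (γ r₀) + ((ψ (γ r)).1 - (ψ (γ r₀)).1, 0) = ψ (γ r) :=
    Prod.ext (by simp) (by simp [h1.2])
  rw [h4, ψ.left_inv h1.1]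

end IsLocalAction

end LocalActions

end BSymplectic

namespace BSymplectic

/-! ### Lattices in euclidean space. -/

section Lattices

/-- A discrete and cocompact subgroup of a euclidean space is spanned by a basis of the space. -/
theorem exists_basis_of_discrete_of_cobounded {n : ℕ} (Λ : AddSubgroup (EuclideanSpace ℝ (Fin n)))
    {ε : ℝ} (hε : 0 < ε) (hdisc : ∀ s ∈ Λ, ‖s‖ < ε → s = 0) {R : ℝ}
    (hcob : ∀ s, ∃ a, ‖a‖ < R ∧ s - a ∈ Λ) :
    ∃ b : Module.Basis (Fin n) ℝ (EuclideanSpace ℝ (Fin n)),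
      ∀ s, s ∈ Λ ↔ s ∈ Submodule.span ℤ (Set.range b) := by
  let E := EuclideanSpace ℝ (Fin n)
  let L : Submodule ℤ E := AddSubgroup.toIntSubmodule Λ
  have : DiscreteTopology L := by
    refine (discreteTopology_iff_isOpen_singleton_zero (G := L)).2 ?_
    rw [Metric.isOpen_singleton_iff]
    refine ⟨ε, hε, fun y hy => Subtype.ext (hdisc y.1 y.2 ?_)⟩
    rwa [dist_zero_right] at hy
  have hspan : Submodule.span ℝ (L : Set E) = ⊤ := by
    by_contra hne
    obtain ⟨f, hf, hle⟩ := Submodule.exists_le_ker_of_lt_top _ (lt_top_iff_ne_top.2 hne)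
    let f' : E →L[ℝ] ℝ := LinearMap.toContinuousLinearMap f
    -- A functional that vanishes on `Λ` is determined by its values on a ball, hence bounded, hence
    -- zero. So `Λ` spans.
    have hbd : ∀ s, ‖f' s‖ ≤ ‖f'‖ * R := by
      intro s
      obtain ⟨a, ha, hs⟩ := hcob s
      have h1 : f (s - a) = 0 := hle (Submodule.subset_span hs)
      have h2 : f' s = f' a := by
        rw [map_sub] at h1
        exact sub_eq_zero.1 h1
      rw [h2]
      exact (f'.le_opNorm a).trans (mul_le_mul_of_nonneg_left ha.le (norm_nonneg _))
    apply hf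
    ext s
    by_contra hs
    have hs' : f' s ≠ 0 := hs
    have hpos : 0 < ‖f' s‖ := norm_pos_iff.2 hs'
    obtain ⟨k, hk⟩ := exists_nat_gt (‖f'‖ * R / ‖f' s‖)
    have h3 := hbd ((k : ℝ) • s)
    rw [map_smul, norm_smul, Real.norm_eq_abs, abs_of_nonneg (Nat.cast_nonneg k)] at h3
    rw [div_lt_iff₀ hpos] at hk
    linarith
  have : IsZLattice ℝ L := ⟨hspan⟩
  have : Module.Free ℤ L := ZLattice.module_free ℝ L
  have : Module.Finite ℤ L := ZLattice.module_finite ℝ L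
  let b := (Module.Free.chooseBasis ℤ L).ofZLatticeBasis ℝ L
  have hcard : Fintype.card (Module.Free.ChooseBasisIndex ℤ L) = n := by
    rw [← Module.finrank_eq_card_basis b, finrank_euclideanSpace_fin]
  refine ⟨b.reindex (Fintype.equivFinOfCardEq hcard), fun s => ?_⟩
  rw [Module.Basis.range_reindex, Module.Basis.ofZLatticeBasis_span]
  rfl

end Lattices

/-! ### The action on the compact leaf and its isotropy group. -/

section Periods

variable {n d : ℕ} {M : Type*} [TopologicalSpace M] [ChartedSpace (EuclideanSpace ℝ (Fin d)) M]
  [IsManifold (𝓡 d) ∞ M] {X : Fin n → VectorFields d M} {A : Type*} {J : M → A} {m : M}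
  {H : EuclideanSpace ℝ (Fin n) → M → M}

/-- The map `H` is a local action near the leaf of `m` for all bounds on the times. -/
def IsGermAction (X : Fin n → VectorFields d M) (m : M) (J : M → A)
    (H : EuclideanSpace ℝ (Fin n) → M → M) : Prop :=
  ∀ R, ∃ N, IsLocalAction X m J R N H

namespace IsGermAction

theorem zero_apply (h : IsGermAction X m J H) {x : M} (hx : x ∈ tangentLeaf X m) : H 0 x = x := by
  obtain ⟨N, hN⟩ := h 0
  exact hN.zero (hN.leaf_subset hx)

theorem apply_mem (h : IsGermAction X m J H) {x : M} (hx : x ∈ tangentLeaf X m)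
    (s : EuclideanSpace ℝ (Fin n)) : H s x ∈ tangentLeaf X m := by
  obtain ⟨N, hN⟩ := h (‖s‖ + 1)
  exact hN.mem_leaf_of_mem_leaf hx (by linarith)

theorem add_apply (h : IsGermAction X m J H) {x : M} (hx : x ∈ tangentLeaf X m)
    (a b : EuclideanSpace ℝ (Fin n)) : H (a + b) x = H a (H b x) := by
  obtain ⟨N, hN⟩ := h (‖a‖ + ‖b‖ + 1)
  have h1 := norm_nonneg a
  have h2 := norm_nonneg b
  exact (hN.add x (hN.leaf_subset hx) a b (by linarith) (by linarith)
    (by linarith [norm_add_le a b]) (hN.leaf_subset (h.apply_mem hx b))).symm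

theorem contMDiffAt (h : IsGermAction X m J H) {x : M} (hx : x ∈ tangentLeaf X m)
    (s : EuclideanSpace ℝ (Fin n)) :
    ContMDiffAt (𝓘(ℝ, EuclideanSpace ℝ (Fin n)).prod (𝓡 d)) (𝓡 d) ∞
      (fun z : EuclideanSpace ℝ (Fin n) × M => H z.1 z.2) (s, x) := by
  obtain ⟨N, hN⟩ := h (‖s‖ + 1)
  exact hN.smooth.contMDiffAt ((Metric.isOpen_ball.prod hN.isOpen).mem_nhds
    ⟨mem_ball_zero_iff.2 (by linarith), hN.leaf_subset hx⟩)

/-- Neighbouring points of a tangent curve differ by a small time of the action, so membership in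
the orbit of `m` is locally constant along the curve. -/
theorem exists_eq (h : IsGermAction X m J H) {y : M} (hy : y ∈ tangentLeaf X m) :
    ∃ s, H s m = y := by
  obtain ⟨γ, hγ, h0, h1⟩ := hy
  have hmem : ∀ r, γ r ∈ tangentLeaf X m := fun r => h0 ▸ hγ.mem_tangentLeaf 0 r
  obtain ⟨N, hN⟩ := h 1
  have hm : m ∈ tangentLeaf X m := h0 ▸ hmem 0
  have hloc : IsLocallyConstant fun r => ∃ s, H s m = γ r := by
    refine (IsLocallyConstant.iff_eventually_eq _).2 fun r₀ => ?_
    filter_upwards [hN.eventually_exists_eq hγ (hN.leaf_subset (hmem r₀)) one_pos] with r hr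
    obtain ⟨a, -, ha⟩ := hr
    refine propext ⟨?_, ?_⟩
    · rintro ⟨s, hs⟩
      refine ⟨-a + s, ?_⟩
      rw [h.add_apply hm, hs, ha, ← h.add_apply (hmem r₀), neg_add_cancel, h.zero_apply (hmem r₀)]
    · rintro ⟨s, hs⟩
      exact ⟨a + s, by rw [h.add_apply hm, hs, ha]⟩
  have h2 := hloc.apply_eq_of_preconnectedSpace 0 1
  rw [h0, h1] at h2
  exact h2 ▸ ⟨0, h.zero_apply hm⟩

/-- The isotropy group of a compact leaf is a lattice. -/
theorem exists_basis [T2Space M] (h : IsGermAction X m J H) (hm : m ∈ tangentLeaf X m)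
    (hL : IsCompact (tangentLeaf X m)) :
    ∃ b : Module.Basis (Fin n) ℝ (EuclideanSpace ℝ (Fin n)),
      ∀ s, H s m = m ↔ s ∈ Submodule.span ℤ (Set.range b) := by
  let E := EuclideanSpace ℝ (Fin n)
  let L := tangentLeaf X m
  let m' : L := ⟨m, hm⟩
  have : CompactSpace L := isCompact_iff_compactSpace.1 hL
  let _ : AddAction E L :=
    { vadd := fun s x => ⟨H s x.1, h.apply_mem x.2 s⟩
      zero_vadd := fun x => Subtype.ext (h.zero_apply x.2)
      add_vadd := fun a b x => Subtype.ext (h.add_apply x.2 a b) }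
  have : ContinuousVAdd E L := by
    refine ⟨Continuous.subtype_mk (f := fun z : E × L => H z.1 z.2.1) ?_ _⟩
    refine continuous_iff_continuousAt.2 fun z => ?_
    exact ContinuousAt.comp (f := fun z : E × L => (z.1, z.2.1))
      (g := fun z : E × M => H z.1 z.2) (h.contMDiffAt z.2.2 z.1).continuousAt
      (by fun_prop)
  have htr : ∀ y : L, ∃ s : E, s +ᵥ m' = y := fun y =>
    (h.exists_eq y.2).imp fun s hs => Subtype.ext hs
  have : AddAction.IsPretransitive E L := by
    refine ⟨fun x y => ?_⟩
    obtain ⟨a, ha⟩ := htr x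
    obtain ⟨b, hb⟩ := htr y
    refine ⟨b - a, ?_⟩
    rw [← ha, ← hb, ← add_vadd, sub_add_cancel]
  -- The open mapping theorem for transitive actions of σ-compact groups. Images of balls are then
  -- open, and by compactness one of them is the whole leaf, which makes the isotropy group
  -- cocompact.
  have hopen : IsOpenMap fun s : E => s +ᵥ m' := isOpenMap_vadd_of_sigmaCompact m'
  obtain ⟨k, hk⟩ := isCompact_univ.elim_directed_cover
    (fun k : ℕ => (fun s : E => s +ᵥ m') '' Metric.ball 0 k)
    (fun k => hopen _ Metric.isOpen_ball) (fun y _ => by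
      obtain ⟨s, hs⟩ := htr y
      obtain ⟨k, hk⟩ := exists_nat_gt ‖s‖
      exact Set.mem_iUnion.2 ⟨k, s, mem_ball_zero_iff.2 hk, hs⟩)
    (directed_of_isDirected_le fun i j hij =>
      Set.image_mono (Metric.ball_subset_ball (by exact_mod_cast hij)))
  obtain ⟨N, hN⟩ := h 1
  obtain ⟨ψ, hψ, hmψ⟩ := hN.exists_box m (hN.leaf_subset hm)
  have hbox : ∀ᶠ s : E in 𝓝 0, H s m = ψ.symm (ψ m + (s, 0)) ∧ ψ m + (s, 0) ∈ ψ.target := by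
    have h1 : Filter.Tendsto (fun s : E => (s, m)) (𝓝 0) (𝓝 (0, m)) :=
      (Continuous.prodMk_left m).tendsto 0
    have h2 : Filter.Tendsto (fun s : E => ψ m + ((s, 0) : E × E)) (𝓝 0) (𝓝 (ψ m)) := by
      have : Continuous fun s : E => ψ m + ((s, 0) : E × E) := by fun_prop
      have h3 := this.tendsto 0
      have h4 : ψ m + ((0, 0) : E × E) = ψ m := add_zero _
      rwa [h4] at h3
    exact (h1.eventually (hN.box m (hN.leaf_subset hm) ψ hψ hmψ)).and
      (h2.eventually (ψ.open_target.mem_nhds (ψ.map_source hmψ)))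
  obtain ⟨ε, hε, hball⟩ := Metric.eventually_nhds_iff_ball.1 hbox
  -- Discreteness: in a flow box a small time `s` translates the coordinates of `m` by `(s, 0)`, so
  -- it fixes `m` only for `s = 0`.
  obtain ⟨b, hb⟩ := exists_basis_of_discrete_of_cobounded (AddAction.stabilizer E m') hε (R := k)
    (fun s hs hsε => by
      have h1 := hball s (mem_ball_zero_iff.2 hsε)
      have h2 : H s m = m := congrArg Subtype.val (AddAction.mem_stabilizer_iff.1 hs)
      rw [h2] at h1
      have h3 := congrArg ψ h1.1
      rw [ψ.right_inv h1.2] at h3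
      have h4 := congrArg Prod.fst h3
      simpa using h4)
    (fun s => by
      obtain ⟨a, ha, hs⟩ := hk (Set.mem_univ (s +ᵥ m'))
      refine ⟨a, mem_ball_zero_iff.1 ha, AddAction.mem_stabilizer_iff.2 ?_⟩
      have hs' : a +ᵥ m' = s +ᵥ m' := hs
      rw [sub_eq_neg_add, add_vadd, ← hs', ← add_vadd, neg_add_cancel, zero_vadd])
  refine ⟨b, fun s => ?_⟩
  rw [← hb, AddAction.mem_stabilizer_iff]
  exact ⟨fun hs => Subtype.ext hs, congrArg Subtype.val⟩

end IsGermAction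

end Periods

end BSymplectic

/-! ### Cubes of angles, tubes and transverse slices. -/

namespace BSymplectic

/-- The closed cube of half side length `r`. -/
def cube (n : ℕ) (r : ℝ) : Set (EuclideanSpace ℝ (Fin n)) :=
  {θ | ∀ i, |θ i| ≤ r}

theorem cube_mono (n : ℕ) {r r' : ℝ} (h : r ≤ r') : cube n r ⊆ cube n r' :=
  fun _ hθ i => (hθ i).trans h

theorem sub_mem_cube {n : ℕ} {r r' : ℝ} {θ θ' : EuclideanSpace ℝ (Fin n)} (h : θ ∈ cube n r)
    (h' : θ' ∈ cube n r') : θ - θ' ∈ cube n (r + r') :=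
  fun i => (abs_sub (θ i) (θ' i)).trans (add_le_add (h i) (h' i))

theorem isClosed_cube (n : ℕ) (r : ℝ) : IsClosed (cube n r) := by
  have : cube n r = ⋂ i, {θ | |θ i| ≤ r} := by
    ext θ
    simp [cube]
  rw [this]
  exact isClosed_iInter fun i => isClosed_le (by fun_prop) continuous_const

theorem exists_norm_lt_of_mem_cube (n : ℕ) (r : ℝ) : ∃ C > 0, ∀ θ ∈ cube n r, ‖θ‖ < C := by
  refine ⟨Real.sqrt (∑ _i : Fin n, r ^ 2) + 1, by positivity, fun θ hθ => ?_⟩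
  rw [EuclideanSpace.norm_eq]
  have : ∑ i, ‖θ i‖ ^ 2 ≤ ∑ _i : Fin n, r ^ 2 := Finset.sum_le_sum fun i _ =>
    pow_le_pow_left₀ (norm_nonneg _) (hθ i) 2
  linarith [Real.sqrt_le_sqrt this]

theorem isCompact_cube (n : ℕ) (r : ℝ) : IsCompact (cube n r) := by
  obtain ⟨C, -, hC⟩ := exists_norm_lt_of_mem_cube n r
  exact (isCompact_closedBall 0 C).of_isClosed_subset (isClosed_cube n r)
    fun θ hθ => mem_closedBall_zero_iff.2 (hC θ hθ).le

section Tubes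

variable {n d : ℕ} {M : Type*} [TopologicalSpace M] [ChartedSpace (EuclideanSpace ℝ (Fin d)) M]
  [IsManifold (𝓡 d) ∞ M] {X : Fin n → VectorFields d M} {A : Type*} {J : M → A}
  {m : M} {R : ℝ} {N : Set M} {H : EuclideanSpace ℝ (Fin n) → M → M}

/-- A parametrization of a neighbourhood of a leaf by angles `θ`, with period one in each
coordinate, and transverse parameters in the ball of radius `δ`. -/
structure IsTube (X : Fin n → VectorFields d M)
    (P : EuclideanSpace ℝ (Fin n) × EuclideanSpace ℝ (Fin n) → M) (δ : ℝ) : Prop where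
  smooth : ∀ θ ∈ cube n 1, ∀ β ∈ Metric.ball 0 δ,
    ContMDiffAt 𝓘(ℝ, EuclideanSpace ℝ (Fin n) × EuclideanSpace ℝ (Fin n)) (𝓡 d) ∞ P (θ, β)
  eq_iff : ∀ θ ∈ cube n 1, ∀ θ' ∈ cube n 1, ∀ β ∈ Metric.ball 0 δ, ∀ β' ∈ Metric.ball 0 δ,
    P (θ, β) = P (θ', β') ↔ (∃ k : Fin n → ℤ, ∀ i, θ i - θ' i = k i) ∧ β = β'
  exists_inverse : ∀ θ ∈ cube n 1, ∀ β ∈ Metric.ball 0 δ,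
    ∃ Φ : M → EuclideanSpace ℝ (Fin n) × EuclideanSpace ℝ (Fin n),
      ContMDiffAt (𝓡 d) 𝓘(ℝ, EuclideanSpace ℝ (Fin n) × EuclideanSpace ℝ (Fin n)) ∞ Φ (P (θ, β)) ∧
      Φ (P (θ, β)) = (θ, β) ∧ ∀ᶠ p in 𝓝 (P (θ, β)), P (Φ p) = p
  mem_leaf : ∀ θ ∈ cube n 1, ∀ β ∈ Metric.ball 0 δ, P (θ, β) ∈ tangentLeaf X (P (0, β))
  curve : ∀ θ ∈ cube n (1 / 2), ∀ β ∈ Metric.ball 0 δ, ∀ γ : ℝ → M, IsTangentCurve X γ →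
    ∀ r₀, γ r₀ = P (θ, β) → ∀ᶠ r in 𝓝 r₀, ∃ θ' ∈ cube n 1, γ r = P (θ', β)

/-- Triviality of the holonomy. For points in `D` the invariance of `J` determines the slice; both
sides are continuous in `p`, so density of `D` gives all points. In the application `D` is the
complement of `Z` and the point of interest lies on `Z`. -/
theorem IsLocalAction.snd_eq (h : IsLocalAction X m J R N H)
    {ψ : OpenPartialHomeomorph M (EuclideanSpace ℝ (Fin n) × EuclideanSpace ℝ (Fin n))}
    {D : Set M} (hD : Dense D) (hJ : ∀ q ∈ ψ.source, ∀ q' ∈ ψ.source, q ∈ D → J q = J q' →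
      (ψ q).2 = (ψ q').2)
    {s : EuclideanSpace ℝ (Fin n)} (hs : ‖s‖ < R) {p : M} (hp : p ∈ N) (hpψ : p ∈ ψ.source)
    (hsp : H s p ∈ ψ.source) : (ψ (H s p)).2 = (ψ p).2 := by
  have hcont : ∀ {q}, q ∈ N → ContinuousAt (fun q => H s q) q := by
    intro q hq
    have h1 : ContinuousAt (fun z : EuclideanSpace ℝ (Fin n) × M => H z.1 z.2) (s, q) :=
      h.smooth.continuousOn.continuousAt ((Metric.isOpen_ball.prod h.isOpen).mem_nhds
        ⟨mem_ball_zero_iff.2 hs, hq⟩)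
    exact h1.comp (f := fun q => (s, q)) (by fun_prop)
  have h1 : ContinuousAt (fun q => (ψ (H s q)).2 - (ψ q).2) p :=
    (continuousAt_snd.comp (ContinuousAt.comp (g := ψ) (ψ.continuousAt hsp) (hcont hp))).sub
      (continuousAt_snd.comp (ψ.continuousAt hpψ))
  have hev : ∀ᶠ q in 𝓝 p, q ∈ N ∧ q ∈ ψ.source ∧ H s q ∈ ψ.source :=
    (h.isOpen.eventually_mem hp).and ((ψ.open_source.eventually_mem hpψ).and
      ((hcont hp).eventually (ψ.open_source.mem_nhds hsp)))
  obtain ⟨O, hO, hOo, hpO⟩ := eventually_nhds_iff.1 hev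
  have h2 := (h1.continuousWithinAt (s := O ∩ D)).mem_closure (t := {0})
    (hD.open_subset_closure_inter hOo hpO) (fun q hq => by
      obtain ⟨h3, h4, h5⟩ := hO q hq.1
      exact sub_eq_zero.2 (hJ q h4 _ h5 hq.2 (h.inv q h3 s hs).symm).symm)
  rw [closure_singleton] at h2
  exact sub_eq_zero.1 h2

/-- Periods of a nearby leaf that depend smoothly on the leaf. -/
structure IsPeriodMap (H : EuclideanSpace ℝ (Fin n) → M → M)
    (σ : EuclideanSpace ℝ (Fin n) → M)
    (Λ : EuclideanSpace ℝ (Fin n) → EuclideanSpace ℝ (Fin n) →L[ℝ] EuclideanSpace ℝ (Fin n)) :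
    Prop where
  smooth : ∀ᶠ β in 𝓝 0, ContDiffAt ℝ ∞ Λ β
  isInvertible : (Λ 0).IsInvertible
  eq_iff : ∀ v, H (Λ 0 v) (σ 0) = σ 0 ↔ ∃ k : Fin n → ℤ, ∀ i, v i = k i
  period : ∀ k : Fin n → ℤ, ∀ᶠ β in 𝓝 0, H (Λ β (WithLp.toLp 2 fun i => (k i : ℝ))) (σ β) = σ β

/-- The slice of a flow box through the point `m`. -/
noncomputable def slice
    (ψ : OpenPartialHomeomorph M (EuclideanSpace ℝ (Fin n) × EuclideanSpace ℝ (Fin n))) (m : M)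
    (β : EuclideanSpace ℝ (Fin n)) : M :=
  ψ.symm (ψ m + (0, β))

section Slice

variable {ψ : OpenPartialHomeomorph M (EuclideanSpace ℝ (Fin n) × EuclideanSpace ℝ (Fin n))}

theorem slice_zero (hm : m ∈ ψ.source) : slice ψ m 0 = m := by
  have h0 : ψ m + ((0, 0) : EuclideanSpace ℝ (Fin n) × EuclideanSpace ℝ (Fin n)) = ψ m := add_zero _
  rw [slice, h0, ψ.left_inv hm]

theorem eventually_mem_target (hm : m ∈ ψ.source) :
    ∀ᶠ β : EuclideanSpace ℝ (Fin n) in 𝓝 0, ψ m + (0, β) ∈ ψ.target := by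
  have hc : Continuous fun β : EuclideanSpace ℝ (Fin n) =>
    ψ m + ((0, β) : EuclideanSpace ℝ (Fin n) × EuclideanSpace ℝ (Fin n)) := by fun_prop
  refine hc.continuousAt.eventually (ψ.open_target.mem_nhds ?_)
  have h0 : ψ m + ((0, 0) : EuclideanSpace ℝ (Fin n) × EuclideanSpace ℝ (Fin n)) = ψ m := add_zero _
  beta_reduce
  rw [h0]
  exact ψ.map_source hm

theorem IsFlowBox.contMDiffAt_slice (hψ : IsFlowBox X ψ) {β : EuclideanSpace ℝ (Fin n)}
    (hβ : ψ m + (0, β) ∈ ψ.target) :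
    ContMDiffAt 𝓘(ℝ, EuclideanSpace ℝ (Fin n)) (𝓡 d) ∞ (slice ψ m) β := by
  have h1 : ContDiff ℝ ∞ fun β : EuclideanSpace ℝ (Fin n) =>
    ψ m + ((0, β) : EuclideanSpace ℝ (Fin n) × EuclideanSpace ℝ (Fin n)) := by fun_prop
  exact ((hψ.smooth_symm _ hβ).contMDiffAt (ψ.open_target.mem_nhds hβ)).comp β
    h1.contMDiff.contMDiffAt

theorem IsFlowBox.tendsto_slice (hψ : IsFlowBox X ψ) (hm : m ∈ ψ.source) :
    Filter.Tendsto (slice ψ m) (𝓝 0) (𝓝 m) := by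
  have := (hψ.contMDiffAt_slice (eventually_mem_target hm).self_of_nhds).continuousAt.tendsto
  rwa [slice_zero hm] at this

end Slice

end Tubes

end BSymplectic

namespace BSymplectic

/-! ### Periods of the nearby leaves. -/

section PeriodMaps

variable {n d : ℕ} {M : Type*} [TopologicalSpace M] [ChartedSpace (EuclideanSpace ℝ (Fin d)) M]
  [IsManifold (𝓡 d) ∞ M] {X : Fin n → VectorFields d M} {A : Type*} {J : M → A}
  {m : M} {H : EuclideanSpace ℝ (Fin n) → M → M}
  {ψ : OpenPartialHomeomorph M (EuclideanSpace ℝ (Fin n) × EuclideanSpace ℝ (Fin n))}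

namespace IsGermAction

variable {ι : Type*} {l : Filter ι} {a b : ι → EuclideanSpace ℝ (Fin n)} {q : ι → M}
  {a₀ b₀ : EuclideanSpace ℝ (Fin n)} {x : M}

theorem tendsto (h : IsGermAction X m J H) (hx : x ∈ tangentLeaf X m)
    (hb : Filter.Tendsto b l (𝓝 b₀)) (hq : Filter.Tendsto q l (𝓝 x)) :
    Filter.Tendsto (fun i => H (b i) (q i)) l (𝓝 (H b₀ x)) :=
  ((h.contMDiffAt hx b₀).continuousAt.tendsto).comp (hb.prodMk_nhds hq)

/-- Away from the leaf of `m` the group law holds only on a neighbourhood that depends on a bound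
for the times. Convergent times are eventually bounded by `‖a₀‖ + ‖b₀‖ + 1`. -/
theorem eventually_add (h : IsGermAction X m J H) (hx : x ∈ tangentLeaf X m)
    (ha : Filter.Tendsto a l (𝓝 a₀)) (hb : Filter.Tendsto b l (𝓝 b₀))
    (hq : Filter.Tendsto q l (𝓝 x)) :
    ∀ᶠ i in l, H (a i) (H (b i) (q i)) = H (a i + b i) (q i) := by
  obtain ⟨N, hN⟩ := h (‖a₀‖ + ‖b₀‖ + 1)
  have h1 := norm_nonneg a₀
  have h2 := norm_nonneg b₀
  filter_upwards [hq.eventually (hN.isOpen.mem_nhds (hN.leaf_subset hx)),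
    (h.tendsto hx hb hq).eventually (hN.isOpen.mem_nhds (hN.leaf_subset (h.apply_mem hx b₀))),
    ha.norm.eventually_lt_const (show ‖a₀‖ < ‖a₀‖ + ‖b₀‖ + 1 by linarith),
    hb.norm.eventually_lt_const (show ‖b₀‖ < ‖a₀‖ + ‖b₀‖ + 1 by linarith),
    (ha.add hb).norm.eventually_lt_const
      (show ‖a₀ + b₀‖ < ‖a₀‖ + ‖b₀‖ + 1 by linarith [norm_add_le a₀ b₀])] with i h3 h4 h5 h6 h7
  exact hN.add _ h3 _ _ h5 h6 h7 h4

theorem eventually_zero (h : IsGermAction X m J H) (hx : x ∈ tangentLeaf X m)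
    (hq : Filter.Tendsto q l (𝓝 x)) : ∀ᶠ i in l, H 0 (q i) = q i := by
  obtain ⟨N, hN⟩ := h 0
  filter_upwards [hq.eventually (hN.isOpen.mem_nhds (hN.leaf_subset hx))] with i hi
  exact hN.zero hi

theorem eventually_box (h : IsGermAction X m J H) (hx : x ∈ tangentLeaf X m) (hψ : IsFlowBox X ψ)
    (hxψ : x ∈ ψ.source) (ha : Filter.Tendsto a l (𝓝 0)) (hq : Filter.Tendsto q l (𝓝 x)) :
    ∀ᶠ i in l, H (a i) (q i) = ψ.symm (ψ (q i) + (a i, 0)) := by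
  obtain ⟨N, hN⟩ := h 0
  exact (ha.prodMk_nhds hq).eventually (hN.box x (hN.leaf_subset hx) ψ hψ hxψ)

theorem eventually_snd_eq (h : IsGermAction X m J H) (hm : m ∈ tangentLeaf X m) {D : Set M}
    (hD : Dense D) (hJ : ∀ q ∈ ψ.source, ∀ q' ∈ ψ.source, q ∈ D → J q = J q' → (ψ q).2 = (ψ q').2)
    (hmψ : m ∈ ψ.source) (hb : Filter.Tendsto b l (𝓝 b₀)) (hq : Filter.Tendsto q l (𝓝 m)) :
    ∀ᶠ i in l, H (b i) (q i) ∈ ψ.source → (ψ (H (b i) (q i))).2 = (ψ (q i)).2 := by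
  obtain ⟨N, hN⟩ := h (‖b₀‖ + 1)
  filter_upwards [hq.eventually (hN.isOpen.mem_nhds (hN.leaf_subset hm)),
    hq.eventually (ψ.open_source.mem_nhds hmψ),
    hb.norm.eventually_lt_const (show ‖b₀‖ < ‖b₀‖ + 1 by linarith)] with i h1 h2 h3 h4
  exact hN.snd_eq hD hJ h3 h1 h2 h4

end IsGermAction

/-- The integer vectors whose images are periods for all small `β` form a subgroup of `ℤⁿ`, which
contains the unit vectors. The size of `β` depends on the vector. -/
theorem IsPeriodMap.of_single {σ : EuclideanSpace ℝ (Fin n) → M}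
    {Λ : EuclideanSpace ℝ (Fin n) → EuclideanSpace ℝ (Fin n) →L[ℝ] EuclideanSpace ℝ (Fin n)}
    (h : IsGermAction X m J H) (hm : m ∈ tangentLeaf X m) (hσ : Filter.Tendsto σ (𝓝 0) (𝓝 m))
    (hΛ : ContinuousAt Λ 0)
    (hs : ∀ i, ∀ᶠ β in 𝓝 0, H (Λ β (EuclideanSpace.single i 1)) (σ β) = σ β) (k : Fin n → ℤ) :
    ∀ᶠ β in 𝓝 0, H (Λ β (WithLp.toLp 2 fun i => (k i : ℝ))) (σ β) = σ β := by
  have hΛv : ∀ v, Filter.Tendsto (fun β => Λ β v) (𝓝 0) (𝓝 (Λ 0 v)) := fun v =>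
    (hΛ.clm_apply continuousAt_const).tendsto
  let ι : (Fin n → ℤ) →+ EuclideanSpace ℝ (Fin n) :=
    { toFun := fun k => WithLp.toLp 2 fun i => (k i : ℝ)
      map_zero' := by ext; simp
      map_add' := fun a b => by ext; simp }
  let G : AddSubgroup (Fin n → ℤ) :=
    { carrier := {k | ∀ᶠ β in 𝓝 0, H (Λ β (ι k)) (σ β) = σ β}
      zero_mem' := by
        filter_upwards [h.eventually_zero hm hσ] with β hβ
        rw [map_zero, map_zero, hβ]
      add_mem' := fun {a b} ha hb => by
        filter_upwards [ha, hb, h.eventually_add hm (hΛv (ι a)) (hΛv (ι b)) hσ] with β h1 h2 h3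
        rw [map_add, map_add, ← h3, h2, h1]
      neg_mem' := fun {a} ha => by
        filter_upwards [ha, h.eventually_zero hm hσ,
          h.eventually_add hm (hΛv (ι a)).neg (hΛv (ι a)) hσ] with β h1 h2 h3
        rw [map_neg, map_neg]
        rwa [h1, neg_add_cancel, h2] at h3 }
  have hk : k = ∑ i, k i • (Pi.single i 1 : Fin n → ℤ) := by
    ext j
    simp [Finset.sum_apply, Pi.single_apply]
  have : k ∈ G := by
    rw [hk]
    refine G.sum_mem fun i _ => G.zsmul_mem ?_ _
    filter_upwards [hs i] with β hβ
    have : ι (Pi.single i 1) = EuclideanSpace.single i 1 := by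
      ext j
      by_cases hj : j = i
      · subst hj
        simp [ι]
      · simp [ι, hj]
    rwa [this]
  exact this

/-- The lattice of periods of a compact leaf extends to the nearby leaves. -/
theorem exists_isPeriodMap [T2Space M] (h : IsGermAction X m J H) (hm : m ∈ tangentLeaf X m)
    (hL : IsCompact (tangentLeaf X m)) (hψ : IsFlowBox X ψ) (hmψ : m ∈ ψ.source) {D : Set M}
    (hD : Dense D)
    (hJ : ∀ q ∈ ψ.source, ∀ q' ∈ ψ.source, q ∈ D → J q = J q' → (ψ q).2 = (ψ q').2) :
    ∃ Λ, IsPeriodMap H (slice ψ m) Λ := by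
  let E := EuclideanSpace ℝ (Fin n)
  obtain ⟨b, hb⟩ := h.exists_basis hm hL
  have hσ := hψ.tendsto_slice hmψ
  have hbm : ∀ i, H (b i) m = m := fun i => (hb _).2 (Submodule.subset_span ⟨i, rfl⟩)
  have hbt : ∀ i, Filter.Tendsto (fun β => H (b i) (slice ψ m β)) (𝓝 0) (𝓝 m) := by
    intro i
    have := h.tendsto hm (tendsto_const_nhds (x := b i)) hσ
    rwa [hbm] at this
  -- The displacement along the leaf after time `b i`, which vanishes on the leaf of `m`.
  -- Subtracting it from `b i` corrects the period for the leaf with parameter `β`.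
  let a : Fin n → E → E := fun i β => (ψ (H (b i) (slice ψ m β))).1 - (ψ m).1
  have ha0 : ∀ i, a i 0 = 0 := by
    intro i
    simp only [a, slice_zero hmψ, hbm, sub_self]
  have has : ∀ i, ∀ᶠ β in 𝓝 0, ContDiffAt ℝ ∞ (a i) β := by
    intro i
    obtain ⟨N, hN⟩ := h (‖b i‖ + 1)
    filter_upwards [eventually_mem_target hmψ, hσ.eventually (hN.isOpen.mem_nhds
      (hN.leaf_subset hm)), (hbt i).eventually (ψ.open_source.mem_nhds hmψ)] with β h1 h2 h3
    have h4 : ContMDiffAt 𝓘(ℝ, E) (𝓡 d) ∞ (fun β => H (b i) (slice ψ m β)) β :=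
      ContMDiffAt.comp (g := fun z : E × M => H z.1 z.2) (f := fun β => (b i, slice ψ m β)) β
        (hN.smooth.contMDiffAt ((Metric.isOpen_ball.prod hN.isOpen).mem_nhds
          ⟨mem_ball_zero_iff.2 (by linarith), h2⟩))
        (contMDiffAt_const.prodMk (hψ.contMDiffAt_slice h1))
    have h5 := ((hψ.smooth _ h3).contMDiffAt (ψ.open_source.mem_nhds h3)).comp β h4
    exact (contDiffAt_fst.comp β h5.contDiffAt).sub contDiffAt_const
  have hat : ∀ i, Filter.Tendsto (a i) (𝓝 0) (𝓝 0) := by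
    intro i
    have := (has i).self_of_nhds.continuousAt.tendsto
    rwa [ha0] at this
  let Λ : E → E →L[ℝ] E := fun β => ∑ i, (EuclideanSpace.proj i : E →L[ℝ] ℝ).smulRight
    (b i - a i β)
  have hΛ : ∀ β θ, Λ β θ = ∑ i, θ i • (b i - a i β) := by
    intro β θ
    simp only [Λ, FunLike.coe_sum, Finset.sum_apply]
    rfl
  have hΛs : ∀ᶠ β in 𝓝 0, ContDiffAt ℝ ∞ Λ β := by
    filter_upwards [Filter.eventually_all.2 has] with β hβ
    exact ContDiffAt.sum fun i _ => contDiffAt_const.smulRight (contDiffAt_const.sub (hβ i))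
  have hΛ0 : ∀ θ, Λ 0 θ = ∑ i, θ i • b i := by
    intro θ
    simp only [hΛ, ha0, sub_zero]
  refine ⟨Λ, hΛs, ?_, ?_, ?_⟩
  · refine ⟨(EuclideanSpace.equiv (Fin n) ℝ).trans b.equivFun.symm.toContinuousLinearEquiv, ?_⟩
    ext1 θ
    rw [hΛ0]
    exact b.equivFun_symm_apply _
  · intro v
    rw [slice_zero hmψ, hb, b.mem_span_iff_repr_mem ℤ]
    have hr : ∀ i, b.repr (Λ 0 v) i = v i := by
      intro i
      rw [hΛ0]
      exact congrFun (b.repr_sum_self fun i => v i) i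
    simp only [hr, Set.mem_range]
    constructor
    · intro hv
      choose k hk using hv
      exact ⟨k, fun i => (hk i).symm⟩
    · rintro ⟨k, hk⟩ i
      exact ⟨k i, (hk i).symm⟩
  -- After time `b i` the point is again in the box and, by absence of holonomy, on the slice where
  -- it started. The further time `-a i β` therefore returns it exactly to its starting point.
  · refine IsPeriodMap.of_single h hm hσ hΛs.self_of_nhds.continuousAt fun i => ?_
    filter_upwards [h.eventually_add hm (a := fun β => -a i β) (hat i).neg
      (tendsto_const_nhds (x := b i)) hσ,
      h.eventually_box hm hψ hmψ (a := fun β => -a i β) (by simpa using (hat i).neg) (hbt i),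
      h.eventually_snd_eq hm hD hJ hmψ (tendsto_const_nhds (x := b i)) hσ,
      (hbt i).eventually (ψ.open_source.mem_nhds hmψ), eventually_mem_target hmψ]
      with β h1 h2 h3 h4 h5
    have h6 : Λ β (EuclideanSpace.single i 1) = -a i β + b i := by
      rw [hΛ, Finset.sum_eq_single i]
      · simp only [PiLp.single_apply, if_true, one_smul]
        abel
      · intro j _ hj
        simp [hj]
      · simp
    rw [h6, ← h1, h2]
    have h7 := h3 h4
    have h8 : ψ (slice ψ m β) = ψ m + (0, β) := ψ.right_inv h5
    rw [h8] at h7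
    have h9 : ψ (H (b i) (slice ψ m β)) + (-a i β, 0) = ψ m + (0, β) :=
      Prod.ext (by simp [a]) (by simp [h7])
    rw [h9]
    rfl

end PeriodMaps

end BSymplectic

namespace BSymplectic

theorem IsPeriodMap.eventually_isInvertible {n : ℕ} {M : Type*}
    {H : EuclideanSpace ℝ (Fin n) → M → M} {σ : EuclideanSpace ℝ (Fin n) → M}
    {Λ : EuclideanSpace ℝ (Fin n) → EuclideanSpace ℝ (Fin n) →L[ℝ] EuclideanSpace ℝ (Fin n)}
    (hΛ : IsPeriodMap H σ Λ) :
    ∀ᶠ β in 𝓝 0, (Λ β).IsInvertible := by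
  obtain ⟨e, he⟩ := hΛ.isInvertible
  have h1 := hΛ.smooth.self_of_nhds.continuousAt.tendsto
  rw [← he] at h1
  exact h1.eventually (ContinuousLinearEquiv.nhds e)

/-! ### Angles and transverse parameters near a compact leaf. -/

section Tubes

variable {n d : ℕ} {M : Type*} [TopologicalSpace M] [ChartedSpace (EuclideanSpace ℝ (Fin d)) M]
  [IsManifold (𝓡 d) ∞ M] {X : Fin n → VectorFields d M} {A : Type*} {J : M → A}
  {m : M} {H : EuclideanSpace ℝ (Fin n) → M → M}
  {ψ : OpenPartialHomeomorph M (EuclideanSpace ℝ (Fin n) × EuclideanSpace ℝ (Fin n))}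
  {Λ : EuclideanSpace ℝ (Fin n) → EuclideanSpace ℝ (Fin n) →L[ℝ] EuclideanSpace ℝ (Fin n)}

namespace IsPeriodMap

/-- The nearby leaves acquire no additional periods. By compactness of the cube it suffices to look
near a fixed `v₀`. If `v₀` is not a period of the leaf of `m`, it moves `m`, and this persists. If
it is, `v₀` is an integer vector; then `Λ β (v - v₀)` is a small period, hence zero in the flow box,
and `v = v₀`. -/
theorem eventually_of_apply_eq [T2Space M] (h : IsGermAction X m J H) (hm : m ∈ tangentLeaf X m)
    (hψ : IsFlowBox X ψ) (hmψ : m ∈ ψ.source) (hΛ : IsPeriodMap H (slice ψ m) Λ) (r : ℝ) :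
    ∀ᶠ β in 𝓝 0, ∀ v ∈ cube n r, H (Λ β v) (slice ψ m β) = slice ψ m β →
      ∃ k : Fin n → ℤ, ∀ i, v i = k i := by
  let E := EuclideanSpace ℝ (Fin n)
  refine (isCompact_cube n r).eventually_forall_of_forall_eventually fun v₀ _ => ?_
  have hσ : Filter.Tendsto (fun z : E × E => slice ψ m z.1) (𝓝 (0, v₀)) (𝓝 m) :=
    (hψ.tendsto_slice hmψ).comp (continuous_fst.tendsto (0, v₀))
  have hΛc : ContinuousAt (fun z : E × E => Λ z.1) (0, v₀) :=
    ContinuousAt.comp (g := Λ) (f := fun z : E × E => z.1)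
      hΛ.smooth.self_of_nhds.continuousAt continuousAt_fst
  have hΛv : Filter.Tendsto (fun z : E × E => Λ z.1 z.2) (𝓝 (0, v₀)) (𝓝 (Λ 0 v₀)) :=
    (hΛc.clm_apply continuousAt_snd).tendsto
  have hΛv₀ : Filter.Tendsto (fun z : E × E => Λ z.1 v₀) (𝓝 (0, v₀)) (𝓝 (Λ 0 v₀)) :=
    (hΛc.clm_apply continuousAt_const).tendsto
  by_cases hv : H (Λ 0 v₀) m = m
  · obtain ⟨k, hk⟩ := (hΛ.eq_iff v₀).1 (by rwa [slice_zero hmψ])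
    have hkv : v₀ = WithLp.toLp 2 fun i => (k i : ℝ) := by
      ext i
      exact hk i
    have hsub : Filter.Tendsto (fun z : E × E => Λ z.1 (z.2 - v₀)) (𝓝 (0, v₀)) (𝓝 0) := by
      simpa [map_sub] using hΛv.sub hΛv₀
    have htgt : Filter.Tendsto (fun z : E × E => ψ (slice ψ m z.1) + (Λ z.1 (z.2 - v₀), 0))
        (𝓝 (0, v₀)) (𝓝 (ψ m)) := by
      have h1 : Filter.Tendsto (fun z : E × E => ψ (slice ψ m z.1)) (𝓝 (0, v₀)) (𝓝 (ψ m)) :=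
        (ψ.continuousAt hmψ).tendsto.comp hσ
      have h2 := h1.add (hsub.prodMk_nhds (tendsto_const_nhds (x := (0 : E))))
      have h3 : ψ m + ((0, 0) : E × E) = ψ m := add_zero _
      rwa [h3] at h2
    filter_upwards [h.eventually_add hm hsub hΛv₀ hσ, h.eventually_box hm hψ hmψ hsub hσ,
      (continuous_fst.tendsto ((0, v₀) : E × E)).eventually (hΛ.period k),
      (continuous_fst.tendsto ((0, v₀) : E × E)).eventually hΛ.eventually_isInvertible,
      hσ.eventually (ψ.open_source.mem_nhds hmψ),
      htgt.eventually (ψ.open_target.mem_nhds (ψ.map_source hmψ))] with z h1 h2 h3 h4 h5 h6 h7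
    rw [← hkv] at h3
    rw [h3, h2, ← map_add, sub_add_cancel, h7] at h1
    have h8 := congrArg ψ h1
    rw [ψ.right_inv h6] at h8
    have h9 : Λ z.1 (z.2 - v₀) = 0 := by simpa using congrArg Prod.fst h8
    have h10 : z.2 - v₀ = 0 := h4.injective (h9.trans (map_zero _).symm)
    exact ⟨k, fun i => by rw [sub_eq_zero.1 h10, hk]⟩
  · filter_upwards [((h.tendsto hm hΛv hσ).prodMk_nhds hσ).eventually
      ((isOpen_ne_fun continuous_fst continuous_snd).mem_nhds hv)] with z hz hz'
    exact absurd hz' hz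

end IsPeriodMap

/-- A neighbourhood of a compact leaf is parametrized by angles and transverse parameters. -/
theorem exists_isTube [T2Space M] (h : IsGermAction X m J H) (hm : m ∈ tangentLeaf X m)
    (hψ : IsFlowBox X ψ) (hmψ : m ∈ ψ.source) {D : Set M} (hD : Dense D)
    (hJ : ∀ q ∈ ψ.source, ∀ q' ∈ ψ.source, q ∈ D → J q = J q' → (ψ q).2 = (ψ q').2)
    (hΛ : IsPeriodMap H (slice ψ m) Λ) :
    ∃ δ > 0, IsTube X (fun z => H (Λ z.2 z.1) (slice ψ m z.2)) δ ∧
      H (Λ 0 0) (slice ψ m 0) = m := by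
  let E := EuclideanSpace ℝ (Fin n)
  -- Half side `2` accommodates differences of two angle vectors from `cube n 1`. `R` bounds the
  -- times `Λ β θ` for such vectors, and `3 * R` leaves room for sums and differences of two of
  -- these times.
  obtain ⟨C, hC, hcube⟩ := exists_norm_lt_of_mem_cube n 2
  set R := (‖Λ 0‖ + 1) * C with hR
  have hRpos : 0 < R := by positivity
  obtain ⟨N, hN⟩ := h (3 * R)
  have hσ := hψ.tendsto_slice hmψ
  -- The range of `β` in `IsPeriodMap.period` depends on `k`; only finitely many integer vectors lie
  -- in the cube, so one `δ` serves them all.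
  have hfin : {k : Fin n → ℤ | ∀ i, |k i| ≤ 2}.Finite := by
    refine (Set.finite_Icc (fun _ : Fin n => (-2 : ℤ)) fun _ => 2).subset fun k hk => ?_
    exact ⟨fun i => (abs_le.1 (hk i)).1, fun i => (abs_le.1 (hk i)).2⟩
  have hshr := hN.isOpen_shrink (show R < 3 * R by linarith) hN.isOpen subset_rfl
  have hev := (eventually_mem_target hmψ).and <|
    (hσ.eventually (hshr.mem_nhds (x := m) ⟨hN.leaf_subset hm, fun s _ =>
      hN.leaf_subset (h.apply_mem hm s)⟩)).and <| hΛ.smooth.and <|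
    (hΛ.smooth.self_of_nhds.continuousAt.norm.eventually_lt_const
      (show ‖Λ 0‖ < ‖Λ 0‖ + 1 by linarith)).and <| hΛ.eventually_isInvertible.and <|
    ((Filter.eventually_all_finite hfin).2 fun k _ => hΛ.period k).and <|
      hΛ.eventually_of_apply_eq h hm hψ hmψ 2
  obtain ⟨δ, hδ, hball⟩ := Metric.eventually_nhds_iff_ball.1 hev
  set σ := slice ψ m with hσdef
  have hc1 : ∀ {θ}, θ ∈ cube n 1 → θ ∈ cube n 2 := fun hθ => cube_mono n (by norm_num) hθ
  have htgt : ∀ {β}, β ∈ Metric.ball (0 : E) δ → ψ m + (0, β) ∈ ψ.target := fun hβ => (hball _ hβ).1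
  have hψσ : ∀ {β}, β ∈ Metric.ball (0 : E) δ → ψ (σ β) = ψ m + (0, β) := fun hβ =>
    ψ.right_inv (htgt hβ)
  have hσψ : ∀ {β}, β ∈ Metric.ball (0 : E) δ → σ β ∈ ψ.source := fun hβ => ψ.map_target (htgt hβ)
  have hσN : ∀ {β}, β ∈ Metric.ball (0 : E) δ → σ β ∈ N := fun hβ => (hball _ hβ).2.1.1
  have hHN : ∀ {β}, β ∈ Metric.ball (0 : E) δ → ∀ {s : E}, ‖s‖ < R → H s (σ β) ∈ N :=
    fun hβ s hs => (hball _ hβ).2.1.2 s (mem_closedBall_zero_iff.2 hs.le)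
  have hΛs : ∀ {β}, β ∈ Metric.ball (0 : E) δ → ContDiffAt ℝ ∞ Λ β := fun hβ =>
    (hball _ hβ).2.2.1
  have hnorm : ∀ {β}, β ∈ Metric.ball (0 : E) δ → ∀ {θ : E}, θ ∈ cube n 2 → ‖Λ β θ‖ < R := by
    intro β hβ θ hθ
    calc ‖Λ β θ‖ ≤ ‖Λ β‖ * ‖θ‖ := (Λ β).le_opNorm θ
      _ ≤ (‖Λ 0‖ + 1) * ‖θ‖ := mul_le_mul_of_nonneg_right (hball _ hβ).2.2.2.1.le (norm_nonneg _)
      _ < R := mul_lt_mul_of_pos_left (hcube θ hθ) (by positivity)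
  have hinv : ∀ {β}, β ∈ Metric.ball (0 : E) δ → (Λ β).IsInvertible := fun hβ =>
    (hball _ hβ).2.2.2.2.1
  have hper : ∀ {β}, β ∈ Metric.ball (0 : E) δ → ∀ {v : E}, v ∈ cube n 2 →
      (H (Λ β v) (σ β) = σ β ↔ ∃ k : Fin n → ℤ, ∀ i, v i = k i) := by
    intro β hβ v hv
    refine ⟨(hball _ hβ).2.2.2.2.2.2 v hv, ?_⟩
    rintro ⟨k, hk⟩
    have hkv : v = WithLp.toLp 2 fun i => (k i : ℝ) := by
      ext i
      exact hk i
    rw [hkv]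
    refine (hball _ hβ).2.2.2.2.2.1 k fun i => ?_
    have := hv i
    rw [hk] at this
    have h2 : ((|k i| : ℤ) : ℝ) ≤ ((2 : ℤ) : ℝ) := by
      rw [Int.cast_abs]
      exact this.trans_eq (by norm_num)
    exact Int.cast_le.1 h2
  have hadd : ∀ {β}, β ∈ Metric.ball (0 : E) δ → ∀ {s s' : E}, ‖s‖ < R → ‖s'‖ < R →
      H s (H s' (σ β)) = H (s + s') (σ β) := by
    intro β hβ s s' hs hs'
    exact hN.add _ (hσN hβ) s s' (by linarith) (by linarith)
      (by linarith [norm_add_le s s']) (hHN hβ hs')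
  have hsub : ∀ {β β'}, β ∈ Metric.ball (0 : E) δ → β' ∈ Metric.ball (0 : E) δ → ∀ {s s' : E},
      ‖s‖ < R → ‖s'‖ < R → (H s (σ β) = H s' (σ β') ↔ H (s - s') (σ β) = σ β') := by
    intro β β' hβ hβ' s s' hs hs'
    constructor
    · intro heq
      have h1 := congrArg (H (-s')) heq
      rw [hadd hβ (by rwa [norm_neg]) hs, hadd hβ' (by rwa [norm_neg]) hs', neg_add_cancel,
        hN.zero (hσN hβ')] at h1
      rw [← h1]
      congr 1
      abel
    · intro heq
      have h1 := hN.add _ (hσN hβ) s' (s - s') (by linarith)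
        (by linarith [norm_sub_le s s']) (by rw [add_sub_cancel]; linarith)
        (by rw [heq]; exact hσN hβ')
      rw [add_sub_cancel, heq] at h1
      exact h1.symm
  have hHs : ∀ {p}, p ∈ N → ∀ {s : E}, ‖s‖ < 3 * R →
      ContMDiffAt (𝓘(ℝ, E).prod (𝓡 d)) (𝓡 d) ∞ (fun z : E × M => H z.1 z.2) (s, p) := by
    intro p hp s hs
    exact hN.smooth.contMDiffAt ((Metric.isOpen_ball.prod hN.isOpen).mem_nhds
      ⟨mem_ball_zero_iff.2 hs, hp⟩)
  have h00 : (0 : E) ∈ cube n 1 := fun i => by simp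
  refine ⟨δ, hδ, ⟨?_, ?_, ?_, ?_, ?_⟩, ?_⟩
  · intro θ hθ β hβ
    have h1 : ContMDiffAt 𝓘(ℝ, E × E) 𝓘(ℝ, E) ∞ (fun z : E × E => Λ z.2 z.1) (θ, β) :=
      ((ContDiffAt.comp (g := Λ) (f := fun z : E × E => z.2) (θ, β) (hΛs hβ)
        contDiffAt_snd).clm_apply contDiffAt_fst).contMDiffAt
    have h2 : ContMDiffAt 𝓘(ℝ, E × E) (𝓡 d) ∞ (fun z : E × E => σ z.2) (θ, β) :=
      (hψ.contMDiffAt_slice (htgt hβ)).comp (g := σ) (f := fun z : E × E => z.2) (θ, β)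
        contDiffAt_snd.contMDiffAt
    exact ContMDiffAt.comp (g := fun z : E × M => H z.1 z.2)
      (f := fun z : E × E => (Λ z.2 z.1, σ z.2)) (θ, β)
      (hHs (hσN hβ) ((hnorm hβ (hc1 hθ)).trans (by linarith))) (h1.prodMk h2)
  · intro θ hθ θ' hθ' β hβ β' hβ'
    have hv : θ - θ' ∈ cube n 2 := by
      have := sub_mem_cube hθ hθ'
      norm_num at this
      exact this
    rw [hsub hβ hβ' (hnorm hβ (hc1 hθ)) (hnorm hβ' (hc1 hθ'))]
    constructor
    · intro heq
      -- The flow preserves the transverse coordinate, also over `Z`, so equal points have equal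
      -- transverse parameters.
      have hββ : β = β' := by
        have h1 := hN.snd_eq hD hJ (s := Λ β θ - Λ β' θ')
          (by linarith [norm_sub_le (Λ β θ) (Λ β' θ'), hnorm hβ (hc1 hθ), hnorm hβ' (hc1 hθ')])
          (hσN hβ) (hσψ hβ) (by rw [heq]; exact hσψ hβ')
        rw [heq, hψσ hβ, hψσ hβ'] at h1
        simpa using h1.symm
      subst hββ
      rw [← map_sub, hper hβ hv] at heq
      exact ⟨heq, rfl⟩
    · rintro ⟨hk, rfl⟩
      rw [← map_sub, hper hβ hv]
      exact hk
  · intro θ hθ β hβ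
    have hs := hnorm hβ (hc1 hθ)
    set s := Λ β θ with hsdef
    set p := H s (σ β) with hp
    have hpN : p ∈ N := hHN hβ hs
    have hq : H (-s) p = σ β := by
      rw [hp, hadd hβ (by rwa [norm_neg]) hs, neg_add_cancel, hN.zero (hσN hβ)]
    have hqs : ContMDiffAt (𝓡 d) (𝓡 d) ∞ (fun p => H (-s) p) p :=
      ContMDiffAt.comp (g := fun z : E × M => H z.1 z.2) (f := fun p => (-s, p)) p
        (hHs hpN (by rw [norm_neg]; linarith)) (contMDiffAt_const.prodMk contMDiffAt_id)
    -- To invert `P`, flow back by `s` into the box around the slice. The first coordinate there is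
    -- the remaining time `τ`, the second the transverse parameter; `κ` adds `τ` to `s` and applies
    -- the inverse of the period map.
    let ζ : M → E × E := fun p => ψ (H (-s) p) - ψ m
    have hζp : ζ p = (0, β) := by
      simp only [ζ]
      rw [hq, hψσ hβ, add_sub_cancel_left]
    have hζ : ContMDiffAt (𝓡 d) 𝓘(ℝ, E × E) ∞ ζ p := by
      have h1 : ContMDiffAt (𝓡 d) 𝓘(ℝ, E × E) ∞ ψ (H (-s) p) := by
        rw [hq]
        exact (hψ.smooth _ (hσψ hβ)).contMDiffAt (ψ.open_source.mem_nhds (hσψ hβ))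
      exact (h1.comp p hqs).sub contMDiffAt_const
    let κ : E × E → E × E := fun z => ((Λ z.2).inverse (s + z.1), z.2)
    have hκ : ContDiffAt ℝ ∞ κ (0, β) := by
      have h1 : ContDiffAt ℝ ∞ (fun z : E × E => Λ z.2) (0, β) :=
        ContDiffAt.comp (g := Λ) (f := fun z : E × E => z.2) (0, β) (hΛs hβ) contDiffAt_snd
      obtain ⟨e, he⟩ := hinv hβ
      have h2 : ContDiffAt ℝ ∞ ContinuousLinearMap.inverse (Λ β) := by
        rw [← he]
        exact contDiffAt_map_inverse e
      exact ((ContDiffAt.comp (g := ContinuousLinearMap.inverse) (f := fun z : E × E => Λ z.2)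
        (0, β) h2 h1).clm_apply (contDiffAt_const.add contDiffAt_fst)).prodMk contDiffAt_snd
    refine ⟨κ ∘ ζ, ?_, ?_, ?_⟩
    · refine ContMDiffAt.comp (g := κ) p ?_ hζ
      rw [hζp]
      exact hκ.contMDiffAt
    · have h1 : κ (ζ p) = (θ, β) := by
        rw [hζp]
        refine Prod.ext ?_ rfl
        simp only [κ, add_zero]
        rw [hsdef]
        exact (hinv hβ).inverse_apply_self θ
      exact h1
    · have hqt : Filter.Tendsto (fun p => H (-s) p) (𝓝 p) (𝓝 (σ β)) := by
        have := hqs.continuousAt.tendsto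
        rwa [hq] at this
      have hζt : Filter.Tendsto ζ (𝓝 p) (𝓝 (0, β)) := by
        have := hζ.continuousAt.tendsto
        rwa [hζp] at this
      have hζ1 : Filter.Tendsto (fun p => (ζ p).1) (𝓝 p) (𝓝 0) :=
        (continuous_fst.tendsto ((0, β) : E × E)).comp hζt
      have hζ2 : Filter.Tendsto (fun p => (ζ p).2) (𝓝 p) (𝓝 β) :=
        (continuous_snd.tendsto ((0, β) : E × E)).comp hζt
      have hσt : Filter.Tendsto (fun p => σ (ζ p).2) (𝓝 p) (𝓝 (σ β)) :=
        (hψ.contMDiffAt_slice (htgt hβ)).continuousAt.tendsto.comp hζ2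
      filter_upwards [hN.isOpen.mem_nhds hpN, hqt.eventually (hN.isOpen.mem_nhds (hσN hβ)),
        hqt.eventually (ψ.open_source.mem_nhds (hσψ hβ)),
        hζ2.eventually (Metric.isOpen_ball.mem_nhds hβ),
        hζ1.norm.eventually_lt_const (show ‖(0 : E)‖ < R by simpa using hRpos),
        (hζ1.prodMk_nhds hσt).eventually (hN.box _ (hσN hβ) ψ hψ (hσψ hβ))]
        with p' h1 h2 h3 h4 h5 h6
      have h7 : Λ (ζ p').2 ((Λ (ζ p').2).inverse (s + (ζ p').1)) = s + (ζ p').1 :=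
        (hinv h4).self_apply_inverse _
      have h8 : ψ m + (0, (ζ p').2) + ((ζ p').1, 0) = ψ (H (-s) p') := by
        simp only [ζ]
        refine Prod.ext ?_ ?_ <;> simp
      have h9 : H (ζ p').1 (σ (ζ p').2) = H (-s) p' := by
        rw [h6, hψσ h4, h8, ψ.left_inv h3]
      have h10 := hN.add p' h1 s (-s) (by linarith) (by rw [norm_neg]; linarith)
        (by rw [add_neg_cancel, norm_zero]; linarith) h2
      rw [add_neg_cancel, hN.zero h1] at h10
      show H (Λ (ζ p').2 ((Λ (ζ p').2).inverse (s + (ζ p').1))) (σ (ζ p').2) = p'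
      rw [h7, ← hadd h4 hs h5, h9, h10]
  · intro θ hθ β hβ
    simp only [map_zero]
    rw [hN.zero (hσN hβ)]
    exact hN.mem_leaf _ (hσN hβ) _ (by linarith [hnorm hβ (hc1 hθ)])
  · intro θ hθ β hβ γ hγ r₀ hr₀
    have hθ1 : θ ∈ cube n 1 := cube_mono n (by norm_num) hθ
    have hs := hnorm hβ (hc1 hθ1)
    have hpN : γ r₀ ∈ N := by
      rw [hr₀]
      exact hHN hβ hs
    -- A time `a` with `‖a‖ < η` changes each angle by less than `1 / 2`, so angles from `cube n (1
    -- / 2)` stay in `cube n 1`.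
    obtain ⟨η, hη, hηb⟩ := Metric.continuousAt_iff.1
      ((Λ β).inverse.continuous.continuousAt (x := 0)) (1 / 2) (by norm_num)
    filter_upwards [hN.eventually_exists_eq hγ hpN (lt_min hη hRpos)] with r hr
    obtain ⟨a, ha, hra⟩ := hr
    refine ⟨(Λ β).inverse a + θ, fun i => ?_, ?_⟩
    · have h1 := hηb (x := a) (by rw [dist_zero_right]; exact ha.trans_le (min_le_left _ _))
      rw [map_zero, dist_zero_right] at h1
      have h2 := PiLp.norm_apply_le ((Λ β).inverse a) i
      rw [Real.norm_eq_abs] at h2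
      have h3 := hθ i
      calc |((Λ β).inverse a + θ) i| = |(Λ β).inverse a i + θ i| := rfl
        _ ≤ |(Λ β).inverse a i| + |θ i| := abs_add_le _ _
        _ ≤ 1 := by linarith
    · rw [hra, hr₀]
      simp only
      rw [map_add, (hinv hβ).self_apply_inverse, hadd hβ (ha.trans_le (min_le_right _ _)) hs]
  · rw [map_zero, hσdef, slice_zero hmψ, hN.zero (hN.leaf_subset hm)]

end Tubes

end BSymplectic

namespace BSymplectic

/-! ### Smooth angles on the torus. -/

section TorusCalculus

variable {n : ℕ} {F : Type*} [NormedAddCommGroup F] [NormedSpace ℝ F] {K : Type*}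
  [TopologicalSpace K] {I : ModelWithCorners ℝ F K} {Q : Type*} [TopologicalSpace Q]
  [ChartedSpace K Q]

theorem contMDiffAt_torus {f : Q → Torus n} {x : Q}
    (hf : ∀ i, ContMDiffAt I (𝓡 1) ∞ (fun y => f y i) x) : ContMDiffAt I (torusModel n) ∞ f x := by
  rw [contMDiffAt_iff_target]
  refine ⟨continuousAt_pi.2 fun i => (hf i).continuousAt, ?_⟩
  exact contMDiffAt_pi_space.2 fun i => (contMDiffAt_iff_target.1 (hf i)).2

theorem contMDiff_torus_apply (i : Fin n) :
    ContMDiff (torusModel n) (𝓡 1) ∞ (fun z : Torus n => z i) := by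
  intro z
  rw [contMDiffAt_iff_target]
  refine ⟨(continuous_apply i).continuousAt, ?_⟩
  have h1 : ContMDiffAt (torusModel n) 𝓘(ℝ, Fin n → EuclideanSpace ℝ (Fin 1)) ∞
      (extChartAt (torusModel n) z) z := by
    rw [contMDiffAt_iff]
    refine ⟨continuousAt_extChartAt z, ?_⟩
    refine contDiffWithinAt_id.congr_of_eventuallyEq ?_
      ((extChartAt (torusModel n) z).right_inv (mem_extChartAt_target z))
    filter_upwards [extChartAt_target_mem_nhdsWithin (I := torusModel n) z] with v hv
      using (extChartAt (torusModel n) z).right_inv hv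
  exact contMDiffAt_pi_space.1 h1 i

attribute [local instance] finrank_real_complex_fact'

/-- Division by `w` moves the base point to `1`, away from the branch cut of the argument. -/
theorem contMDiffAt_arg_div (w : Circle) :
    ContMDiffAt (𝓡 1) 𝓘(ℝ, ℝ) ∞ (fun z : Circle => Complex.arg ((z / w : Circle) : ℂ)) w := by
  have h1 : ContMDiffAt (𝓡 1) 𝓘(ℝ, ℂ) ∞ (fun z : Circle => (z : ℂ)) w :=
    contMDiff_coe_sphere.contMDiffAt
  have hw : (w : ℂ) / w = 1 := div_self (Circle.coe_ne_zero w)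
  have h2 : ContDiffAt ℝ ∞ (fun z : ℂ => (Complex.log (z / w)).im) w := by
    have h3 : ContDiffAt ℝ ∞ Complex.log ((w : ℂ) / w) := by
      rw [hw]
      exact (Complex.contDiffAt_log Complex.one_mem_slitPlane).restrict_scalars ℝ
    have h4 : ContDiffAt ℝ ∞ (fun z : ℂ => Complex.log (z / w)) w :=
      ContDiffAt.comp (g := Complex.log) (f := fun z : ℂ => z / w) (w : ℂ) h3
        (contDiffAt_id.div_const _)
    exact Complex.imCLM.contDiff.contDiffAt.comp (w : ℂ) h4
  have h5 := h2.contMDiffAt.comp w h1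
  refine h5.congr_of_eventuallyEq (Filter.Eventually.of_forall fun z => ?_)
  have h6 : Complex.arg ((z / w : Circle) : ℂ) = (Complex.log ((z : ℂ) / w)).im := by
    rw [Complex.log_im, Circle.coe_div]
  exact h6

/-- The angles of a point of the torus, between `-1 / 2` and `1 / 2`. -/
noncomputable def angle (z : Torus n) : EuclideanSpace ℝ (Fin n) :=
  WithLp.toLp 2 fun i => Complex.arg (z i) / (2 * Real.pi)

/-- The point of the torus with the given angles. -/
noncomputable def torusExp (θ : EuclideanSpace ℝ (Fin n)) : Torus n :=
  fun i => Circle.exp (2 * Real.pi * θ i)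

theorem torusExp_angle (z : Torus n) : torusExp (angle z) = z := by
  funext i
  simp only [torusExp, angle]
  rw [mul_div_cancel₀ _ (by positivity), Circle.exp_arg]

theorem angle_mem_cube (z : Torus n) : angle z ∈ cube n (1 / 2) := by
  intro i
  have h1 := Complex.abs_arg_le_pi (z i)
  simp only [angle]
  rw [abs_div, abs_of_pos (by positivity : (0 : ℝ) < 2 * Real.pi), div_le_iff₀ (by positivity)]
  linarith

theorem torusExp_eq_iff {θ θ' : EuclideanSpace ℝ (Fin n)} :
    torusExp θ = torusExp θ' ↔ ∃ k : Fin n → ℤ, ∀ i, θ i - θ' i = k i := by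
  rw [funext_iff, ← Classical.skolem (p := fun (i : Fin n) (k : ℤ) => θ i - θ' i = k)]
  refine forall_congr' fun i => ?_
  simp only [torusExp, Circle.exp_eq_exp]
  refine exists_congr fun k => ?_
  have hpi := Real.pi_pos
  constructor
  · intro h
    have : 2 * Real.pi * (θ i - θ' i - k) = 0 := by linear_combination h
    have := (mul_eq_zero.1 this).resolve_left (by positivity)
    linarith
  · intro h
    linear_combination 2 * Real.pi * h

/-- The angles of `z` that are close to those of `w`. -/
noncomputable def angleNear (w z : Torus n) : EuclideanSpace ℝ (Fin n) :=
  WithLp.toLp 2 fun i =>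
    Complex.arg (w i) / (2 * Real.pi) + Complex.arg ((z i / w i : Circle) : ℂ) / (2 * Real.pi)

theorem angleNear_self (w : Torus n) : angleNear w w = angle w := by
  simp [angleNear, angle]

theorem torusExp_angleNear (w z : Torus n) : torusExp (angleNear w z) = z := by
  funext i
  simp only [torusExp, angleNear]
  rw [← add_div, mul_div_cancel₀ _ (by positivity), Circle.exp_add, Circle.exp_arg, Circle.exp_arg,
    mul_div_cancel]

theorem contMDiffAt_angleNear (w : Torus n) :
    ContMDiffAt (torusModel n) 𝓘(ℝ, EuclideanSpace ℝ (Fin n)) ∞ (angleNear w) w := by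
  have h1 : ContMDiffAt (torusModel n) 𝓘(ℝ, Fin n → ℝ) ∞ (fun (z : Torus n) (i : Fin n) =>
      Complex.arg (w i) / (2 * Real.pi) +
        Complex.arg ((z i / w i : Circle) : ℂ) / (2 * Real.pi)) w := by
    refine contMDiffAt_pi_space.2 fun i => ?_
    have h2 := (contMDiffAt_arg_div (w i)).comp w (contMDiff_torus_apply i w)
    have h3 : ContDiff ℝ ∞ fun x : ℝ => Complex.arg (w i) / (2 * Real.pi) + x / (2 * Real.pi) := by
      fun_prop
    exact h3.contMDiff.contMDiffAt.comp w h2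
  exact (EuclideanSpace.equiv (Fin n) ℝ).symm.contDiff.contMDiff.contMDiffAt.comp w h1

theorem contMDiff_torusExp :
    ContMDiff 𝓘(ℝ, EuclideanSpace ℝ (Fin n)) (torusModel n) ∞ (torusExp (n := n)) := by
  refine fun θ => contMDiffAt_torus fun i => ?_
  have h1 : ContDiff ℝ ∞ fun θ : EuclideanSpace ℝ (Fin n) => 2 * Real.pi * θ i := by fun_prop
  exact contMDiff_circleExp.contMDiffAt.comp θ h1.contMDiff.contMDiffAt

/-- Every point of the torus has angles in `cube n (1 / 2)`, while a tube is controlled on `cube n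
1`. The margin allows local arguments at the boundary of the fundamental domain. -/
theorem eventually_mem_cube {θ : EuclideanSpace ℝ (Fin n)} (hθ : θ ∈ cube n (1 / 2)) :
    ∀ᶠ θ' in 𝓝 θ, θ' ∈ cube n 1 := by
  refine Filter.eventually_all.2 fun i => ?_
  have hc : Continuous fun θ : EuclideanSpace ℝ (Fin n) => |θ i| := by fun_prop
  filter_upwards [hc.continuousAt.eventually_lt_const (show |θ i| < 1 by linarith [hθ i])] with θ' h
    using h.le

end TorusCalculus

/-! ### From a tube to a product of torus and ball. -/

namespace IsTube

variable {n d : ℕ} {M : Type*} [TopologicalSpace M] [ChartedSpace (EuclideanSpace ℝ (Fin d)) M]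
  [IsManifold (𝓡 d) ∞ M] {X : Fin n → VectorFields d M}
  {P : EuclideanSpace ℝ (Fin n) × EuclideanSpace ℝ (Fin n) → M} {δ : ℝ}

/-- The parametrization by the torus and the unit ball. -/
noncomputable def torusMap (P : EuclideanSpace ℝ (Fin n) × EuclideanSpace ℝ (Fin n) → M) (δ : ℝ)
    (z : Torus n × unitBall n) : M :=
  P (angle z.1, δ • z.2.1)

theorem smul_mem_ball (hδ : 0 < δ) (b : unitBall n) : δ • b.1 ∈ Metric.ball 0 δ := by
  have h1 : ‖b.1‖ < 1 := mem_ball_zero_iff.1 b.2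
  rw [mem_ball_zero_iff, norm_smul, Real.norm_eq_abs, abs_of_pos hδ]
  exact mul_lt_of_lt_one_right hδ h1

theorem angle_mem (z : Torus n) : angle z ∈ cube n 1 :=
  cube_mono n (by norm_num) (angle_mem_cube z)

theorem apply_eq_torusMap (h : IsTube X P δ) (hδ : 0 < δ) {θ : EuclideanSpace ℝ (Fin n)}
    (hθ : θ ∈ cube n 1) (b : unitBall n) : P (θ, δ • b.1) = torusMap P δ (torusExp θ, b) := by
  refine (h.eq_iff _ hθ _ (angle_mem _) _ (smul_mem_ball hδ b) _ (smul_mem_ball hδ b)).2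
    ⟨torusExp_eq_iff.1 ?_, rfl⟩
  rw [torusExp_angle]

theorem torusMap_injective (h : IsTube X P δ) (hδ : 0 < δ) :
    Function.Injective (torusMap P δ) := by
  rintro ⟨z, b⟩ ⟨z', b'⟩ heq
  obtain ⟨h1, h2⟩ := (h.eq_iff _ (angle_mem _) _ (angle_mem _) _ (smul_mem_ball hδ b) _
    (smul_mem_ball hδ b')).1 heq
  have h3 := torusExp_eq_iff.2 h1
  rw [torusExp_angle, torusExp_angle] at h3
  exact Prod.ext h3 (Subtype.ext (smul_right_injective _ hδ.ne' h2))

/-- `angle` jumps at the branch cut, but near `w` it differs from the smooth `angleNear w` by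
integers, which `P` does not see. -/
theorem contMDiff_torusMap (h : IsTube X P δ) (hδ : 0 < δ) :
    ContMDiff ((torusModel n).prod (𝓡 n)) (𝓡 d) ∞ (torusMap P δ) := by
  let E := EuclideanSpace ℝ (Fin n)
  rintro ⟨w, b⟩
  have h1 : ContMDiffAt ((torusModel n).prod (𝓡 n)) 𝓘(ℝ, E) ∞
      (fun z : Torus n × unitBall n => angleNear w z.1) (w, b) :=
    (contMDiffAt_angleNear w).comp (g := angleNear w) (f := fun z : Torus n × unitBall n => z.1)
      (w, b) contMDiffAt_fst
  have h2 : ContMDiffAt ((torusModel n).prod (𝓡 n)) 𝓘(ℝ, E) ∞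
      (fun z : Torus n × unitBall n => δ • z.2.1) (w, b) :=
    (δ • ContinuousLinearMap.id ℝ E).contDiff.contMDiff.contMDiffAt.comp (w, b)
      ((contMDiff_subtype_val (U := unitBall n)).contMDiffAt.comp (w, b) contMDiffAt_snd)
  have h3 : ContMDiffAt 𝓘(ℝ, E × E) (𝓡 d) ∞ P (angleNear w w, δ • b.1) := by
    rw [angleNear_self]
    exact h.smooth _ (angle_mem w) _ (smul_mem_ball hδ b)
  refine (ContMDiffAt.comp (g := P)
    (f := fun z : Torus n × unitBall n => (angleNear w z.1, δ • z.2.1)) (w, b) h3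
    (h1.prodMk_space h2)).congr_of_eventuallyEq ?_
  have h4 := h1.continuousAt.tendsto
  simp only [angleNear_self] at h4
  filter_upwards [h4.eventually (eventually_mem_cube (angle_mem_cube w))] with z hz
  rw [Function.comp, h.apply_eq_torusMap hδ hz, torusExp_angleNear]

/-- Near a point of the tube the parametrization has a smooth right inverse. -/
theorem exists_torusMap_inverse (h : IsTube X P δ) (hδ : 0 < δ) (z : Torus n × unitBall n) :
    ∃ (f : M → Torus n) (g : M → EuclideanSpace ℝ (Fin n)),
      ContMDiffAt (𝓡 d) (torusModel n) ∞ f (torusMap P δ z) ∧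
      ContMDiffAt (𝓡 d) (𝓡 n) ∞ g (torusMap P δ z) ∧
      ∀ᶠ p in 𝓝 (torusMap P δ z), ∃ hp : g p ∈ unitBall n, torusMap P δ (f p, ⟨g p, hp⟩) = p := by
  let E := EuclideanSpace ℝ (Fin n)
  obtain ⟨Φ, hΦs, hΦ, hΦi⟩ := h.exists_inverse _ (angle_mem z.1) _ (smul_mem_ball hδ z.2)
  have h1 : ContMDiffAt (𝓡 d) 𝓘(ℝ, E) ∞ (fun p => (Φ p).1) (torusMap P δ z) :=
    contDiff_fst.contMDiff.contMDiffAt.comp _ hΦs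
  have h2 : ContMDiffAt (𝓡 d) 𝓘(ℝ, E) ∞ (fun p => (Φ p).2) (torusMap P δ z) :=
    contDiff_snd.contMDiff.contMDiffAt.comp _ hΦs
  refine ⟨fun p => torusExp (Φ p).1, fun p => δ⁻¹ • (Φ p).2,
    contMDiff_torusExp.contMDiffAt.comp _ h1,
    (δ⁻¹ • ContinuousLinearMap.id ℝ E).contDiff.contMDiff.contMDiffAt.comp _ h2, ?_⟩
  have h3 := h1.continuousAt.tendsto
  have h4 := h2.continuousAt.tendsto
  have h5 : Φ (torusMap P δ z) = (angle z.1, δ • z.2.1) := hΦ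
  rw [h5] at h3 h4
  filter_upwards [hΦi, h3.eventually (eventually_mem_cube (angle_mem_cube z.1)),
    h4.eventually (Metric.isOpen_ball.mem_nhds (smul_mem_ball hδ z.2))] with p h6 h7 h8
  have hp : δ⁻¹ • (Φ p).2 ∈ unitBall n := by
    refine mem_ball_zero_iff.2 ?_
    rw [norm_smul, Real.norm_eq_abs, abs_of_pos (by positivity), inv_mul_lt_iff₀ hδ, mul_one]
    exact mem_ball_zero_iff.1 h8
  refine ⟨hp, ?_⟩
  rw [← h.apply_eq_torusMap hδ h7]
  simp only
  rw [smul_inv_smul₀ hδ.ne']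
  exact h6

theorem isOpen_range_torusMap (h : IsTube X P δ) (hδ : 0 < δ) :
    IsOpen (Set.range (torusMap P δ)) := by
  rw [isOpen_iff_eventually]
  rintro _ ⟨z, rfl⟩
  obtain ⟨f, g, -, -, hfg⟩ := h.exists_torusMap_inverse hδ z
  filter_upwards [hfg] with p hp
  exact ⟨_, hp.choose_spec⟩

/-- A tangent curve cannot leave the torus with parameter `z.2`: the times spent on it form a closed
set, because the torus is the image of a compact cube, and an open set by `IsTube.curve`.
Conversely, all points of this torus lie on the leaf of `P (0, δ • z.2.1)`. -/
theorem tangentLeaf_torusMap [T2Space M] (h : IsTube X P δ) (hδ : 0 < δ)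
    (z : Torus n × unitBall n) :
    tangentLeaf X (torusMap P δ z) = {p | ∃ w, torusMap P δ (w, z.2) = p} := by
  have hβ := smul_mem_ball hδ z.2
  ext p
  constructor
  · rintro ⟨γ, hγ, h0, rfl⟩
    let S : Set ℝ := γ ⁻¹' ((fun θ => P (θ, δ • z.2.1)) '' cube n 1)
    have hclosed : IsClosed S := by
      refine IsClosed.preimage hγ.smooth.continuous (IsCompact.isClosed ?_)
      refine (isCompact_cube n 1).image_of_continuousOn fun θ hθ => ?_
      exact (ContinuousAt.comp (g := P) (f := fun θ => (θ, δ • z.2.1))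
        (h.smooth θ hθ _ hβ).continuousAt (by fun_prop)).continuousWithinAt
    have hopen : IsOpen S := by
      rw [isOpen_iff_eventually]
      rintro r₀ ⟨θ, hθ, hr₀⟩
      have h1 : γ r₀ = P (angle (torusExp θ), δ • z.2.1) := by
        rw [← hr₀]
        exact h.apply_eq_torusMap hδ hθ z.2
      filter_upwards [h.curve _ (angle_mem_cube _) _ hβ γ hγ r₀ h1] with r hr
      obtain ⟨θ', hθ', hr⟩ := hr
      exact ⟨θ', hθ', hr.symm⟩
    have huniv : S = Set.univ := IsClopen.eq_univ ⟨hclosed, hopen⟩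
      ⟨0, angle z.1, angle_mem z.1, h0.symm⟩
    obtain ⟨θ, hθ, h1⟩ : (1 : ℝ) ∈ S := huniv ▸ Set.mem_univ _
    exact ⟨torusExp θ, by rw [← h.apply_eq_torusMap hδ hθ]; exact h1⟩
  · rintro ⟨w, rfl⟩
    exact mem_tangentLeaf_trans (mem_tangentLeaf_symm (h.mem_leaf _ (angle_mem z.1) _ hβ))
      (h.mem_leaf _ (angle_mem w) _ hβ)

theorem linearIndependent_torusMap (h : IsTube X P δ) (hδ : 0 < δ) (z : Torus n × unitBall n) :
    LinearIndependent ℝ fun i => X i (torusMap P δ z) :=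
  linearIndependent_of_mem_tangentLeaf (h.mem_leaf _ (angle_mem z.1) _ (smul_mem_ball hδ z.2))

/-- The tube is diffeomorphic to the product of the torus and the ball. -/
theorem exists_diffeomorph (h : IsTube X P δ) (hδ : 0 < δ) :
    ∃ (U : TopologicalSpace.Opens M)
      (φ : U ≃ₘ^∞⟮𝓡 d, (torusModel n).prod (𝓡 n)⟯ (Torus n × unitBall n)),
      ∀ z, ((φ.symm z : U) : M) = torusMap P δ z := by
  let U : TopologicalSpace.Opens M := ⟨Set.range (torusMap P δ), h.isOpen_range_torusMap hδ⟩
  let e : Torus n × unitBall n ≃ U := Equiv.ofInjective _ (h.torusMap_injective hδ)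
  have he : ∀ z, ((e z : U) : M) = torusMap P δ z := fun z => rfl
  have hsmooth : ContMDiff ((torusModel n).prod (𝓡 n)) (𝓡 d) ∞ e := fun z =>
    (ContMDiffAt.subtypeVal_comp_iff U e z).1 (h.contMDiff_torusMap hδ z)
  have hinv : ContMDiff (𝓡 d) ((torusModel n).prod (𝓡 n)) ∞ e.symm := by
    intro p
    obtain ⟨z, rfl⟩ := e.surjective p
    obtain ⟨f, g, hf, hg, hfg⟩ := h.exists_torusMap_inverse hδ z
    have hev : ∀ᶠ q : U in 𝓝 (e z), (e.symm q).1 = f q ∧ (e.symm q).2.1 = g q := by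
      have hc : Filter.Tendsto (Subtype.val : U → M) (𝓝 (e z)) (𝓝 (torusMap P δ z)) :=
        continuous_subtype_val.tendsto (e z)
      filter_upwards [hc.eventually hfg] with q hq
      obtain ⟨hp, hq⟩ := hq
      have h1 : e.symm q = (f q, ⟨g q, hp⟩) := e.symm_apply_eq.2 (Subtype.ext hq.symm)
      rw [h1]
      exact ⟨rfl, rfl⟩
    have h1 : ContMDiffAt (𝓡 d) (torusModel n) ∞ (fun q : U => (e.symm q).1) (e z) :=
      (contMDiffAt_subtype_iff (U := U) (x := e z).2 hf).congr_of_eventuallyEq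
        (hev.mono fun q hq => hq.1)
    have h2 : ContMDiffAt (𝓡 d) (𝓡 n) ∞ (fun q : U => (e.symm q).2) (e z) := by
      rw [← ContMDiffAt.subtypeVal_comp_iff]
      exact (contMDiffAt_subtype_iff (U := U) (x := e z).2 hg).congr_of_eventuallyEq
        (hev.mono fun q hq => hq.2)
    exact h1.prodMk h2
  exact ⟨U, ⟨e.symm, hinv, hsmooth⟩, he⟩

end IsTube

end BSymplectic

/-! ### Tubes around compact leaves in `Z`, and the theorem. -/

namespace BSymplectic

namespace BIntegrableSystem

variable {n : ℕ} {M : Type*} [TopologicalSpace M]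
  [ChartedSpace (EuclideanSpace ℝ (Fin (2 * n))) M] [IsManifold (𝓡 (2 * n)) ∞ M]
  {Z : Set M} {Ω : BBilinForm (2 * n) Z}

/-- The leaf of a point of `Z` is contained in `Z`. -/
theorem tangentLeaf_subset (F : BIntegrableSystem Ω) (hZ : IsHypersurface (2 * n) Z)
    (hΩ : IsBSymplectic Ω) {V : Set M} {t : M → ℝ} (hV : Z ⊆ V)
    (ht : IsDefiningFunction (2 * n) Z V t) {m : M} (hm : m ∈ Z) :
    tangentLeaf (fun i => (F.X i).1) m ⊆ Z := by
  rintro _ ⟨γ, hγ, h0, rfl⟩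
  have hopen : IsOpen (γ ⁻¹' Z) := by
    rw [isOpen_iff_eventually]
    intro r₀ (hr₀ : γ r₀ ∈ Z)
    obtain ⟨ψ, hψ, hxψ, hsV, hlevel, -⟩ := F.exists_isFlowBox hZ hΩ ht (hV hr₀) hr₀
      (hγ.tangent r₀).1
    filter_upwards [hψ.eventually_snd_eq hγ hxψ] with r hr
    -- The sign of `t` is part of the level and hence constant on the slice, so `t` stays zero along
    -- the curve.
    have h1 := congrArg Prod.fst (hlevel _ hr.1 _ hxψ hr.2)
    have h2 : SignType.sign (t (γ r)) = SignType.sign (t (γ r₀)) := h1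
    rw [(ht.mem_iff _ (hV hr₀)).1 hr₀, sign_zero, sign_eq_zero_iff] at h2
    exact (ht.mem_iff _ (hsV hr.1)).2 h2
  have huniv : γ ⁻¹' Z = Set.univ :=
    IsClopen.eq_univ ⟨hZ.isClosed.preimage hγ.smooth.continuous, hopen⟩
      ⟨0, by rw [Set.mem_preimage, h0]; exact hm⟩
  exact (huniv ▸ Set.mem_univ _ : (1 : ℝ) ∈ γ ⁻¹' Z)

/-- A neighbourhood of a compact leaf in `Z` is a tube. -/
theorem exists_isTube [T2Space M] (F : BIntegrableSystem Ω) (hZ : IsHypersurface (2 * n) Z)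
    (hΩ : IsBSymplectic Ω) {V : Set M} {t : M → ℝ} (hV : Z ⊆ V)
    (ht : IsDefiningFunction (2 * n) Z V t) {m : M} (hm : m ∈ Z) (hreg : F.IsRegular m)
    (hL : IsCompact (tangentLeaf (fun i => (F.X i).1) m)) :
    ∃ P, ∃ δ > 0, IsTube (fun i => (F.X i).1) P δ ∧ P (0, 0) = m := by
  have hself : m ∈ tangentLeaf (fun i => (F.X i).1) m := mem_tangentLeaf_self hreg
  have hsub := F.tangentLeaf_subset hZ hΩ hV ht hm
  -- The flow has to preserve a quantity that makes sense in all boxes of the cover simultaneously.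
  -- Since the leaf lies in `Z`, boxes built from the normal form exist at each of its points.
  obtain ⟨ε, N, h, hε, hact⟩ := exists_isLocalAction (J := F.level t) hself hL fun x hx => by
    obtain ⟨ψ, hψ, hxψ, -, hlevel, -⟩ := F.exists_isFlowBox hZ hΩ ht (hV (hsub hx)) (hsub hx)
      (linearIndependent_of_mem_tangentLeaf hx)
    exact ⟨ψ, hψ, hxψ, hlevel⟩
  obtain ⟨H, hH⟩ := hact.exists_forall hε
  obtain ⟨ψ, hψ, hmψ, -, -, hlevel⟩ := F.exists_isFlowBox hZ hΩ ht (hV hm) hm hreg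
  obtain ⟨Λ, hΛ⟩ := exists_isPeriodMap hH hself hL hψ hmψ hZ.dense_compl hlevel
  obtain ⟨δ, hδ, htube, h0⟩ := BSymplectic.exists_isTube hH hself hψ hmψ hZ.dense_compl hlevel hΛ
  exact ⟨_, δ, hδ, htube, h0⟩

end BIntegrableSystem

end BSymplectic

theorem proposition4p2 {n : ℕ} {M : Type*} [TopologicalSpace M] [T2Space M] [SigmaCompactSpace M]
    [ChartedSpace (EuclideanSpace ℝ (Fin (2 * n))) M] [IsManifold (𝓡 (2 * n)) ∞ M]
    (Z : Set M) (hZ : BSymplectic.IsHypersurface (2 * n) Z)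
    (hnormal : BSymplectic.HasTrivialNormalBundle (2 * n) Z)
    (Ω : BSymplectic.BBilinForm (2 * n) Z) (hΩ : BSymplectic.IsBSymplectic Ω)
    (F : BSymplectic.BIntegrableSystem Ω)
    (m : M) (hmZ : m ∈ Z) (hreg : F.IsRegular m) (hcompact : IsCompact (F.leaf m)) :
    ∃ (U : TopologicalSpace.Opens M)
      (φ : U ≃ₘ^∞⟮𝓡 (2 * n), (BSymplectic.torusModel n).prod (𝓡 n)⟯
        (BSymplectic.Torus n × BSymplectic.unitBall n)),
      F.leaf m ⊆ (U : Set M) ∧ (∀ p : U, F.IsRegular p) ∧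
        ∀ p : U, F.leaf p = Subtype.val '' {q : U | (φ q).2 = (φ p).2} := by
  obtain ⟨V, t, hV, ht⟩ := hnormal
  rw [F.leaf_eq_tangentLeaf] at hcompact
  obtain ⟨P, δ, hδ, htube, h0⟩ := F.exists_isTube hZ hΩ hV ht hmZ hreg hcompact
  obtain ⟨U, φ, hφ⟩ := htube.exists_diffeomorph hδ
  have hp : ∀ p : U, (p : M) = BSymplectic.IsTube.torusMap P δ (φ p) := fun p => by
    rw [← hφ, φ.symm_apply_apply]
  have hleaf : ∀ p : U, F.leaf p = Subtype.val '' {q : U | (φ q).2 = (φ p).2} := by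
    intro p
    rw [F.leaf_eq_tangentLeaf, hp p, htube.tangentLeaf_torusMap hδ]
    ext x
    constructor
    · rintro ⟨w, rfl⟩
      exact ⟨φ.symm (w, (φ p).2), by simp, hφ _⟩
    · rintro ⟨q, hq, rfl⟩
      refine ⟨(φ q).1, ?_⟩
      rw [hp q, ← (hq : (φ q).2 = (φ p).2)]
  have hmU : m ∈ U := by
    have h00 : (0 : EuclideanSpace ℝ (Fin n)) ∈ BSymplectic.cube n 1 := fun i => by simp
    have h1 := htube.apply_eq_torusMap hδ h00 ⟨0, Metric.mem_ball_self one_pos⟩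
    rw [smul_zero, h0, ← hφ] at h1
    rw [h1]
    exact (φ.symm _).2
  refine ⟨U, φ, ?_, fun p => ?_, hleaf⟩
  · rw [hleaf ⟨m, hmU⟩]
    rintro _ ⟨q, -, rfl⟩
    exact q.2
  · have h1 := htube.linearIndependent_torusMap hδ (φ p)
    rw [← hp p] at h1
    exact h1
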